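/- Let $\omega_0,\gamma,T_-,\theta>0$ and $a,b\in\mathbb R$ with $b-a=\tfrac12$, $a\le 0$, $b\ge 0$. Let $\mathcal F:\mathbb R\to\mathbb R$ be a smooth $1$-periodic function with $\int_0^1\mathcal F(t)\,dt=0$, $\int_0^1\mathcal F(t)^2\,dt>0$ and $\sum_{\ell\in\mathbb Z}\ell^2|\tilde{\mathcal F}(\ell)|^2<\infty$, where $\tilde{\mathcal F}(\ell)=\int_0^1 e^{-2\pi i\ell t}\mathcal F(t)\,dt$. For $n\ge 1$ put $\theta_n=n^b\theta$ and $\mathcal F_n(t)=n^a\mathcal F(t/\theta_n)$, and consider the pinned harmonic chain of $n+1$ particles, with positions and momenta $(\mathbf q,\mathbf p)=(q_0,\dots,q_n,p_0,\dots,p_n)\in\mathbb R^{2(n+1)}$ and with the conventions $q_{-1}:=q_0$, $q_{n+1}:=q_n$, whose generator at time $t$ is $$\mathcal G_t G=\sum_{x=0}^n p_x\partial_{q_x}G+\sum_{x=0}^n\big(q_{x+1}+q_{x-1}-2q_x-\omega_0^2q_x\big)\partial_{p_x}G+\mathcal F_n(t)\,\partial_{p_n}G+\gamma\sum_{x=1}^n\big(G(\mathbf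 q,\mathbf p^x)-G(\mathbf q,\mathbf p)\big)+2\gamma\big(T_-\partial_{p_0}^2G-p_0\partial_{p_0}G\big),$$ where $\mathbf p^x$ is $\mathbf p$ with the sign of $p_x$ reversed. A periodic stationary state is a family $(\mu_t)_{t\ge0}$ of Borel probability measures on $\mathbb R^{2(n+1)}$ with $\mu_{t+\theta_n}=\mu_t$ that solves the forward equation $\partial_t\mu_t=\mathcal G_t^*\mu_t$, that is, $\frac{d}{dt}\int G\,d\mu_t=\int\mathcal G_tG\,d\mu_t$ for all $t\ge 0$ and all smooth compactly supported $G$. Let $$\mathcal E_x=\frac{p_x^2}{2}+\frac{(q_x-q_{x-1})^2}{2}+\frac{\omega_0^2q_x^2}{2},\qquad \langle\mathcal E_x\rangle_n=\frac1{\theta_n}\int_0^{\theta_n}\int\mathcal E_x\,d\mu_t\,dt,\qquad x=0,\dots,n.$$ Then there is a constant $C>0$, independent of $n$, such that for every $n=1,2,\dots$ and every periodic stationary state $(\mu_t)_{t\ge0}$ of the chain of $n+1$ particles, the energies $\mathcal E_x$ are integrable with respect to each $\mu_t$, the functions $t\mapsto\int\mathcal E_x\,d\mu_t$ are integrable over $[0,\theta_n]$,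 and $$\frac1{n+1}\sum_{x=0}^n\langle\mathcal E_x\rangle_n\le C .$$ -/

import Mathlib

open MeasureTheory
open scoped ContDiff

noncomputable section

namespace Chain

/-- Phase space `ℝ^{n+1} × ℝ^{n+1}` of a chain of `n + 1` particles labelled `0, …, n`;
a point is `z = (q, p)`, with positions `z.1` and momenta `z.2`. -/
abbrev Phase (n : ℕ) : Type := (Fin (n + 1) → ℝ) × (Fin (n + 1) → ℝ)

variable {n : ℕ}

/-- The site `x - 1`, where site `-1` is identified with site `0` (so `q_{-1} = q_0`). -/
def prevSite (x : Fin (n + 1)) : Fin (n + 1) := ⟨(x : ℕ) - 1, by omega⟩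

/-- The site `x + 1`, where site `n + 1` is identified with site `n` (so `q_{n+1} = q_n`). -/
def nextSite (x : Fin (n + 1)) : Fin (n + 1) := ⟨min ((x : ℕ) + 1) n, by omega⟩

/-- The Neumann discrete Laplacian `(Δ_N q)_x = q_{x+1} + q_{x-1} - 2 q_x`. -/
def neumannLaplacian (q : Fin (n + 1) → ℝ) (x : Fin (n + 1)) : ℝ :=
  q (nextSite x) + q (prevSite x) - 2 * q x

/-- The microscopic energy `𝓔_x = p_x² / 2 + (q_x - q_{x-1})² / 2 + ω₀² q_x² / 2`. -/
def energy (ω₀ : ℝ) (x : Fin (n + 1)) (z : Phase n) : ℝ :=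
  z.2 x ^ 2 / 2 + (z.1 x - z.1 (prevSite x)) ^ 2 / 2 + ω₀ ^ 2 * z.1 x ^ 2 / 2

/-- The partial derivative `∂_{q_x} G`. -/
def dq (x : Fin (n + 1)) (G : Phase n → ℝ) (z : Phase n) : ℝ :=
  fderiv ℝ G z (Pi.single x 1, 0)

/-- The partial derivative `∂_{p_x} G`. -/
def dp (x : Fin (n + 1)) (G : Phase n → ℝ) (z : Phase n) : ℝ :=
  fderiv ℝ G z (0, Pi.single x 1)

/-- The configuration in which the sign of the momentum at site `x` is flipped. -/
def flipMomentum (x : Fin (n + 1)) (z : Phase n) : Phase n :=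
  (z.1, Function.update z.2 x (-z.2 x))

/-- The Hamiltonian part of the generator, when the external force acting on the last
particle has the value `f`. -/
def hamiltonianPart (ω₀ f : ℝ) (G : Phase n → ℝ) (z : Phase n) : ℝ :=
  (∑ x, z.2 x * dq x G z)
    + (∑ x, (neumannLaplacian z.1 x - ω₀ ^ 2 * z.1 x) * dp x G z)
    + f * dp (Fin.last n) G z

/-- The momentum flips at the sites `1, …, n`. -/
def flipPart (G : Phase n → ℝ) (z : Phase n) : ℝ :=
  ∑ x ∈ Finset.univ.filter (fun x : Fin (n + 1) => x ≠ 0), (G (flipMomentum x z) - G z)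

/-- The Langevin thermostat at temperature `T` acting at site `0`:
`S_- G = T ∂²_{p_0} G - p_0 ∂_{p_0} G`. -/
def thermostatPart (T : ℝ) (G : Phase n → ℝ) (z : Phase n) : ℝ :=
  T * dp 0 (dp 0 G) z - z.2 0 * dp 0 G z

/-- The generator of the dynamics, when the external force has the value `f`. -/
def generator (ω₀ γ T f : ℝ) (G : Phase n → ℝ) (z : Phase n) : ℝ :=
  hamiltonianPart ω₀ f G z + γ * flipPart G z + 2 * γ * thermostatPart T G z

/-- `{μ_t, t ≥ 0}` is a periodic stationary state, of period `Θ`, of the chain driven by the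
external force `f t` at time `t`: a `Θ`-periodic family of probability measures that solves the
forward equation `∂_t μ_t = 𝒢_t^* μ_t` in the sense of smooth compactly supported test
functions. -/
structure IsPeriodicState (ω₀ γ T Θ : ℝ) (f : ℝ → ℝ) (μ : ℝ → Measure (Phase n)) : Prop where
  isProbabilityMeasure : ∀ t, 0 ≤ t → IsProbabilityMeasure (μ t)
  periodic : ∀ t, 0 ≤ t → μ (t + Θ) = μ t
  forward : ∀ G : Phase n → ℝ, ContDiff ℝ ∞ G → HasCompactSupport G → ∀ t, 0 ≤ t →
    HasDerivWithinAt (fun s => ∫ z, G z ∂(μ s)) (∫ z, generator ω₀ γ T (f t) G z ∂(μ t))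
      (Set.Ici 0) t

/-- The time average `⟨G⟩ = Θ⁻¹ ∫_0^Θ (∫ G dμ_t) dt` over a period. -/
def timeAverage (Θ : ℝ) (μ : ℝ → Measure (Phase n)) (G : Phase n → ℝ) : ℝ :=
  (1 / Θ) * ∫ t in (0 : ℝ)..Θ, ∫ z, G z ∂(μ t)

/-- The period `θ_n = n^b θ`. -/
def period (b θ : ℝ) (n : ℕ) : ℝ := (n : ℝ) ^ b * θ

/-- The force `𝓕_n(t) = n^a 𝓕(t / θ_n)`. -/
def force (a b θ : ℝ) (𝓕 : ℝ → ℝ) (n : ℕ) (t : ℝ) : ℝ :=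
  (n : ℝ) ^ a * 𝓕 (t / period b θ n)

/-- The Fourier coefficient `∫_0^1 e^{-2πiℓt} 𝓕(t) dt`. -/
def fourierCoefficient (𝓕 : ℝ → ℝ) (ℓ : ℤ) : ℂ :=
  ∫ t in (0 : ℝ)..1, Complex.exp (-2 * Real.pi * Complex.I * ℓ * t) * (𝓕 t : ℂ)

end Chain

end

/-! Split the second moments into means and covariances. On first moments the flips and the
thermostat act as a damping `2γ` at every site, so the means solve a pinned damped wave equation
forced at the last site. `periodic_response_bound` bounds their mean square over a period by the
squared sup norm of the force, uniformly in the length of the chain. The mean momenta solve the same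
equation with the derivative of the force as forcing, and that derivative is `O(n^(a-b)) =
O(n^(-1/2))`. Hence `∑ s_x = O(1/n)`, where `s_x` is the time average of the squared mean momentum
at `x`.

Let `K = ω₀² - Δ_N`, let `Q`, `A`, `P` be the period averages of the covariances qq, qp, pp, and let
`τ_x` be the averaged second moment of `p_x` for `x ≠ 0`, with `τ_0 = T`. The force cancels from the
covariance equations; it survives only through `τ_x = P_xx + s_x`, because a flip injects the full
second moment. Eliminating `A` gives `8γ²(KQ + QK) + [K,[K,Q]] = 16γ² diag τ` and `[K,[K,Q]] =
16γ²(diag τ - P)`. The commutator inequality `frob_comm_covOp_le` then bounds `‖[K, diag τ]‖²`,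
hence `∑ (τ_{x+1} - τ_x)²`, by a constant times `⟨diag τ, diag τ - P⟩`. As `diag τ - P` has trace
zero, `τ` may be replaced there by `τ - τ_0`, and the pairing is at most `sup |τ - T| · ∑ s`. By
Cauchy–Schwarz `sup |τ - T|²` is at most `n` times the gradient sum; dividing by the supremum, `sup
|τ - T| ≤ C n ∑ s = O(1)`. This is `trace_covariance_le`. The virial identity `tr(QK) = tr P`
controls the potential energy as well.

Since only compactly supported test functions are allowed, finiteness of second moments has to be
proved. `exists_lyapunov` finds a quadratic `V` with `𝒢_t V ≤ C - cV`, by solving a dual matrix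
equation whose unique solvability rests on the same commutator inequality. Concave truncations of
`V`, periodicity and Fatou's lemma give `exists_moment_bound`; after that
`integral_generator_quadPoly` makes all moment equations legitimate. -/

noncomputable section

namespace Chain

open Matrix

/-! ### Commutator inequalities for the stationary covariance operator -/

section Frobenius

variable {m : Type*} [Fintype m]

/-- The Frobenius inner product of two real matrices. -/
def frob (X Y : Matrix m m ℝ) : ℝ := (Xᵀ * Y).trace

/-- The commutator `[K, X]`. -/
def comm (K X : Matrix m m ℝ) : Matrix m m ℝ := K * X - X * K

lemma frob_eq_sum (X Y : Matrix m m ℝ) : frob X Y = ∑ y, ∑ x, X x y * Y x y := by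
  simp [frob, trace, Matrix.mul_apply]

lemma frob_comm (X Y : Matrix m m ℝ) : frob X Y = frob Y X := by
  simp only [frob_eq_sum, mul_comm]

lemma frob_add_left (X Y Z : Matrix m m ℝ) : frob (X + Y) Z = frob X Z + frob Y Z := by
  simp [frob, Matrix.add_mul]

lemma frob_sub_left (X Y Z : Matrix m m ℝ) : frob (X - Y) Z = frob X Z - frob Y Z := by
  simp [frob, Matrix.sub_mul]

lemma frob_smul_left (a : ℝ) (X Y : Matrix m m ℝ) : frob (a • X) Y = a * frob X Y := by
  simp [frob]

lemma frob_add_right (X Y Z : Matrix m m ℝ) : frob X (Y + Z) = frob X Y + frob X Z := by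
  simp [frob, Matrix.mul_add]

lemma frob_sub_right (X Y Z : Matrix m m ℝ) : frob X (Y - Z) = frob X Y - frob X Z := by
  simp [frob, Matrix.mul_sub]

lemma frob_smul_right (a : ℝ) (X Y : Matrix m m ℝ) : frob X (a • Y) = a * frob X Y := by
  simp [frob]

lemma frob_self_nonneg (X : Matrix m m ℝ) : 0 ≤ frob X X := by
  rw [frob_eq_sum]
  exact Finset.sum_nonneg fun _ _ => Finset.sum_nonneg fun _ _ => mul_self_nonneg _

lemma sq_le_frob_self (X : Matrix m m ℝ) (x y : m) : X x y ^ 2 ≤ frob X X := by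
  rw [frob_eq_sum, sq]
  refine le_trans ?_ (Finset.single_le_sum (f := fun y => ∑ x, X x y * X x y)
    (fun _ _ => Finset.sum_nonneg fun _ _ => mul_self_nonneg _) (Finset.mem_univ y))
  exact Finset.single_le_sum (f := fun x => X x y * X x y) (fun _ _ => mul_self_nonneg _)
    (Finset.mem_univ x)

lemma eq_zero_of_frob_self (X : Matrix m m ℝ) (h : frob X X ≤ 0) : X = 0 := by
  ext x y
  have := sq_le_frob_self X x y
  simpa using pow_eq_zero_iff (n := 2) (by norm_num) |>.1
    (le_antisymm (this.trans h) (sq_nonneg (X x y)))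

lemma frob_transpose (X Y : Matrix m m ℝ) : frob Xᵀ Yᵀ = frob X Y := by
  simp only [frob_eq_sum, transpose_apply]
  exact Finset.sum_comm

lemma frob_add_self_le (X Y : Matrix m m ℝ) :
    frob (X + Y) (X + Y) ≤ 2 * frob X X + 2 * frob Y Y := by
  have h := frob_self_nonneg (X - Y)
  simp only [frob_add_left, frob_sub_left, frob_add_right, frob_sub_right] at *
  linarith

lemma frob_sub_self_le (X Y : Matrix m m ℝ) :
    frob (X - Y) (X - Y) ≤ 2 * frob X X + 2 * frob Y Y := by
  have h := frob_self_nonneg (X + Y)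
  simp only [frob_add_left, frob_sub_left, frob_add_right, frob_sub_right] at *
  linarith

variable {K : Matrix m m ℝ}

lemma frob_mul_left (hK : Kᵀ = K) (X Y : Matrix m m ℝ) : frob (K * X) Y = frob X (K * Y) := by
  simp [frob, hK, Matrix.mul_assoc]

lemma frob_mul_right (hK : Kᵀ = K) (X Y : Matrix m m ℝ) : frob (X * K) Y = frob X (Y * K) := by
  rw [frob, frob, transpose_mul, hK, Matrix.mul_assoc, trace_mul_comm, Matrix.mul_assoc]

lemma frob_comm_left (hK : Kᵀ = K) (X Y : Matrix m m ℝ) :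
    frob (comm K X) Y = frob X (comm K Y) := by
  rw [comm, comm, frob_sub_left, frob_sub_right, frob_mul_left hK, frob_mul_right hK]

lemma le_frob_mul_left {c : ℝ} (h : ∀ v : m → ℝ, c * (v ⬝ᵥ v) ≤ v ⬝ᵥ K *ᵥ v)
    (X : Matrix m m ℝ) : c * frob X X ≤ frob (K * X) X := by
  rw [frob_comm (K * X), frob_eq_sum, frob_eq_sum, Finset.mul_sum]
  exact Finset.sum_le_sum fun y _ => h fun x => X x y

lemma frob_mul_right_eq (hK : Kᵀ = K) (X Y : Matrix m m ℝ) :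
    frob (X * K) Y = frob (K * Xᵀ) Yᵀ := by
  rw [← frob_transpose, transpose_mul, hK]

lemma le_frob_mul_right (hK : Kᵀ = K) {c : ℝ} (h : ∀ v : m → ℝ, c * (v ⬝ᵥ v) ≤ v ⬝ᵥ K *ᵥ v)
    (X : Matrix m m ℝ) : c * frob X X ≤ frob (X * K) X := by
  rw [frob_mul_right_eq hK, ← frob_transpose X]
  exact le_frob_mul_left h _

lemma frob_mul_left_le {κ : ℝ} (h : ∀ v : m → ℝ, (K *ᵥ v) ⬝ᵥ (K *ᵥ v) ≤ κ * (v ⬝ᵥ v))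
    (X : Matrix m m ℝ) : frob (K * X) (K * X) ≤ κ * frob X X := by
  rw [frob_eq_sum, frob_eq_sum, Finset.mul_sum]
  exact Finset.sum_le_sum fun y _ => h fun x => X x y

lemma frob_mul_right_le (hK : Kᵀ = K) {κ : ℝ}
    (h : ∀ v : m → ℝ, (K *ᵥ v) ⬝ᵥ (K *ᵥ v) ≤ κ * (v ⬝ᵥ v))
    (X : Matrix m m ℝ) : frob (X * K) (X * K) ≤ κ * frob X X := by
  rw [← frob_transpose, transpose_mul, hK, ← frob_transpose X]
  exact frob_mul_left_le h _

/-- The operator `W ↦ (g / 2) (K W + W K) + [K, [K, W]]` of the stationary covariance equation. -/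
def covOp (K : Matrix m m ℝ) (g : ℝ) (W : Matrix m m ℝ) : Matrix m m ℝ :=
  (g / 2) • (K * W + W * K) + comm K (comm K W)

lemma comm_add (X Y : Matrix m m ℝ) : comm K (X + Y) = comm K X + comm K Y := by
  simp only [comm, Matrix.mul_add, Matrix.add_mul]; abel

lemma comm_sub (X Y : Matrix m m ℝ) : comm K (X - Y) = comm K X - comm K Y := by
  simp only [comm, Matrix.mul_sub, Matrix.sub_mul]; abel

lemma comm_smul (a : ℝ) (X : Matrix m m ℝ) : comm K (a • X) = a • comm K X := by
  simp only [comm, Matrix.mul_smul, Matrix.smul_mul, smul_sub]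

lemma comm_mul_left (X : Matrix m m ℝ) : comm K (K * X) = K * comm K X := by
  simp only [comm, Matrix.mul_sub, Matrix.mul_assoc]

lemma comm_mul_right (X : Matrix m m ℝ) : comm K (X * K) = comm K X * K := by
  simp only [comm, Matrix.sub_mul, Matrix.mul_assoc]

/-- Both operators are polynomials in left and right multiplication by `K`, which commute. -/
lemma comm_covOp (g : ℝ) (W : Matrix m m ℝ) : comm K (covOp K g W) = covOp K g (comm K W) := by
  rw [covOp, covOp, comm_add, comm_smul, comm_add, comm_mul_left, comm_mul_right]

lemma frob_symm_mul_ge (hK : Kᵀ = K) {c g : ℝ} (hg : 0 ≤ g)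
    (h : ∀ v : m → ℝ, c * (v ⬝ᵥ v) ≤ v ⬝ᵥ K *ᵥ v) (X : Matrix m m ℝ) :
    g * c * frob X X ≤ frob ((g / 2) • (K * X + X * K)) X := by
  rw [frob_smul_left, frob_add_left]
  nlinarith [le_frob_mul_left h X, le_frob_mul_right hK h X]

/-- The commutator with `K` is self-adjoint for the Frobenius product and commutes with the
anticommutator. Moving one commutator across turns the first part of the pairing into the
anticommutator form at `[K, W]`, which is coercive; the second part is a square. -/
lemma frob_covOp_ge (hK : Kᵀ = K) {c g : ℝ} (hg : 0 ≤ g)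
    (h : ∀ v : m → ℝ, c * (v ⬝ᵥ v) ≤ v ⬝ᵥ K *ᵥ v) (W : Matrix m m ℝ) :
    g * c * frob (comm K W) (comm K W) + frob (comm K (comm K W)) (comm K (comm K W)) ≤
      frob (covOp K g W) (comm K (comm K W)) := by
  rw [covOp, frob_add_left, ← frob_comm_left hK ((g / 2) • _), comm_smul, comm_add,
    comm_mul_left, comm_mul_right]
  linarith [frob_symm_mul_ge hK hg h (comm K W)]

lemma frob_covOp_self_ge (hK : Kᵀ = K) {c g : ℝ} (hg : 0 ≤ g)
    (h : ∀ v : m → ℝ, c * (v ⬝ᵥ v) ≤ v ⬝ᵥ K *ᵥ v) (W : Matrix m m ℝ) :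
    g * c * frob W W ≤ frob (covOp K g W) W := by
  rw [covOp, frob_add_left, frob_comm_left hK]
  linarith [frob_symm_mul_ge hK hg h W, frob_self_nonneg (comm K W)]

/-- The key estimate. With `D = covOp K g W`, `X = [K, W]` and `Y = [K, X]`, the matrix `[K, D]` is
a combination of `KX + XK` and `[K, Y]`, so its square is at most `2g²κ‖X‖² + 8κ‖Y‖²`. Both norms
are controlled by `⟨D, Y⟩` through `frob_covOp_ge`. The constant depends on `K` only through its
spectral bounds, hence not on the dimension. -/
lemma frob_comm_covOp_le (hK : Kᵀ = K) {c g κ : ℝ} (hg : 0 < g) (hc : 0 < c) (hκ : 0 ≤ κ)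
    (h : ∀ v : m → ℝ, c * (v ⬝ᵥ v) ≤ v ⬝ᵥ K *ᵥ v)
    (h' : ∀ v : m → ℝ, (K *ᵥ v) ⬝ᵥ (K *ᵥ v) ≤ κ * (v ⬝ᵥ v)) (W : Matrix m m ℝ) :
    frob (comm K (covOp K g W)) (comm K (covOp K g W)) ≤
      (2 * g * κ / c + 8 * κ) * frob (covOp K g W) (comm K (comm K W)) := by
  have hge := frob_covOp_ge hK hg.le h W
  rw [comm_covOp, covOp]
  set X := comm K W
  set Y := comm K X
  have h1 : frob (comm K Y) (comm K Y) ≤ 4 * κ * frob Y Y := by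
    have := frob_sub_self_le (K * Y) (Y * K)
    rw [comm]
    linarith [frob_mul_left_le h' Y, frob_mul_right_le hK h' Y]
  have h2 : frob ((g / 2) • (K * X + X * K)) ((g / 2) • (K * X + X * K)) ≤
      g ^ 2 * κ * frob X X := by
    have := frob_add_self_le (K * X) (X * K)
    rw [frob_smul_left, frob_smul_right]
    have : frob (K * X + X * K) (K * X + X * K) ≤ 4 * κ * frob X X := by
      linarith [frob_mul_left_le h' X, frob_mul_right_le hK h' X]
    nlinarith [sq_nonneg g]
  have h3 := frob_add_self_le ((g / 2) • (K * X + X * K)) (comm K Y)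
  have hX := frob_self_nonneg X
  have hY := frob_self_nonneg Y
  have hC : 0 ≤ 2 * g * κ / c + 8 * κ := by positivity
  refine le_trans ?_ (mul_le_mul_of_nonneg_left hge hC)
  have e : (2 * g * κ / c + 8 * κ) * (g * c * frob X X + frob Y Y) =
      2 * g ^ 2 * κ * frob X X + 8 * κ * frob Y Y +
        (2 * g * κ / c * frob Y Y + 8 * κ * (g * c * frob X X)) := by
    field_simp
    ring
  rw [e]
  have : 0 ≤ 2 * g * κ / c * frob Y Y + 8 * κ * (g * c * frob X X) := by positivity
  linarith

/-- Coercivity gives injectivity, and the space of matrices is finite-dimensional. -/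
lemma covOp_surjective (hK : Kᵀ = K) {c g : ℝ} (hg : 0 < g) (hc : 0 < c)
    (h : ∀ v : m → ℝ, c * (v ⬝ᵥ v) ≤ v ⬝ᵥ K *ᵥ v) (D : Matrix m m ℝ) :
    ∃ W, covOp K g W = D := by
  classical
  let f : Matrix m m ℝ →ₗ[ℝ] Matrix m m ℝ :=
    { toFun := covOp K g
      map_add' := fun X Y => by
        simp only [covOp, comm_add, Matrix.mul_add, Matrix.add_mul, smul_add]; abel
      map_smul' := fun a X => by
        simp only [covOp, comm_smul, Matrix.mul_smul, Matrix.smul_mul, smul_add, smul_comm a,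
          RingHom.id_apply] }
  have hf : Function.Injective f := by
    rw [injective_iff_map_eq_zero]
    intro W hW
    have hW : covOp K g W = 0 := hW
    have := frob_covOp_self_ge hK hg.le h W
    rw [hW] at this
    refine eq_zero_of_frob_self W ?_
    have h0 : frob (0 : Matrix m m ℝ) W = 0 := by simp [frob]
    rw [h0] at this
    by_contra! hlt
    have : 0 < g * c * frob W W := by positivity
    linarith
  exact LinearMap.injective_iff_surjective.1 hf D

end Frobenius

/-! ### The stiffness matrix and discrete gradients -/

section Stiffness

variable {n : ℕ}

/-- The matrix of `ω₀² - Δ_N`. -/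
def stiffness (ω₀ : ℝ) : Matrix (Fin (n + 1)) (Fin (n + 1)) ℝ :=
  Matrix.of fun x y => (ω₀ ^ 2 + 2) * (if x = y then 1 else 0)
    - ((if nextSite x = y then 1 else 0) + (if prevSite x = y then 1 else 0))

lemma stiffness_mulVec (ω₀ : ℝ) (q : Fin (n + 1) → ℝ) (x : Fin (n + 1)) :
    (stiffness ω₀ *ᵥ q) x = -(neumannLaplacian q x - ω₀ ^ 2 * q x) := by
  simp only [mulVec, dotProduct, stiffness, of_apply, sub_mul, add_mul, Finset.sum_sub_distrib,
    mul_assoc, ite_mul, one_mul, zero_mul, mul_ite, mul_zero, Finset.sum_add_distrib,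
    Finset.sum_ite_eq, Finset.mem_univ, if_true, neumannLaplacian]
  ring

/-- Off the diagonal, `y` follows `x` exactly when `x` precedes `y`; the identifications at the two
ends of the chain only affect diagonal entries. -/
lemma stiffness_transpose (ω₀ : ℝ) :
    (stiffness ω₀ : Matrix (Fin (n + 1)) (Fin (n + 1)) ℝ)ᵀ = stiffness ω₀ := by
  ext x y
  simp only [transpose_apply, stiffness, of_apply, nextSite, prevSite, Fin.ext_iff]
  have := x.2
  have := y.2
  by_cases h : (x : ℕ) = y
  · have h' : x = y := Fin.ext h
    subst h'
    rfl
  · split_ifs <;> first | omega | simp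

lemma nextSite_last : nextSite (Fin.last n) = Fin.last n := by ext; simp [nextSite]

lemma prevSite_zero : prevSite (0 : Fin (n + 1)) = 0 := by ext; simp [prevSite]

lemma nextSite_castSucc (i : Fin n) : nextSite i.castSucc = i.succ := by
  ext; simp [nextSite]

lemma prevSite_succ (i : Fin n) : prevSite i.succ = i.castSucc := by
  ext; simp [prevSite]

lemma sum_sq_nextSite (q : Fin (n + 1) → ℝ) :
    ∑ x, (q x - q (nextSite x)) ^ 2 = ∑ i : Fin n, (q i.succ - q i.castSucc) ^ 2 := by
  simp only [Fin.sum_univ_castSucc (n := n), nextSite_last, nextSite_castSucc, sub_self, sub_sq_comm]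
  simp

lemma sum_sq_prevSite (q : Fin (n + 1) → ℝ) :
    ∑ x, (q x - q (prevSite x)) ^ 2 = ∑ i : Fin n, (q i.succ - q i.castSucc) ^ 2 := by
  simp [Fin.sum_univ_succ (n := n), prevSite_zero, prevSite_succ]

lemma sum_sq_edge_le (q : Fin (n + 1) → ℝ) :
    ∑ i : Fin n, (q i.succ - q i.castSucc) ^ 2 ≤ 4 * (q ⬝ᵥ q) := by
  have h1 : ∑ i : Fin n, q i.succ ^ 2 ≤ q ⬝ᵥ q := by
    simp only [dotProduct, Fin.sum_univ_succ (n := n), ← sq]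
    nlinarith [sq_nonneg (q 0)]
  have h2 : ∑ i : Fin n, q i.castSucc ^ 2 ≤ q ⬝ᵥ q := by
    simp only [dotProduct, Fin.sum_univ_castSucc (n := n), ← sq]
    nlinarith [sq_nonneg (q (Fin.last n))]
  calc ∑ i : Fin n, (q i.succ - q i.castSucc) ^ 2
      ≤ ∑ i : Fin n, (2 * q i.succ ^ 2 + 2 * q i.castSucc ^ 2) :=
        Finset.sum_le_sum fun i _ => by nlinarith [sq_nonneg (q i.succ + q i.castSucc)]
    _ ≤ 4 * (q ⬝ᵥ q) := by
        rw [Finset.sum_add_distrib, ← Finset.mul_sum, ← Finset.mul_sum]; linarith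

/-- Summation by parts; the Neumann conventions make both boundary terms vanish. -/
lemma dotProduct_stiffness (ω₀ : ℝ) (q : Fin (n + 1) → ℝ) :
    q ⬝ᵥ stiffness ω₀ *ᵥ q = ∑ x, (q x - q (prevSite x)) ^ 2 + ω₀ ^ 2 * (q ⬝ᵥ q) := by
  have h : q ⬝ᵥ stiffness ω₀ *ᵥ q = ∑ x, q x * (q x - q (nextSite x)) +
      ∑ x, q x * (q x - q (prevSite x)) + ω₀ ^ 2 * (q ⬝ᵥ q) := by
    simp only [dotProduct, stiffness_mulVec, neumannLaplacian, Finset.mul_sum,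
      ← Finset.sum_add_distrib]
    exact Finset.sum_congr rfl fun x _ => by ring
  rw [h, sum_sq_prevSite, Fin.sum_univ_castSucc, Fin.sum_univ_succ, add_left_inj]
  simp only [nextSite_last, prevSite_zero, prevSite_succ, nextSite_castSucc, sub_self, mul_zero,
    add_zero, zero_add, ← Finset.sum_add_distrib]
  exact Finset.sum_congr rfl fun x _ => by ring

lemma le_dotProduct_stiffness (ω₀ : ℝ) (q : Fin (n + 1) → ℝ) :
    ω₀ ^ 2 * (q ⬝ᵥ q) ≤ q ⬝ᵥ stiffness ω₀ *ᵥ q := by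
  rw [dotProduct_stiffness]
  have : 0 ≤ ∑ x, (q x - q (prevSite x)) ^ 2 := Finset.sum_nonneg fun _ _ => sq_nonneg _
  linarith

lemma dotProduct_stiffness_le (ω₀ : ℝ) (q : Fin (n + 1) → ℝ) :
    q ⬝ᵥ stiffness ω₀ *ᵥ q ≤ (ω₀ ^ 2 + 4) * (q ⬝ᵥ q) := by
  rw [dotProduct_stiffness, sum_sq_prevSite]
  linarith [sum_sq_edge_le q]

lemma stiffness_mulVec_sq_le (ω₀ : ℝ) (q : Fin (n + 1) → ℝ) :
    (stiffness ω₀ *ᵥ q) ⬝ᵥ (stiffness ω₀ *ᵥ q) ≤ (3 * ω₀ ^ 4 + 24) * (q ⬝ᵥ q) := by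
  calc (stiffness ω₀ *ᵥ q) ⬝ᵥ (stiffness ω₀ *ᵥ q)
      ≤ ∑ x, (3 * ω₀ ^ 4 * (q x * q x) + 3 * (q x - q (nextSite x)) ^ 2
          + 3 * (q x - q (prevSite x)) ^ 2) := by
        refine Finset.sum_le_sum fun x _ => ?_
        rw [stiffness_mulVec, neumannLaplacian]
        nlinarith [sq_nonneg (ω₀ ^ 2 * q x - (q x - q (nextSite x))),
          sq_nonneg (ω₀ ^ 2 * q x - (q x - q (prevSite x))),
          sq_nonneg ((q x - q (nextSite x)) - (q x - q (prevSite x)))]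
    _ ≤ _ := by
        rw [Finset.sum_add_distrib, Finset.sum_add_distrib, ← Finset.mul_sum, ← Finset.mul_sum,
          ← Finset.mul_sum, sum_sq_nextSite, sum_sq_prevSite]
        have := sum_sq_edge_le q
        have e : ∑ x, q x * q x = q ⬝ᵥ q := rfl
        rw [e]
        linarith

/-- The entry of `[K, diag d]` at `(i, i + 1)` is `-(d_{i+1} - d_i)`, so the superdiagonal alone
already carries the gradient sum. -/
lemma sum_sq_edge_le_frob (ω₀ : ℝ) (d : Fin (n + 1) → ℝ) :
    ∑ i : Fin n, (d i.succ - d i.castSucc) ^ 2 ≤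
      frob (comm (stiffness ω₀) (diagonal d)) (comm (stiffness ω₀) (diagonal d)) := by
  rw [frob_eq_sum, Fin.sum_univ_succ]
  have h0 : 0 ≤ ∑ x, comm (stiffness ω₀) (diagonal d) x 0 * comm (stiffness ω₀) (diagonal d) x 0 :=
    Finset.sum_nonneg fun _ _ => mul_self_nonneg _
  refine le_trans ?_ (le_add_of_nonneg_left h0)
  refine Finset.sum_le_sum fun i _ => ?_
  refine le_trans (le_of_eq ?_) (Finset.single_le_sum
    (f := fun x => comm (stiffness ω₀) (diagonal d) x i.succ *
      comm (stiffness ω₀) (diagonal d) x i.succ)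
    (fun _ _ => mul_self_nonneg _) (Finset.mem_univ i.castSucc))
  have hne : i.castSucc ≠ i.succ := (Fin.castSucc_lt_succ).ne
  have hp : prevSite i.castSucc ≠ i.succ := by
    rw [Ne, Fin.ext_iff]; simp only [prevSite, Fin.val_castSucc, Fin.val_succ]; omega
  simp only [comm, Matrix.sub_apply, mul_diagonal, diagonal_mul, stiffness, of_apply, nextSite_castSucc,
    hne, hp, if_true, if_false]
  ring

/-- Telescoping from site `0` and Cauchy–Schwarz over at most `n` edges. -/
lemma sq_sub_zero_le (d : Fin (n + 1) → ℝ) (x : Fin (n + 1)) :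
    (d x - d 0) ^ 2 ≤ n * ∑ i : Fin n, (d i.succ - d i.castSucc) ^ 2 := by
  let e : ℕ → ℝ := fun k => if h : k < n + 1 then d ⟨k, h⟩ else 0
  have h1 : d x - d 0 = ∑ k ∈ Finset.range x, (e (k + 1) - e k) := by
    rw [Finset.sum_range_sub]
    have hx : (x : ℕ) < n + 1 := x.2
    simp only [e, dif_pos hx, dif_pos (Nat.succ_pos n)]
    rfl
  have h2 : ∑ i : Fin n, (d i.succ - d i.castSucc) ^ 2 =
      ∑ k ∈ Finset.range n, (e (k + 1) - e k) ^ 2 := by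
    rw [Finset.sum_range]
    refine Finset.sum_congr rfl fun i _ => ?_
    have a1 : (i : ℕ) + 1 < n + 1 := by omega
    have a2 : (i : ℕ) < n + 1 := by omega
    simp only [e, a1, a2, dif_pos]
    rfl
  have hx : (x : ℕ) ≤ n := by omega
  rw [h1, h2]
  refine sq_sum_le_card_mul_sum_sq.trans ?_
  rw [Finset.card_range]
  have hx' : ((x : ℕ) : ℝ) ≤ n := by exact_mod_cast hx
  refine mul_le_mul hx' (Finset.sum_le_sum_of_subset_of_nonneg (Finset.range_mono hx)
    fun _ _ _ => sq_nonneg _) (Finset.sum_nonneg fun _ _ => sq_nonneg _) (Nat.cast_nonneg _)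

/-! ### The matrix Lyapunov equation -/

/-- The diagonal part of a matrix with the entry at the site `0` removed. -/
def flipDiag (Z : Matrix (Fin (n + 1)) (Fin (n + 1)) ℝ) : Matrix (Fin (n + 1)) (Fin (n + 1)) ℝ :=
  diagonal fun x => if x = 0 then 0 else Z x x

/-- The operator on the momentum block of the Lyapunov equation. -/
def lyapOp (ω₀ g : ℝ) (Z : Matrix (Fin (n + 1)) (Fin (n + 1)) ℝ) :
    Matrix (Fin (n + 1)) (Fin (n + 1)) ℝ :=
  covOp (stiffness ω₀) g (Z - flipDiag Z) +
    comm (stiffness ω₀) (comm (stiffness ω₀) (flipDiag Z))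

lemma flipDiag_add (X Y : Matrix (Fin (n + 1)) (Fin (n + 1)) ℝ) :
    flipDiag (X + Y) = flipDiag X + flipDiag Y := by
  rw [flipDiag, flipDiag, flipDiag, diagonal_add]
  congr 1
  ext x
  split_ifs <;> simp

lemma flipDiag_smul (a : ℝ) (X : Matrix (Fin (n + 1)) (Fin (n + 1)) ℝ) :
    flipDiag (a • X) = a • flipDiag X := by
  rw [flipDiag, flipDiag, ← diagonal_smul]
  congr 1
  ext x
  simp

lemma flipDiag_transpose (X : Matrix (Fin (n + 1)) (Fin (n + 1)) ℝ) :
    (flipDiag X)ᵀ = flipDiag Xᵀ := by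
  simp [flipDiag]

lemma comm_transpose (ω₀ : ℝ) (X : Matrix (Fin (n + 1)) (Fin (n + 1)) ℝ) :
    (comm (stiffness ω₀) X)ᵀ = - comm (stiffness ω₀) Xᵀ := by
  simp [comm, stiffness_transpose]

lemma lyapOp_transpose (ω₀ g : ℝ) (Z : Matrix (Fin (n + 1)) (Fin (n + 1)) ℝ) :
    (lyapOp ω₀ g Z)ᵀ = lyapOp ω₀ g Zᵀ := by
  have hneg : ∀ X : Matrix (Fin (n + 1)) (Fin (n + 1)) ℝ,
      comm (stiffness ω₀) (-X) = - comm (stiffness ω₀) X := fun X => by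
    simpa using comm_smul (K := stiffness ω₀) (-1) X
  simp only [lyapOp, covOp, transpose_add, transpose_smul, transpose_mul, comm_transpose,
    stiffness_transpose, transpose_sub, flipDiag_transpose, hneg, neg_neg]
  rw [add_comm (_ * stiffness ω₀)]

/-- A duality argument. Write the flip diagonal `D` of `Z` as `covOp K g W`. The equation forces the
rest of `Z` to be `-[K,[K,W]]`, while that rest is Frobenius-orthogonal to `D`. So the right side of
the key estimate vanishes and `D` commutes with `K`: it is constant along the chain, and zero
because its entry at site `0` is. -/
lemma lyapOp_injective {ω₀ g : ℝ} (hω₀ : 0 < ω₀) (hg : 0 < g)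
    {Z : Matrix (Fin (n + 1)) (Fin (n + 1)) ℝ} (hZ : lyapOp ω₀ g Z = 0) : Z = 0 := by
  have hK := stiffness_transpose (n := n) ω₀
  have hω : 0 < ω₀ ^ 2 := by positivity
  have hco := le_dotProduct_stiffness (n := n) ω₀
  obtain ⟨W, hW⟩ := covOp_surjective hK hg hω hco (flipDiag Z)
  have hinj : ∀ X, covOp (stiffness ω₀) g X = 0 → X = 0 := fun X hX => by
    have := frob_covOp_self_ge hK hg.le hco X
    rw [hX] at this
    refine eq_zero_of_frob_self X ?_
    have h0 : frob (0 : Matrix (Fin (n + 1)) (Fin (n + 1)) ℝ) X = 0 := by simp [frob]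
    rw [h0] at this
    by_contra! hlt
    have : 0 < g * ω₀ ^ 2 * frob X X := by positivity
    linarith
  have hadd : ∀ X Y, covOp (stiffness (n := n) ω₀) g (X + Y) =
      covOp (stiffness ω₀) g X + covOp (stiffness ω₀) g Y := fun X Y => by
    simp only [covOp, comm_add, Matrix.mul_add, Matrix.add_mul, smul_add]; abel
  set A := comm (stiffness ω₀) (comm (stiffness ω₀) W) with hA
  have hU : Z - flipDiag Z = - A := by
    -- As `covOp` commutes with the commutator, `[K,[K,flipDiag Z]] = covOp K g A`, so the equation
    -- reads `covOp K g (Z - flipDiag Z + A) = 0`.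
    refine eq_neg_of_add_eq_zero_left (hinj _ ?_)
    rw [hadd, hA, ← comm_covOp, ← comm_covOp, hW]
    exact hZ
  have hperp : frob (flipDiag Z) (Z - flipDiag Z) = 0 := by
    rw [frob_eq_sum]
    refine Finset.sum_eq_zero fun y _ => Finset.sum_eq_zero fun x _ => ?_
    by_cases hxy : x = y
    · subst hxy
      by_cases hx : x = 0 <;> simp [flipDiag, hx]
    · simp [flipDiag, diagonal_apply_ne _ hxy]
  have hzero : frob (flipDiag Z) A = 0 := by
    rw [hU] at hperp
    simpa [frob] using hperp
  have hle := frob_comm_covOp_le hK hg hω (by positivity) hco (stiffness_mulVec_sq_le ω₀) W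
  rw [hW, hzero, mul_zero] at hle
  have hedge := (sum_sq_edge_le_frob ω₀ _).trans hle
  have hD : flipDiag Z = 0 := by
    rw [flipDiag, ← diagonal_zero]
    congr 1
    ext x
    have h := sq_sub_zero_le (fun x => if x = 0 then 0 else Z x x) x
    simp only [if_true, sub_zero] at h hedge
    have h' := h.trans (mul_nonpos_of_nonneg_of_nonpos (Nat.cast_nonneg _) hedge)
    exact pow_eq_zero_iff (n := 2) (by norm_num) |>.1 (le_antisymm h' (sq_nonneg _))
  have hA0 : A = 0 := by
    refine eq_zero_of_frob_self _ ?_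
    have h1 := frob_covOp_ge hK hg.le hco W
    rw [hW, hzero] at h1
    have h2 := frob_self_nonneg (comm (stiffness ω₀) W)
    have : 0 ≤ g * ω₀ ^ 2 * frob (comm (stiffness ω₀) W) (comm (stiffness ω₀) W) := by positivity
    linarith
  rw [hD, hA0] at hU
  simpa using hU

lemma lyapOp_surjective {ω₀ g : ℝ} (hω₀ : 0 < ω₀) (hg : 0 < g)
    (R : Matrix (Fin (n + 1)) (Fin (n + 1)) ℝ) : ∃ Z, lyapOp ω₀ g Z = R := by
  let f : Matrix (Fin (n + 1)) (Fin (n + 1)) ℝ →ₗ[ℝ] Matrix (Fin (n + 1)) (Fin (n + 1)) ℝ :=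
    { toFun := lyapOp ω₀ g
      map_add' := fun X Y => by
        simp only [lyapOp, covOp, comm_add, comm_sub, flipDiag_add, Matrix.mul_add, Matrix.add_mul,
          Matrix.mul_sub, Matrix.sub_mul, smul_add, smul_sub]
        abel
      map_smul' := fun a X => by
        simp only [lyapOp, covOp, comm_smul, comm_sub, flipDiag_smul, Matrix.mul_smul,
          Matrix.smul_mul, Matrix.mul_sub, Matrix.sub_mul, smul_add, smul_sub, smul_comm a,
          RingHom.id_apply] }
  have hf : Function.Injective f := by
    rw [injective_iff_map_eq_zero]
    exact fun Z hZ => lyapOp_injective hω₀ hg hZ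
  exact LinearMap.injective_iff_surjective.1 hf R

/-- Blocks of a quadratic form that the Langevin and flip dynamics maps to `-|q|² - |p|²`. -/
lemma exists_lyapunov_blocks {ω₀ γ : ℝ} (hω₀ : 0 < ω₀) (hγ : 0 < γ) :
    ∃ X Y Z : Matrix (Fin (n + 1)) (Fin (n + 1)) ℝ, Xᵀ = X ∧ Zᵀ = Z ∧
      X = γ • Y + stiffness ω₀ * Z ∧
      Y * stiffness ω₀ + (Y * stiffness ω₀)ᵀ = (2 : ℝ) • 1 ∧
      Y + Yᵀ = (8 * γ) • (Z - flipDiag Z) - (2 : ℝ) • 1 := by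
  set K : Matrix (Fin (n + 1)) (Fin (n + 1)) ℝ := stiffness ω₀ with hKdef
  have hK : Kᵀ = K := stiffness_transpose ω₀
  have hg : 0 < 16 * γ ^ 2 := by positivity
  -- Eliminating `X` and `Y` from the block conditions leaves this one equation for `Z`.
  obtain ⟨Z, hZ⟩ := lyapOp_surjective (n := n) hω₀ hg ((4 * γ) • (1 + K))
  -- The right-hand side is symmetric, so the transpose solves the same equation; uniqueness
  -- concludes.
  have hZt : Zᵀ = Z := by
    have h1 : lyapOp ω₀ (16 * γ ^ 2) (Zᵀ - Z) = 0 := by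
      have h2 : lyapOp ω₀ (16 * γ ^ 2) Zᵀ = (4 * γ) • (1 + K) := by
        rw [← lyapOp_transpose, hZ]; simp [hK]
      have h3 : ∀ X Y : Matrix (Fin (n + 1)) (Fin (n + 1)) ℝ, lyapOp ω₀ (16 * γ ^ 2) (X + Y) =
          lyapOp ω₀ (16 * γ ^ 2) X + lyapOp ω₀ (16 * γ ^ 2) Y := fun X Y => by
        simp only [lyapOp, covOp, comm_add, comm_sub, flipDiag_add, Matrix.mul_add, Matrix.add_mul,
          Matrix.mul_sub, Matrix.sub_mul, smul_add, smul_sub]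
        abel
      have h4 := h3 (Zᵀ - Z) Z
      rw [sub_add_cancel, h2, hZ] at h4
      simpa using h4
    exact sub_eq_zero.1 (lyapOp_injective hω₀ hg h1)
  set U := Z - flipDiag Z with hU
  have hUt : Uᵀ = U := by rw [hU, transpose_sub, flipDiag_transpose, hZt]
  have hZ' : (8 * γ ^ 2) • (K * U + U * K) + comm K (comm K Z) = (4 * γ) • (1 + K) := by
    rw [← hZ, lyapOp, covOp, ← hU, ← hKdef, add_assoc, ← comm_add, ← comm_add, hU, sub_add_cancel]
    congr 2
    ring
  -- The momentum condition fixes the symmetric part of `Y`; symmetry of `X = γY + KZ` fixes the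
  -- antisymmetric part.
  let Y := (4 * γ) • U - 1 - (1 / (2 * γ)) • comm K Z
  have hcZt : (comm K Z)ᵀ = - comm K Z := by rw [hKdef, comm_transpose, hZt]
  have hYt : Yᵀ = (4 * γ) • U - 1 + (1 / (2 * γ)) • comm K Z := by
    simp only [Y, transpose_sub, transpose_smul, transpose_one, hUt, hcZt, smul_neg]
    abel
  have hYt' : Yᵀ = Y + (1 / γ) • comm K Z := by
    rw [hYt]
    simp only [Y]
    have : (1 / γ) = 1 / (2 * γ) + 1 / (2 * γ) := by field_simp; norm_num
    rw [this, add_smul]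
    abel
  refine ⟨γ • Y + K * Z, Y, Z, ?_, hZt, rfl, ?_, ?_⟩
  · rw [transpose_add, transpose_smul, hYt', transpose_mul, hZt, hK, smul_add, smul_smul,
      mul_one_div_cancel hγ.ne', one_smul, comm]
    abel
  · have h1 : Y * K + (Y * K)ᵀ = (4 * γ) • (K * U + U * K) - (2 : ℝ) • K +
        (1 / (2 * γ)) • comm K (comm K Z) := by
      rw [transpose_mul, hYt, hK]
      simp only [Y, Matrix.sub_mul, Matrix.mul_sub, Matrix.mul_add, Matrix.smul_mul,
        Matrix.mul_smul, Matrix.one_mul, Matrix.mul_one, two_smul, comm, smul_sub, smul_add]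
      abel
    have h2 : (1 / (2 * γ)) • comm K (comm K Z) = (2 : ℝ) • (1 + K) -
        (4 * γ) • (K * U + U * K) := by
      have e : comm K (comm K Z) = (4 * γ) • (1 + K) - (8 * γ ^ 2) • (K * U + U * K) :=
        eq_sub_of_add_eq' hZ'
      rw [e, smul_sub, smul_smul, smul_smul]
      congr 2 <;> field_simp <;> norm_num
    rw [h1, h2]
    module
  · rw [hYt]
    simp only [Y]
    have : (8 * γ) = 4 * γ + 4 * γ := by ring
    rw [this, add_smul, two_smul]
    abel

/-! ### Temperature profile of a stationary covariance -/

/-- In a stationary covariance whose temperature profile `τ` is fed by small sources `s`, the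
kinetic temperatures stay within `O(n ∑ s)` of the thermostat temperature. -/
lemma trace_covariance_le {ω₀ γ : ℝ} (hω₀ : 0 < ω₀) (hγ : 0 < γ)
    {Q A P : Matrix (Fin (n + 1)) (Fin (n + 1)) ℝ} {τ s : Fin (n + 1) → ℝ}
    (hQ : Qᵀ = Q) (hP : Pᵀ = P) (hA : Aᵀ = -A)
    (hqp : P = Q * stiffness ω₀ + (2 * γ) • A)
    (hpp : (4 * γ) • (diagonal τ - P) = stiffness ω₀ * A - A * stiffness ω₀)
    (hs : ∀ x, 0 ≤ s x) (hτ : ∀ x, x ≠ 0 → τ x = P x x + s x) :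
    P.trace ≤ (n + 1) * (τ 0 + (2 * (16 * γ ^ 2) * (3 * ω₀ ^ 4 + 24) / ω₀ ^ 2
      + 8 * (3 * ω₀ ^ 4 + 24)) * (n * ∑ x, s x)) := by
  set K : Matrix (Fin (n + 1)) (Fin (n + 1)) ℝ := stiffness ω₀ with hKdef
  have hK : Kᵀ = K := stiffness_transpose ω₀
  set C := 2 * (16 * γ ^ 2) * (3 * ω₀ ^ 4 + 24) / ω₀ ^ 2 + 8 * (3 * ω₀ ^ 4 + 24) with hC
  have hC0 : 0 ≤ C := by positivity
  have hg : 0 < 16 * γ ^ 2 := by positivity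
  -- Comparing `hqp` with its transpose eliminates `A`: it gives `[K, Q] = 4γA`, and half the sum
  -- gives the anticommutator of `K` and `Q`.
  have hP2 : P = K * Q - (2 * γ) • A := by
    rw [← hP, hqp, transpose_add, transpose_mul, transpose_smul, hA, hQ, hK, smul_neg, sub_eq_add_neg]
  have hadQ : comm K Q = (4 * γ) • A := by
    have : K * Q = Q * K + (2 * γ) • A + (2 * γ) • A := by rw [← hqp]; exact (sub_eq_iff_eq_add.1 hP2.symm)
    rw [comm, this, show 4 * γ = 2 * γ + 2 * γ by ring, add_smul]
    abel
  have had2 : comm K (comm K Q) = (16 * γ ^ 2) • (diagonal τ - P) := by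
    have : comm K A = (4 * γ) • (diagonal τ - P) := hpp.symm
    rw [hadQ, comm_smul, this, smul_smul]
    congr 1
    ring
  have hcov : covOp K (16 * γ ^ 2) Q = (16 * γ ^ 2) • diagonal τ := by
    have h2P : K * Q + Q * K = (2 : ℝ) • P := by
      rw [two_smul]
      nth_rewrite 1 [hP2]
      rw [hqp]
      abel
    rw [covOp, had2, h2P]
    module
  -- By `hpp` this matrix is a multiple of a commutator.
  have htr : (diagonal τ - P).trace = 0 := by
    have h1 : (4 * γ) * (diagonal τ - P).trace = 0 := by
      rw [← smul_eq_mul, ← trace_smul, hpp, trace_sub, trace_mul_comm, sub_self]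
    exact (mul_eq_zero.1 h1).resolve_left (by positivity)
  have htr' : ∑ x, (τ x - P x x) = 0 := by
    simpa [trace] using htr
  set E := ∑ i : Fin n, (τ i.succ - τ i.castSucc) ^ 2 with hE
  have hE0 : 0 ≤ E := Finset.sum_nonneg fun _ _ => sq_nonneg _
  have hS0 : 0 ≤ ∑ x, s x := Finset.sum_nonneg fun x _ => hs x
  set y := Real.sqrt (n * E) with hy
  have hy0 : 0 ≤ y := Real.sqrt_nonneg _
  have hy2 : y ^ 2 = n * E := Real.sq_sqrt (by positivity)
  have hsup : ∀ x, |τ x - τ 0| ≤ y := fun x =>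
    Real.abs_le_sqrt (sq_sub_zero_le τ x)
  have hfrob : frob (diagonal τ) (diagonal τ - P) ≤ y * ∑ x, s x := by
    have h1 : frob (diagonal τ) (diagonal τ - P) = ∑ x, τ x * (τ x - P x x) := by
      rw [frob_eq_sum]
      refine Finset.sum_congr rfl fun x _ => ?_
      rw [Finset.sum_eq_single x]
      · simp
      · intro b _ hb; simp [diagonal_apply_ne _ hb]
      · simp
    -- Subtracting the constant `τ 0` costs nothing by the zero trace. It also removes site `0`, the
    -- only site where `τ - P` need not be the source.
    have h2 : ∑ x, τ x * (τ x - P x x) = ∑ x, (τ x - τ 0) * (τ x - P x x) := by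
      simp only [sub_mul _ (τ 0), Finset.sum_sub_distrib, ← Finset.mul_sum, htr', mul_zero, sub_zero]
    rw [h1, h2, Finset.mul_sum]
    refine Finset.sum_le_sum fun x _ => ?_
    by_cases hx : x = 0
    · subst hx
      rw [sub_self, zero_mul]
      exact mul_nonneg hy0 (hs _)
    · have : τ x - P x x = s x := by rw [hτ x hx]; ring
      rw [this]
      exact mul_le_mul_of_nonneg_right ((le_abs_self _).trans (hsup x)) (hs x)
  have hle := frob_comm_covOp_le hK hg (by positivity) (by positivity)
    (le_dotProduct_stiffness ω₀) (stiffness_mulVec_sq_le ω₀) Q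
  rw [hcov, had2, comm_smul, frob_smul_left, frob_smul_left, frob_smul_right, frob_smul_right,
    ← hC] at hle
  have hEy : E ≤ C * (y * ∑ x, s x) := by
    have h1 := sum_sq_edge_le_frob ω₀ τ
    have h2 : frob (comm K (diagonal τ)) (comm K (diagonal τ)) ≤
        C * frob (diagonal τ) (diagonal τ - P) := by
      have hgg : 0 < (16 * γ ^ 2) * (16 * γ ^ 2) := by positivity
      refine le_of_mul_le_mul_left ?_ hgg
      linarith
    exact h1.trans (h2.trans (mul_le_mul_of_nonneg_left hfrob hC0))
  -- Here `y² = nE ≤ C n y ∑ s`, so a factor `y` cancels unless `y = 0`.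
  have hyle : y ≤ C * (n * ∑ x, s x) := by
    rcases hy0.eq_or_lt with h0 | h0
    · rw [← h0]; positivity
    · have h1 : y * y ≤ (C * (n * ∑ x, s x)) * y := by
        have := mul_le_mul_of_nonneg_left hEy (Nat.cast_nonneg (α := ℝ) n)
        nlinarith
      exact le_of_mul_le_mul_right h1 h0
  have htrP : P.trace = ∑ x, τ x := by
    have : ∑ x, τ x - ∑ x, P x x = 0 := by rw [← Finset.sum_sub_distrib]; exact htr'
    simp only [trace, diag_apply]
    linarith
  rw [htrP]
  calc ∑ x, τ x ≤ ∑ _x : Fin (n + 1), (τ 0 + C * (n * ∑ x, s x)) :=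
        Finset.sum_le_sum fun x _ => by linarith [le_abs_self (τ x - τ 0), hsup x]
    _ = _ := by simp [mul_add]

end Stiffness

/-! ### The generator in vector form and its locality -/

variable {n : ℕ}

/-- The unit vector of the momentum at site `x`. -/
def momentumDir (x : Fin (n + 1)) : Phase n := (0, Pi.single x 1)

/-- The linear part `(q, p) ↦ (p, -(ω₀² - Δ_N) q - c p)` of the drift with damping `c`. -/
def drift (ω₀ c : ℝ) : Phase n →L[ℝ] Phase n :=
  LinearMap.toContinuousLinearMap
    { toFun := fun z => (z.2, -(stiffness ω₀ *ᵥ z.1) - c • z.2)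
      map_add' := fun z w => by
        ext x <;> simp [mulVec_add]; ring
      map_smul' := fun a z => by
        ext x <;> simp [mulVec_smul]; ring }

lemma drift_apply (ω₀ c : ℝ) (z : Phase n) :
    drift ω₀ c z = (z.2, -(stiffness ω₀ *ᵥ z.1) - c • z.2) := rfl

lemma fderiv_apply_eq_sum (G : Phase n → ℝ) (z v : Phase n) :
    fderiv ℝ G z v = ∑ x, v.1 x * dq x G z + ∑ x, v.2 x * dp x G z := by
  have hv : v = ∑ x, v.1 x • ((Pi.single x 1, 0) : Phase n) +
      ∑ x, v.2 x • ((0, Pi.single x 1) : Phase n) := by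
    refine Prod.ext ?_ ?_ <;> ext y <;>
      simp [Prod.fst_sum, Prod.snd_sum, Finset.sum_apply, Pi.single_apply]
  conv_lhs => rw [hv]
  simp only [map_add, map_sum, map_smul, smul_eq_mul]
  rfl

lemma generator_eq (ω₀ γ T f : ℝ) (G : Phase n → ℝ) (z : Phase n) :
    generator ω₀ γ T f G z = fderiv ℝ G z (drift ω₀ 0 z + f • momentumDir (Fin.last n))
      + γ * flipPart G z + 2 * γ * thermostatPart T G z := by
  rw [generator, hamiltonianPart, map_add, fderiv_apply_eq_sum G z (drift ω₀ 0 z), map_smul]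
  simp only [drift_apply, zero_smul, sub_zero, Pi.neg_apply, stiffness_mulVec, neg_neg,
    smul_eq_mul]
  rfl

lemma flipMomentum_eq (x : Fin (n + 1)) (z : Phase n) :
    flipMomentum x z = z - (2 * z.2 x) • momentumDir x := by
  refine Prod.ext ?_ ?_
  · simp [flipMomentum, momentumDir]
  · ext y
    by_cases hy : y = x
    · subst hy
      simp [flipMomentum, momentumDir]
      ring
    · simp [flipMomentum, momentumDir, hy]

lemma norm_flipMomentum (x : Fin (n + 1)) (z : Phase n) : ‖flipMomentum x z‖ = ‖z‖ := by
  have : ‖Function.update z.2 x (-z.2 x)‖ = ‖z.2‖ := by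
    rw [Pi.norm_def, Pi.norm_def]
    congr 2
    ext y
    by_cases hy : y = x
    · subst hy; simp
    · simp [hy]
  rw [Prod.norm_def, Prod.norm_def, flipMomentum, this]

lemma contDiff_flipMomentum (x : Fin (n + 1)) : ContDiff ℝ ∞ (flipMomentum (n := n) x) := by
  have : flipMomentum (n := n) x = fun z => z - (2 * z.2 x) • momentumDir x :=
    funext fun z => flipMomentum_eq x z
  rw [this]
  fun_prop

lemma contDiff_dp {G : Phase n → ℝ} (hG : ContDiff ℝ ∞ G) (x : Fin (n + 1)) :
    ContDiff ℝ ∞ (dp x G) :=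
  (hG.fderiv_right (m := ∞) le_rfl).clm_apply contDiff_const

lemma contDiff_generator {G : Phase n → ℝ} (hG : ContDiff ℝ ∞ G) (ω₀ γ T f : ℝ) :
    ContDiff ℝ ∞ (generator ω₀ γ T f G) := by
  have h1 : ContDiff ℝ ∞ fun z : Phase n =>
      fderiv ℝ G z (drift ω₀ 0 z + f • momentumDir (Fin.last n)) :=
    (hG.fderiv_right (m := ∞) le_rfl).clm_apply ((drift ω₀ 0).contDiff.add contDiff_const)
  have h2 : ContDiff ℝ ∞ (flipPart G) :=
    ContDiff.sum fun x _ => (hG.comp (contDiff_flipMomentum x)).sub hG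
  have h3 : ContDiff ℝ ∞ (thermostatPart T G) := by
    have hp : ContDiff ℝ ∞ fun z : Phase n => z.2 0 := by fun_prop
    exact (contDiff_const.mul (contDiff_dp (contDiff_dp hG 0) 0)).sub
      (hp.mul (contDiff_dp hG 0))
  have : generator ω₀ γ T f G = fun z => fderiv ℝ G z (drift ω₀ 0 z + f • momentumDir (Fin.last n))
      + γ * flipPart G z + 2 * γ * thermostatPart T G z := funext fun z => generator_eq ..
  rw [this]
  exact (h1.add (contDiff_const.mul h2)).add (contDiff_const.mul h3)

lemma fderiv_congr_of_eqOn {O : Set (Phase n)} (hO : IsOpen O) {G₁ G₂ : Phase n → ℝ}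
    (h : Set.EqOn G₁ G₂ O) {z : Phase n} (hz : z ∈ O) : fderiv ℝ G₁ z = fderiv ℝ G₂ z :=
  Filter.EventuallyEq.fderiv_eq (Filter.eventuallyEq_of_mem (hO.mem_nhds hz) h)

/-- Momentum flips are jumps, so openness alone does not make the generator local on `O`; invariance
under the flips is also needed. Balls centred at the origin and their exteriors have it because
flips preserve the norm. -/
lemma generator_congr {O : Set (Phase n)} (hO : IsOpen O)
    (hflip : ∀ x, ∀ z ∈ O, flipMomentum x z ∈ O) {G₁ G₂ : Phase n → ℝ}
    (h : Set.EqOn G₁ G₂ O) (ω₀ γ T f : ℝ) {z : Phase n} (hz : z ∈ O) :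
    generator ω₀ γ T f G₁ z = generator ω₀ γ T f G₂ z := by
  have hdp : Set.EqOn (dp 0 G₁) (dp 0 G₂) O := fun w hw => by
    rw [dp, dp, fderiv_congr_of_eqOn hO h hw]
  rw [generator_eq, generator_eq, thermostatPart, thermostatPart, hdp hz,
    fderiv_congr_of_eqOn hO h hz, dp, fderiv_congr_of_eqOn hO hdp hz, ← dp, flipPart, flipPart,
    h hz]
  congr 3
  refine Finset.sum_congr rfl fun x _ => ?_
  rw [h (hflip x z hz)]

lemma generator_zero (ω₀ γ T f : ℝ) (z : Phase n) :
    generator ω₀ γ T f (fun _ => 0) z = 0 := by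
  have : dp (n := n) 0 (fun _ => (0 : ℝ)) = fun _ => 0 := by
    funext w; simp [dp]
  rw [generator_eq, flipPart, thermostatPart, this]
  simp [dp]

lemma hasCompactSupport_generator {G : Phase n → ℝ} (hG : HasCompactSupport G) (ω₀ γ T f : ℝ) :
    HasCompactSupport (generator ω₀ γ T f G) := by
  obtain ⟨r, hr⟩ := hG.isCompact.isBounded.subset_closedBall (0 : Phase n)
  refine HasCompactSupport.intro (isCompact_closedBall (0 : Phase n) r) fun z hz => ?_
  have hO : IsOpen {w : Phase n | r < ‖w‖} := isOpen_lt continuous_const continuous_norm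
  rw [generator_congr (G₂ := fun _ => 0) hO (fun x w hw => ?_) (fun w hw => ?_) ω₀ γ T f
    (show z ∈ {w : Phase n | r < ‖w‖} by simpa using hz), generator_zero]
  · simpa [norm_flipMomentum] using hw
  · by_contra hne
    have := hr (subset_tsupport _ (Function.mem_support.2 hne))
    simp only [Metric.mem_closedBall, dist_zero_right] at this
    exact absurd hw (not_lt.2 this)

lemma generator_add_const (ω₀ γ T f c : ℝ) (G : Phase n → ℝ) (z : Phase n) :
    generator ω₀ γ T f (fun w => G w + c) z = generator ω₀ γ T f G z := by
  have h1 : fderiv ℝ (fun w => G w + c) = fderiv ℝ G := by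
    funext w; exact fderiv_add_const c
  have h2 : dp 0 (fun w => G w + c) = dp 0 G := by
    funext w; rw [dp, h1, dp]
  rw [generator_eq, generator_eq, thermostatPart, thermostatPart, h1, h2, flipPart, flipPart]
  congr 3
  exact Finset.sum_congr rfl fun x _ => by ring

/-- Isolates the dependence on the force, so that the right side of the forward equation is
continuous in time by applying the equation to two fixed test functions. -/
lemma generator_eq_add_force (ω₀ γ T f : ℝ) (G : Phase n → ℝ) (z : Phase n) :
    generator ω₀ γ T f G z = generator ω₀ γ T 0 G z + f * dp (Fin.last n) G z := by
  simp only [generator, hamiltonianPart]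
  ring

/-- The generator applied to a concave increasing function of an observable. -/
lemma generator_comp_le {ω₀ γ T : ℝ} (hγ : 0 ≤ γ) (hT : 0 ≤ T) (f : ℝ) {V : Phase n → ℝ}
    (hV : ContDiff ℝ ∞ V) {φ ρ : ℝ → ℝ} (hφ : ∀ v, HasDerivAt φ (ρ v) v)
    (hρ : Differentiable ℝ ρ) (hρ' : Antitone ρ) (hφρ : ∀ a b, φ b - φ a ≤ ρ a * (b - a))
    (z : Phase n) :
    generator ω₀ γ T f (fun w => φ (V w)) z ≤ ρ (V z) * generator ω₀ γ T f V z := by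
  have hVd : Differentiable ℝ V := hV.differentiable (by simp)
  have h1 : ∀ w, fderiv ℝ (fun w => φ (V w)) w = ρ (V w) • fderiv ℝ V w := fun w =>
    ((hφ (V w)).comp_hasFDerivAt w (hVd w).hasFDerivAt).fderiv
  have h2 : dp 0 (fun w => φ (V w)) = fun w => ρ (V w) * dp 0 V w := by
    funext w; rw [dp, h1]; rfl
  have h3 : dp 0 (dp 0 (fun w => φ (V w))) z =
      ρ (V z) * dp 0 (dp 0 V) z + dp 0 V z * (deriv ρ (V z) * dp 0 V z) := by
    have hdV : DifferentiableAt ℝ (dp 0 V) z :=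
      ((contDiff_dp hV 0).differentiable (by simp)) z
    have hr : HasFDerivAt (fun w => ρ (V w)) (deriv ρ (V z) • fderiv ℝ V z) z :=
      (hρ (V z)).hasDerivAt.comp_hasFDerivAt z (hVd z).hasFDerivAt
    have hm : HasFDerivAt (fun w => ρ (V w) * dp 0 V w) _ z := hr.mul hdV.hasFDerivAt
    rw [h2, dp, hm.fderiv]
    simp [dp]
  have h4 : deriv ρ (V z) ≤ 0 := hρ'.deriv_nonpos
  have h5 : flipPart (fun w => φ (V w)) z ≤ ρ (V z) * flipPart V z := by
    rw [flipPart, flipPart, Finset.mul_sum]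
    exact Finset.sum_le_sum fun x _ => hφρ _ _
  -- The first-order terms agree exactly. Concavity gives the sign of the two discrepancies: `deriv
  -- ρ · (∂_{p_0} V)²` from the thermostat, and the jumps through the tangent-line inequality.
  rw [generator_eq, generator_eq, thermostatPart, thermostatPart, h3, h2, h1]
  have h6 := mul_le_mul_of_nonneg_left h5 hγ
  have h7 : 2 * γ * T * (deriv ρ (V z) * (dp 0 V z) ^ 2) ≤ 0 :=
    mul_nonpos_of_nonneg_of_nonpos (by positivity)
      (mul_nonpos_of_nonpos_of_nonneg h4 (sq_nonneg _))
  have h8 : (ρ (V z) • fderiv ℝ V z) (drift ω₀ 0 z + f • momentumDir (Fin.last n)) =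
    ρ (V z) * fderiv ℝ V z (drift ω₀ 0 z + f • momentumDir (Fin.last n)) := rfl
  rw [h8]
  nlinarith

/-! ### Quadratic polynomials and the Lyapunov function -/

/-- The polynomial `z ↦ B(z, z) + ℓ(z)`. -/
def quadPoly (B : Phase n →L[ℝ] Phase n →L[ℝ] ℝ) (ℓ : Phase n →L[ℝ] ℝ) (z : Phase n) : ℝ :=
  B z z + ℓ z

lemma contDiff_quadPoly (B : Phase n →L[ℝ] Phase n →L[ℝ] ℝ) (ℓ : Phase n →L[ℝ] ℝ) :
    ContDiff ℝ ∞ (quadPoly B ℓ) := by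
  unfold quadPoly
  fun_prop

lemma fderiv_quadPoly (B : Phase n →L[ℝ] Phase n →L[ℝ] ℝ) (ℓ : Phase n →L[ℝ] ℝ)
    (z v : Phase n) : fderiv ℝ (quadPoly B ℓ) z v = B z v + B v z + ℓ v := by
  have h := (B.hasFDerivAt_of_bilinear (hasFDerivAt_id z) (hasFDerivAt_id z)).add
    (ℓ.hasFDerivAt (x := z))
  have : fderiv ℝ (quadPoly B ℓ) z = _ := h.fderiv
  rw [this]
  simp

lemma dp_dp_quadPoly (B : Phase n →L[ℝ] Phase n →L[ℝ] ℝ) (ℓ : Phase n →L[ℝ] ℝ)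
    (x : Fin (n + 1)) (z : Phase n) :
    dp x (dp x (quadPoly B ℓ)) z = 2 * B (momentumDir x) (momentumDir x) := by
  have h1 : dp x (quadPoly B ℓ) = fun w =>
      (B.flip (momentumDir x) + B (momentumDir x)) w + ℓ (momentumDir x) := by
    funext w
    rw [dp, fderiv_quadPoly]
    rfl
  rw [h1, dp, fderiv_add_const, ContinuousLinearMap.fderiv]
  simp [two_mul, momentumDir]

/-- A flip moves `z` by `-2 p_x e_x`, so its expansion has a linear term and a quadratic one. The
linear terms and the thermostat friction merge into a uniform damping `2γ`. The quadratic terms have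
the form of the thermostat noise, with `p_x²` in place of `T`. -/
lemma generator_quadPoly (ω₀ γ T f : ℝ) (B : Phase n →L[ℝ] Phase n →L[ℝ] ℝ)
    (ℓ : Phase n →L[ℝ] ℝ) (z : Phase n) :
    generator ω₀ γ T f (quadPoly B ℓ) z =
      B z (drift ω₀ (2 * γ) z + f • momentumDir (Fin.last n))
        + B (drift ω₀ (2 * γ) z + f • momentumDir (Fin.last n)) z
        + ℓ (drift ω₀ (2 * γ) z + f • momentumDir (Fin.last n))
        + 4 * γ * ∑ x, (if x = 0 then T else z.2 x ^ 2) * B (momentumDir x) (momentumDir x) := by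
  have hd : drift ω₀ (2 * γ) z = drift ω₀ 0 z - (2 * γ) • ∑ x, z.2 x • momentumDir x := by
    refine Prod.ext ?_ ?_ <;> ext y <;>
      simp [drift_apply, momentumDir, Prod.fst_sum, Prod.snd_sum, Finset.sum_apply,
        Pi.single_apply]
  have hflip : ∀ x, quadPoly B ℓ (flipMomentum x z) - quadPoly B ℓ z =
      -2 * (z.2 x * (B z (momentumDir x) + B (momentumDir x) z + ℓ (momentumDir x)))
        + 4 * (z.2 x ^ 2 * B (momentumDir x) (momentumDir x)) := fun x => by
    rw [flipMomentum_eq, quadPoly, quadPoly]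
    simp
    ring
  have hsum : flipPart (quadPoly B ℓ) z =
      ∑ x, (if x = 0 then 0 else
        (-2 * (z.2 x * (B z (momentumDir x) + B (momentumDir x) z + ℓ (momentumDir x)))
        + 4 * (z.2 x ^ 2 * B (momentumDir x) (momentumDir x)))) := by
    rw [flipPart, Finset.sum_filter]
    refine Finset.sum_congr rfl fun x _ => ?_
    by_cases hx : x = 0 <;> simp only [hx, hflip, ne_eq, not_true, not_false_iff, if_true, if_false]
  rw [generator_eq, hsum, thermostatPart, dp_dp_quadPoly, hd, fderiv_quadPoly]
  have hdp : dp 0 (quadPoly B ℓ) z = B z (momentumDir 0) + B (momentumDir 0) z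
    + ℓ (momentumDir 0) := fderiv_quadPoly ..
  rw [hdp]
  simp only [Fin.sum_univ_succ, if_true, Fin.succ_ne_zero, if_false, map_add, map_sub, map_smul,
    map_sum, _root_.add_apply, _root_.sub_apply,
    _root_.smul_apply, _root_.sum_apply, smul_eq_mul, mul_add,
    Finset.sum_add_distrib, ← Finset.mul_sum]
  ring

/-- The bilinear form on phase space with position, mixed and momentum blocks `X`, `Y`, `Z`. -/
def blockForm (X Y Z : Matrix (Fin (n + 1)) (Fin (n + 1)) ℝ) :
    Phase n →L[ℝ] Phase n →L[ℝ] ℝ :=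
  LinearMap.toContinuousBilinearMap (LinearMap.mk₂ ℝ
    (fun z w : Phase n => z.1 ⬝ᵥ X *ᵥ w.1 + z.1 ⬝ᵥ Y *ᵥ w.2 + z.2 ⬝ᵥ Z *ᵥ w.2)
    (fun z w u => by simp only [Prod.fst_add, Prod.snd_add, add_dotProduct]; ring)
    (fun a z u => by simp only [Prod.smul_fst, Prod.smul_snd, smul_dotProduct, smul_eq_mul]; ring)
    (fun z w u => by
      simp only [Prod.fst_add, Prod.snd_add, mulVec_add, dotProduct_add]; ring)
    (fun a z u => by
      simp only [Prod.smul_fst, Prod.smul_snd, mulVec_smul, dotProduct_smul, smul_eq_mul]; ring))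

lemma blockForm_apply (X Y Z : Matrix (Fin (n + 1)) (Fin (n + 1)) ℝ) (z w : Phase n) :
    blockForm X Y Z z w = z.1 ⬝ᵥ X *ᵥ w.1 + z.1 ⬝ᵥ Y *ᵥ w.2 + z.2 ⬝ᵥ Z *ᵥ w.2 := rfl

lemma dotProduct_transpose_mulVec (X : Matrix (Fin (n + 1)) (Fin (n + 1)) ℝ)
    (u v : Fin (n + 1) → ℝ) : u ⬝ᵥ Xᵀ *ᵥ v = v ⬝ᵥ X *ᵥ u := by
  rw [mulVec_transpose, dotProduct_comm, dotProduct_mulVec]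

lemma blockForm_momentumDir (X Y Z : Matrix (Fin (n + 1)) (Fin (n + 1)) ℝ) (x : Fin (n + 1)) :
    blockForm X Y Z (momentumDir x) (momentumDir x) = Z x x := by
  simp [blockForm_apply, momentumDir]

lemma dotProduct_flipDiag (Z : Matrix (Fin (n + 1)) (Fin (n + 1)) ℝ) (p : Fin (n + 1) → ℝ) :
    p ⬝ᵥ flipDiag Z *ᵥ p = ∑ x, (if x = 0 then 0 else p x ^ 2) * Z x x := by
  rw [dotProduct]
  refine Finset.sum_congr rfl fun x _ => ?_
  rw [flipDiag, mulVec_diagonal]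
  split_ifs
  · simp
  · ring

/-- Coefficient comparison: `hXY` cancels the mixed terms, `hqq` yields `-|q|²` and `hpp` yields
`-|p|²`. -/
lemma lyapunov_drift {ω₀ γ : ℝ} {X Y Z : Matrix (Fin (n + 1)) (Fin (n + 1)) ℝ}
    (hX : Xᵀ = X) (hZ : Zᵀ = Z) (hXY : X = γ • Y + stiffness ω₀ * Z)
    (hqq : Y * stiffness ω₀ + (Y * stiffness ω₀)ᵀ = (2 : ℝ) • 1)
    (hpp : Y + Yᵀ = (8 * γ) • (Z - flipDiag Z) - (2 : ℝ) • 1) (z : Phase n) :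
    blockForm X Y Z z (drift ω₀ (2 * γ) z) + blockForm X Y Z (drift ω₀ (2 * γ) z) z
      + 4 * γ * ∑ x, (if x = 0 then 0 else z.2 x ^ 2) * Z x x
      = -(z.1 ⬝ᵥ z.1) - z.2 ⬝ᵥ z.2 := by
  obtain ⟨q, p⟩ := z
  have h1 : q ⬝ᵥ Y *ᵥ (stiffness ω₀ *ᵥ q) = q ⬝ᵥ q := by
    have := congrArg (fun M => q ⬝ᵥ M *ᵥ q) hqq
    simp only [add_mulVec, dotProduct_add, dotProduct_transpose_mulVec, smul_mulVec,
      one_mulVec, dotProduct_smul, smul_eq_mul, ← mulVec_mulVec] at this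
    linarith
  have h2 : 2 * (p ⬝ᵥ Y *ᵥ p) = 8 * γ * (p ⬝ᵥ Z *ᵥ p - p ⬝ᵥ flipDiag Z *ᵥ p) - 2 * (p ⬝ᵥ p) := by
    have := congrArg (fun M => p ⬝ᵥ M *ᵥ p) hpp
    simp only [add_mulVec, sub_mulVec, dotProduct_add, dotProduct_sub,
      dotProduct_transpose_mulVec, smul_mulVec, one_mulVec, dotProduct_smul, smul_eq_mul] at this
    linarith
  have h3 : q ⬝ᵥ X *ᵥ p = γ * (q ⬝ᵥ Y *ᵥ p) + q ⬝ᵥ stiffness ω₀ *ᵥ (Z *ᵥ p) := by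
    rw [hXY, add_mulVec, smul_mulVec, dotProduct_add, dotProduct_smul, smul_eq_mul, mulVec_mulVec]
  have h4 : p ⬝ᵥ X *ᵥ q = q ⬝ᵥ X *ᵥ p := by
    rw [← dotProduct_transpose_mulVec, hX]
  have h5 : p ⬝ᵥ Z *ᵥ (stiffness ω₀ *ᵥ q) = (stiffness ω₀ *ᵥ q) ⬝ᵥ Z *ᵥ p := by
    rw [← dotProduct_transpose_mulVec, hZ]
  have h6 : (stiffness ω₀ *ᵥ q) ⬝ᵥ Z *ᵥ p = q ⬝ᵥ stiffness ω₀ *ᵥ (Z *ᵥ p) := by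
    rw [dotProduct_comm, ← dotProduct_transpose_mulVec, stiffness_transpose]
  rw [← dotProduct_flipDiag]
  simp only [blockForm_apply, drift_apply, mulVec_sub, mulVec_neg, mulVec_smul, dotProduct_sub,
    dotProduct_neg, dotProduct_smul, sub_dotProduct, neg_dotProduct, smul_dotProduct, smul_eq_mul]
  rw [h4, h5, h6, h3]
  linarith

/-- For twice the energy the Hamiltonian terms cancel, and flips conserve it; only the friction at
site `0` remains. -/
lemma energy_drift {ω₀ γ : ℝ} (hγ : 0 ≤ γ) (z : Phase n) :
    blockForm (stiffness ω₀) 0 1 z (drift ω₀ (2 * γ) z)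
      + blockForm (stiffness ω₀) 0 1 (drift ω₀ (2 * γ) z) z
      + 4 * γ * ∑ x, (if x = 0 then 0 else z.2 x ^ 2)
        * (1 : Matrix (Fin (n + 1)) (Fin (n + 1)) ℝ) x x ≤ 0 := by
  obtain ⟨q, p⟩ := z
  have h1 : p ⬝ᵥ stiffness ω₀ *ᵥ q = q ⬝ᵥ stiffness ω₀ *ᵥ p := by
    rw [← dotProduct_transpose_mulVec, stiffness_transpose]
  have h2 : (stiffness ω₀ *ᵥ q) ⬝ᵥ p = q ⬝ᵥ stiffness ω₀ *ᵥ p := by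
    rw [dotProduct_comm, h1]
  have h3 : ∑ x, (if x = 0 then 0 else p x ^ 2) *
      (1 : Matrix (Fin (n + 1)) (Fin (n + 1)) ℝ) x x ≤ p ⬝ᵥ p := by
    refine Finset.sum_le_sum fun x _ => ?_
    split_ifs
    · simpa using mul_self_nonneg (p x)
    · simp [sq]
  simp only [blockForm_apply, drift_apply, dotProduct_sub, zero_mulVec, dotProduct_zero,
    one_mulVec, dotProduct_neg, dotProduct_smul, sub_dotProduct, neg_dotProduct,
    smul_dotProduct, smul_eq_mul]
  rw [h2, h1]
  nlinarith

lemma norm_sq_le (z : Phase n) : ‖z‖ ^ 2 ≤ z.1 ⬝ᵥ z.1 + z.2 ⬝ᵥ z.2 := by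
  have h : ∀ v : Fin (n + 1) → ℝ, ‖v‖ ^ 2 ≤ v ⬝ᵥ v := fun v => by
    have h0 : 0 ≤ v ⬝ᵥ v := Finset.sum_nonneg fun _ _ => mul_self_nonneg _
    have : ‖v‖ ≤ Real.sqrt (v ⬝ᵥ v) := by
      refine (pi_norm_le_iff_of_nonneg (Real.sqrt_nonneg _)).2 fun x => ?_
      refine Real.abs_le_sqrt ?_
      rw [sq]
      exact Finset.single_le_sum (f := fun x => v x * v x) (fun _ _ => mul_self_nonneg _)
        (Finset.mem_univ x)
    calc ‖v‖ ^ 2 ≤ Real.sqrt (v ⬝ᵥ v) ^ 2 := by gcongr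
      _ = _ := Real.sq_sqrt h0
  have h1 := h z.1
  have h2 := h z.2
  have h3 : 0 ≤ ‖z.1‖ ^ 2 := sq_nonneg _
  have h4 : 0 ≤ ‖z.2‖ ^ 2 := sq_nonneg _
  rw [Prod.norm_def]
  rcases max_cases ‖z.1‖ ‖z.2‖ with h | h <;> rw [h.1] <;> linarith

/-- A quadratic Lyapunov function, uniform over external forces bounded by `S`. -/
lemma exists_lyapunov {ω₀ γ : ℝ} (hω₀ : 0 < ω₀) (hγ : 0 < γ) (T S : ℝ) :
    ∃ B : Phase n →L[ℝ] Phase n →L[ℝ] ℝ, ∃ c C : ℝ, 0 < c ∧ 0 ≤ C ∧ (∀ z, ‖z‖ ^ 2 ≤ B z z) ∧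
      ∀ f, |f| ≤ S → ∀ z, generator ω₀ γ T f (quadPoly B 0) z ≤ C - c * quadPoly B 0 z := by
  obtain ⟨X, Y, Z, hX, hZ, hXY, hqq, hpp⟩ := exists_lyapunov_blocks (n := n) hω₀ hγ
  set B₀ := blockForm X Y Z
  set B₁ : Phase n →L[ℝ] Phase n →L[ℝ] ℝ := blockForm (stiffness ω₀) 0 1 with hB₁
  set m := min (ω₀ ^ 2) 1 with hm
  have hm0 : 0 < m := lt_min (by positivity) one_pos
  -- The solution `B₀` of the Lyapunov equation need not be positive. Adding `M` times the energy
  -- form makes it dominate `‖z‖²` without spoiling the drift.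
  set M := (‖B₀‖ + 1) / m with hM
  have hM0 : 0 ≤ M := by positivity
  have hB₁ge : ∀ z, m * ‖z‖ ^ 2 ≤ B₁ z z := fun z => by
    have h1 := le_dotProduct_stiffness ω₀ z.1
    have h2 : 0 ≤ z.1 ⬝ᵥ z.1 := Finset.sum_nonneg fun _ _ => mul_self_nonneg _
    have h3 : 0 ≤ z.2 ⬝ᵥ z.2 := Finset.sum_nonneg fun _ _ => mul_self_nonneg _
    have h4 : B₁ z z = z.1 ⬝ᵥ stiffness ω₀ *ᵥ z.1 + z.2 ⬝ᵥ z.2 := by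
      simp [hB₁, blockForm_apply]
    have h5 : m ≤ ω₀ ^ 2 := min_le_left _ _
    have h6 : m ≤ 1 := min_le_right _ _
    have h7 := norm_sq_le z
    rw [h4]
    nlinarith
  set B := B₀ + M • B₁ with hB
  -- Half of the dissipation `‖z‖²` absorbs the force term by Young's inequality, at the cost of the
  -- first summand of `C`; the other half dominates `c B(z, z)`. The second summand bounds the
  -- thermostat noise.
  refine ⟨B, 1 / (2 * (‖B‖ + 1)), 2 * (‖B‖ * S * ‖momentumDir (Fin.last n)‖) ^ 2
    + |4 * γ * T * B (momentumDir 0) (momentumDir 0)|, by positivity, by positivity, ?_, ?_⟩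
  · intro z
    have h1 : |B₀ z z| ≤ ‖B₀‖ * ‖z‖ * ‖z‖ := B₀.le_opNorm₂ z z
    have h2 : B z z = B₀ z z + M * B₁ z z := rfl
    have h3 : M * (m * ‖z‖ ^ 2) = (‖B₀‖ + 1) * ‖z‖ ^ 2 := by
      rw [hM]; field_simp
    have h4 := mul_le_mul_of_nonneg_left (hB₁ge z) hM0
    rw [h2]
    nlinarith [neg_abs_le (B₀ z z)]
  · intro f hf z
    set e := momentumDir (Fin.last n)
    set d := drift ω₀ (2 * γ) z with hd
    have hgen : generator ω₀ γ T f (quadPoly B 0) z =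
        (B₀ z d + B₀ d z + 4 * γ * ∑ x, (if x = 0 then 0 else z.2 x ^ 2) * Z x x)
        + M * (B₁ z d + B₁ d z + 4 * γ * ∑ x, (if x = 0 then 0 else z.2 x ^ 2) *
          (1 : Matrix (Fin (n + 1)) (Fin (n + 1)) ℝ) x x)
        + f * (B z e + B e z) + 4 * γ * T * B (momentumDir 0) (momentumDir 0) := by
      have hBe : ∀ x, B (momentumDir x) (momentumDir x) =
          Z x x + M * (1 : Matrix (Fin (n + 1)) (Fin (n + 1)) ℝ) x x := fun x => by
        rw [← blockForm_momentumDir X Y Z, ← blockForm_momentumDir (stiffness ω₀) 0 1]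
        rfl
      have hBa : ∀ u v, B u v = B₀ u v + M * B₁ u v := fun u v => rfl
      rw [generator_quadPoly]
      simp only [hBe, Fin.sum_univ_succ, if_true, Fin.succ_ne_zero, if_false, map_add, map_smul,
        _root_.add_apply, _root_.smul_apply, smul_eq_mul, mul_add, Finset.sum_add_distrib,
        _root_.zero_apply, hBa, Finset.mul_sum, zero_mul]
      simp only [mul_left_comm M, mul_comm M]
      ring
    have h1 : |B z e| ≤ ‖B‖ * ‖z‖ * ‖e‖ := B.le_opNorm₂ z e
    have h2 : |B e z| ≤ ‖B‖ * ‖e‖ * ‖z‖ := B.le_opNorm₂ e z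
    have h3 : f * (B z e + B e z) ≤ 2 * (‖B‖ * S * ‖e‖) * ‖z‖ := by
      calc f * (B z e + B e z) ≤ |f| * |B z e + B e z| := by
            rw [← abs_mul]; exact le_abs_self _
        _ ≤ S * (‖B‖ * ‖z‖ * ‖e‖ + ‖B‖ * ‖e‖ * ‖z‖) :=
            mul_le_mul hf ((abs_add_le _ _).trans (add_le_add h1 h2)) (abs_nonneg _)
              ((abs_nonneg f).trans hf)
        _ = _ := by ring
    have h4 := lyapunov_drift hX hZ hXY hqq hpp z
    have h5 := mul_le_mul_of_nonneg_left (energy_drift (ω₀ := ω₀) hγ.le z) hM0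
    have h6 := norm_sq_le z
    have h7 : quadPoly B 0 z ≤ ‖B‖ * ‖z‖ ^ 2 := by
      have : |B z z| ≤ ‖B‖ * ‖z‖ * ‖z‖ := B.le_opNorm₂ z z
      simp only [quadPoly, _root_.zero_apply, add_zero]
      nlinarith [le_abs_self (B z z)]
    have h8 : 1 / (2 * (‖B‖ + 1)) * quadPoly B 0 z ≤ ‖z‖ ^ 2 / 2 := by
      have hb : 0 ≤ ‖B‖ := norm_nonneg B
      rw [div_mul_eq_mul_div, one_mul, div_le_iff₀ (by positivity)]
      nlinarith [sq_nonneg ‖z‖]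
    have h9 := le_abs_self (4 * γ * T * B (momentumDir 0) (momentumDir 0))
    have h10 : 2 * (‖B‖ * S * ‖e‖) * ‖z‖ ≤ ‖z‖ ^ 2 / 2 + 2 * (‖B‖ * S * ‖e‖) ^ 2 := by
      linarith [sq_nonneg (‖z‖ - 2 * (‖B‖ * S * ‖e‖)),
        show (‖z‖ - 2 * (‖B‖ * S * ‖e‖)) ^ 2 = ‖z‖ ^ 2 - 2 * (2 * (‖B‖ * S * ‖e‖) * ‖z‖)
          + 4 * (‖B‖ * S * ‖e‖) ^ 2 by ring]
    rw [mul_zero] at h5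
    rw [hgen, h4]
    linarith

/-! ### Concave truncations and finiteness of second moments -/

/-- A smooth nonincreasing function equal to `1` on `(-∞, k + 1]` and to `0` on `[2 k + 2, ∞)`. -/
def truncSlope (k : ℕ) (s : ℝ) : ℝ := 1 - Real.smoothTransition (s / (k + 1) - 1)

/-- A smooth concave truncation of the identity: the primitive of `truncSlope k`. -/
def trunc (k : ℕ) (v : ℝ) : ℝ := ∫ s in (0 : ℝ)..v, truncSlope k s

lemma contDiff_truncSlope (k : ℕ) : ContDiff ℝ ∞ (truncSlope k) := by
  unfold truncSlope
  exact contDiff_const.sub (Real.smoothTransition.contDiff.comp (by fun_prop))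

lemma continuous_truncSlope (k : ℕ) : Continuous (truncSlope k) := (contDiff_truncSlope k).continuous

lemma hasDerivAt_trunc (k : ℕ) (v : ℝ) : HasDerivAt (trunc k) (truncSlope k v) v :=
  intervalIntegral.integral_hasDerivAt_right ((continuous_truncSlope k).intervalIntegrable _ _)
    ((continuous_truncSlope k).stronglyMeasurableAtFilter _ _) (continuous_truncSlope k).continuousAt

lemma contDiff_trunc (k : ℕ) : ContDiff ℝ ∞ (trunc k) := by
  refine contDiff_infty_iff_deriv.2 ⟨fun v => (hasDerivAt_trunc k v).differentiableAt, ?_⟩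
  have : deriv (trunc k) = truncSlope k := funext fun v => (hasDerivAt_trunc k v).deriv
  rw [this]
  exact contDiff_truncSlope k

lemma antitone_truncSlope (k : ℕ) : Antitone (truncSlope k) := fun a b hab => by
  have : a / ((k : ℝ) + 1) - 1 ≤ b / (k + 1) - 1 := by gcongr
  have := Real.smoothTransition.monotone this
  simp only [truncSlope]
  linarith

lemma truncSlope_nonneg (k : ℕ) (s : ℝ) : 0 ≤ truncSlope k s :=
  sub_nonneg.2 (Real.smoothTransition.le_one _)

lemma truncSlope_le_one (k : ℕ) (s : ℝ) : truncSlope k s ≤ 1 :=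
  sub_le_self _ (Real.smoothTransition.nonneg _)

lemma truncSlope_of_le {k : ℕ} {s : ℝ} (h : s ≤ k + 1) : truncSlope k s = 1 := by
  have hk : (0 : ℝ) < k + 1 := by positivity
  rw [truncSlope, Real.smoothTransition.zero_of_nonpos, sub_zero]
  rw [sub_nonpos, div_le_one hk]
  exact h

lemma truncSlope_of_ge {k : ℕ} {s : ℝ} (h : 2 * (k + 1) ≤ s) : truncSlope k s = 0 := by
  have hk : (0 : ℝ) < k + 1 := by positivity
  rw [truncSlope, Real.smoothTransition.one_of_one_le, sub_self]
  rw [le_sub_iff_add_le, le_div_iff₀ hk]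
  linarith

lemma trunc_sub_eq (k : ℕ) (a b : ℝ) : trunc k b - trunc k a = ∫ s in a..b, truncSlope k s :=
  intervalIntegral.integral_interval_sub_left ((continuous_truncSlope k).intervalIntegrable _ _)
    ((continuous_truncSlope k).intervalIntegrable _ _)

lemma trunc_sub_le (k : ℕ) (a b : ℝ) : trunc k b - trunc k a ≤ truncSlope k a * (b - a) := by
  have hi : ∀ u v : ℝ, IntervalIntegrable (truncSlope k) volume u v := fun u v =>
    (continuous_truncSlope k).intervalIntegrable _ _
  rcases le_total a b with h | h
  · rw [trunc_sub_eq]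
    have := intervalIntegral.integral_mono_on h (hi a b) (intervalIntegrable_const (c := truncSlope k a))
      fun s hs => antitone_truncSlope k hs.1
    simpa [mul_comm] using this
  · have := intervalIntegral.integral_mono_on h (intervalIntegrable_const (c := truncSlope k a))
      (hi b a) fun s hs => antitone_truncSlope k hs.2
    rw [← trunc_sub_eq] at this
    simp only [intervalIntegral.integral_const, smul_eq_mul] at this
    linarith

lemma trunc_nonneg (k : ℕ) {v : ℝ} (hv : 0 ≤ v) : 0 ≤ trunc k v :=
  intervalIntegral.integral_nonneg hv fun s _ => truncSlope_nonneg k s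

lemma trunc_zero (k : ℕ) : trunc k 0 = 0 := by simp [trunc]

lemma trunc_le (k : ℕ) {v : ℝ} (hv : 0 ≤ v) : trunc k v ≤ v := by
  have := trunc_sub_le k 0 v
  rw [trunc_zero, sub_zero, sub_zero] at this
  exact this.trans (mul_le_of_le_one_left hv (truncSlope_le_one _ _))

lemma trunc_of_le {k : ℕ} {v : ℝ} (h : v ≤ k + 1) (hv : 0 ≤ v) : trunc k v = v := by
  have : trunc k v = ∫ _s in (0 : ℝ)..v, (1 : ℝ) := by
    refine intervalIntegral.integral_congr fun s hs => ?_
    rw [Set.uIcc_of_le hv] at hs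
    exact truncSlope_of_le (hs.2.trans h)
  rw [this]
  simp

lemma trunc_of_ge {k : ℕ} {v : ℝ} (h : 2 * (k + 1) ≤ v) : trunc k v = trunc k (2 * (k + 1)) := by
  rw [← sub_eq_zero, trunc_sub_eq]
  have : ∫ s in (2 * ((k : ℝ) + 1))..v, truncSlope k s = ∫ _s in (2 * ((k : ℝ) + 1))..v, (0 : ℝ) := by
    refine intervalIntegral.integral_congr fun s hs => ?_
    rw [Set.uIcc_of_le h] at hs
    exact truncSlope_of_ge hs.1
  rw [this]
  simp

section State

variable {ω₀ γ T Θ : ℝ} {f : ℝ → ℝ} {μ : ℝ → Measure (Phase n)}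

lemma IsPeriodicState.integrable_test (hμ : IsPeriodicState ω₀ γ T Θ f μ) {G : Phase n → ℝ}
    (hG : ContDiff ℝ ∞ G) (hc : HasCompactSupport G) {t : ℝ} (ht : 0 ≤ t) :
    Integrable G (μ t) := by
  have := hμ.isProbabilityMeasure t ht
  exact hG.continuous.integrable_of_hasCompactSupport hc

lemma IsPeriodicState.continuousOn_test (hμ : IsPeriodicState ω₀ γ T Θ f μ) {G : Phase n → ℝ}
    (hG : ContDiff ℝ ∞ G) (hc : HasCompactSupport G) :
    ContinuousOn (fun t => ∫ z, G z ∂(μ t)) (Set.Ici 0) :=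
  fun t ht => (hμ.forward G hG hc t ht).continuousWithinAt

lemma IsPeriodicState.continuousOn_generator (hμ : IsPeriodicState ω₀ γ T Θ f μ)
    (hf : Continuous f) {G : Phase n → ℝ} (hG : ContDiff ℝ ∞ G) (hc : HasCompactSupport G) :
    ContinuousOn (fun t => ∫ z, generator ω₀ γ T (f t) G z ∂(μ t)) (Set.Ici 0) := by
  have h1 := hμ.continuousOn_test (contDiff_generator hG ω₀ γ T 0)
    (hasCompactSupport_generator hc ω₀ γ T 0)
  have hdc : HasCompactSupport (dp (Fin.last n) G) := hc.fderiv_apply ℝ _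
  have h2 := hμ.continuousOn_test (contDiff_dp hG (Fin.last n)) hdc
  refine (h1.add (hf.continuousOn.mul h2)).congr fun t ht => ?_
  simp only [generator_eq_add_force ω₀ γ T (f t)]
  rw [integral_add, integral_const_mul]
  · rfl
  · exact hμ.integrable_test (contDiff_generator hG ω₀ γ T 0)
      (hasCompactSupport_generator hc ω₀ γ T 0) ht
  · exact (hμ.integrable_test (contDiff_dp hG _) hdc ht).const_mul _

lemma integral_eq_sub_of_hasDerivWithinAt_Ici {u u' : ℝ → ℝ}
    (hu : ∀ t, 0 ≤ t → HasDerivWithinAt u (u' t) (Set.Ici 0) t)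
    (hu' : ContinuousOn u' (Set.Ici 0)) {a b : ℝ} (ha : 0 ≤ a) (hab : a ≤ b) :
    ∫ t in a..b, u' t = u b - u a := by
  have hsub : Set.uIcc a b ⊆ Set.Ici 0 := by
    rw [Set.uIcc_of_le hab]; exact fun t ht => ha.trans ht.1
  refine intervalIntegral.integral_eq_sub_of_hasDeriv_right
    (fun t ht => ((hu t (hsub ht)).continuousWithinAt).mono hsub) (fun t ht => ?_)
    (hu'.mono hsub).intervalIntegrable
  rw [min_eq_left hab, max_eq_right hab] at ht
  exact (hu t (ha.trans ht.1.le)).mono fun s hs => (ha.trans ht.1.le).trans (le_of_lt hs)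

lemma IsPeriodicState.integral_generator (hμ : IsPeriodicState ω₀ γ T Θ f μ)
    (hf : Continuous f) {G : Phase n → ℝ} (hG : ContDiff ℝ ∞ G) (hc : HasCompactSupport G)
    {a b : ℝ} (ha : 0 ≤ a) (hab : a ≤ b) :
    ∫ t in a..b, ∫ z, generator ω₀ γ T (f t) G z ∂(μ t) =
      ∫ z, G z ∂(μ b) - ∫ z, G z ∂(μ a) :=
  integral_eq_sub_of_hasDerivWithinAt_Ici (fun t ht => hμ.forward G hG hc t ht)
    (hμ.continuousOn_generator hf hG hc) ha hab

lemma hasCompactSupport_of_lyapunov {V F : Phase n → ℝ} (hV : ∀ z, ‖z‖ ^ 2 ≤ V z) {r : ℝ}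
    (hF : ∀ z, r ≤ V z → F z = 0) : HasCompactSupport F := by
  refine HasCompactSupport.intro (isCompact_closedBall (0 : Phase n) (Real.sqrt r)) fun z hz => ?_
  refine hF z (le_trans ?_ (hV z))
  have hz : Real.sqrt r < ‖z‖ := by simpa using hz
  exact (Real.sqrt_le_left (norm_nonneg z)).1 hz.le

/-- Fatou's lemma for approximations that are eventually exact at each point. -/
lemma lintegral_ofReal_le_liminf {ν : Measure (Phase n)} {V : Phase n → ℝ} {F : ℕ → Phase n → ℝ} (hF : ∀ k, Continuous (F k))
    (hF0 : ∀ k z, 0 ≤ F k z) (hFi : ∀ k, Integrable (F k) ν)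
    (hFV : ∀ z, ∀ᶠ k in Filter.atTop, F k z = V z) :
    ∫⁻ z, ENNReal.ofReal (V z) ∂ν ≤
      Filter.liminf (fun k => ENNReal.ofReal (∫ z, F k z ∂ν)) Filter.atTop := by
  have h1 : ∀ z, ENNReal.ofReal (V z) =
      Filter.liminf (fun k => ENNReal.ofReal (F k z)) Filter.atTop := fun z => by
    have : Filter.Tendsto (fun k => ENNReal.ofReal (F k z)) Filter.atTop
        (nhds (ENNReal.ofReal (V z))) :=
      tendsto_const_nhds.congr' ((hFV z).mono fun k hk => by simp only [hk])
    exact this.liminf_eq.symm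
  calc ∫⁻ z, ENNReal.ofReal (V z) ∂ν
      = ∫⁻ z, Filter.liminf (fun k => ENNReal.ofReal (F k z)) Filter.atTop ∂ν :=
        lintegral_congr h1
    _ ≤ Filter.liminf (fun k => ∫⁻ z, ENNReal.ofReal (F k z) ∂ν) Filter.atTop :=
        lintegral_liminf_le fun k => (hF k).measurable.ennreal_ofReal
    _ = _ := by
        congr 1
        funext k
        rw [ofReal_integral_eq_lintegral_ofReal (hFi k) (Filter.Eventually.of_forall (hF0 k))]

lemma eventually_le_natCast_add_one (v : ℝ) : ∀ᶠ k : ℕ in Filter.atTop, v ≤ (k : ℝ) + 1 := by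
  filter_upwards [Filter.eventually_ge_atTop ⌈v⌉₊] with k hk
  have : (⌈v⌉₊ : ℝ) ≤ k := by exact_mod_cast hk
  linarith [Nat.le_ceil v]

/-- Every periodic state has finite second moments, bounded locally uniformly in time. -/
theorem IsPeriodicState.exists_moment_bound (hμ : IsPeriodicState ω₀ γ T Θ f μ) (hω₀ : 0 < ω₀)
    (hγ : 0 < γ) (hT : 0 ≤ T) (hΘ : 0 < Θ) (hf : Continuous f) {S : ℝ} (hS : ∀ t, |f t| ≤ S) :
    ∃ M, 0 ≤ M ∧ ∀ t, 0 ≤ t →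
      Integrable (fun z => ‖z‖ ^ 2) (μ t) ∧ ∫ z, ‖z‖ ^ 2 ∂(μ t) ≤ M * (1 + t) := by
  obtain ⟨B, c, C, hc, hC, hBV, hgen⟩ := exists_lyapunov (n := n) hω₀ hγ T S
  set V := quadPoly B 0 with hVdef
  have hV : ∀ z, ‖z‖ ^ 2 ≤ V z := fun z => by
    simpa [hVdef, quadPoly] using hBV z
  have hV0 : ∀ z, 0 ≤ V z := fun z => (sq_nonneg _).trans (hV z)
  have hVs : ContDiff ℝ ∞ V := contDiff_quadPoly B 0
  -- The truncation is constant for large `V`; subtracting that constant gives an admissible test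
  -- function and leaves the generator unchanged.
  let g : ℕ → Phase n → ℝ := fun k z => trunc k (V z) + -trunc k (2 * (k + 1))
  let h : ℕ → Phase n → ℝ := fun k z => truncSlope k (V z) * V z
  have hgs : ∀ k, ContDiff ℝ ∞ (g k) := fun k => ((contDiff_trunc k).comp hVs).add contDiff_const
  have hgc : ∀ k, HasCompactSupport (g k) := fun k =>
    hasCompactSupport_of_lyapunov hV (r := 2 * (k + 1)) fun z hz => by
      simp only [g, trunc_of_ge hz, add_neg_cancel]
  have hhs : ∀ k, ContDiff ℝ ∞ (h k) := fun k => ((contDiff_truncSlope k).comp hVs).mul hVs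
  have hhc : ∀ k, HasCompactSupport (h k) := fun k =>
    hasCompactSupport_of_lyapunov hV (r := 2 * (k + 1)) fun z hz => by
      simp only [h, truncSlope_of_ge hz, zero_mul]
  have hh0 : ∀ k z, 0 ≤ h k z := fun k z => mul_nonneg (truncSlope_nonneg _ _) (hV0 z)
  have hle : ∀ k t z, generator ω₀ γ T (f t) (g k) z ≤ C - c * h k z := fun k t z => by
    rw [generator_add_const]
    refine (generator_comp_le hγ.le hT (f t) hVs (hasDerivAt_trunc k)
      ((contDiff_truncSlope k).differentiable (by simp)) (antitone_truncSlope k)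
      (trunc_sub_le k) z).trans ?_
    have h1 := mul_le_mul_of_nonneg_left (hgen (f t) (hS t) z) (truncSlope_nonneg k (V z))
    have h2 := mul_le_mul_of_nonneg_right (truncSlope_le_one k (V z)) hC
    simp only [h]
    linarith
  have hEle : ∀ k t, 0 ≤ t → ∫ z, generator ω₀ γ T (f t) (g k) z ∂(μ t) ≤
      C - c * ∫ z, h k z ∂(μ t) := fun k t ht => by
    have := hμ.isProbabilityMeasure t ht
    have hi := (hμ.integrable_test (hhs k) (hhc k) ht).const_mul c
    calc ∫ z, generator ω₀ γ T (f t) (g k) z ∂(μ t) ≤ ∫ z, (C - c * h k z) ∂(μ t) :=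
          integral_mono (hμ.integrable_test (contDiff_generator (hgs k) _ _ _ _)
            (hasCompactSupport_generator (hgc k) _ _ _ _) ht) ((integrable_const C).sub hi)
            (hle k t)
      _ = _ := by
          rw [integral_sub (integrable_const C) hi, integral_const_mul]
          simp
  -- Periodicity kills the boundary terms over one period, leaving a bound on the dissipation that
  -- is uniform in `k`.
  have hperiod : ∀ k, ∫ t in (0 : ℝ)..Θ, ∫ z, h k z ∂(μ t) ≤ C * Θ / c := fun k => by
    have h1 := hμ.integral_generator hf (hgs k) (hgc k) le_rfl hΘ.le
    have h2 : μ Θ = μ 0 := by simpa using hμ.periodic 0 le_rfl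
    rw [h2, sub_self] at h1
    have hsub : Set.uIcc 0 Θ ⊆ Set.Ici 0 := by
      rw [Set.uIcc_of_le hΘ.le]; exact fun t ht => ht.1
    have hi1 := ((hμ.continuousOn_generator hf (hgs k) (hgc k)).mono hsub).intervalIntegrable
      (μ := volume)
    have hi2 := ((hμ.continuousOn_test (hhs k) (hhc k)).mono hsub).intervalIntegrable
      (μ := volume)
    have h3 := intervalIntegral.integral_mono_on hΘ.le hi1
      (intervalIntegrable_const.sub (hi2.const_mul c)) fun t ht => hEle k t ht.1
    rw [h1, intervalIntegral.integral_sub intervalIntegrable_const (hi2.const_mul c),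
      intervalIntegral.integral_const_mul] at h3
    simp only [intervalIntegral.integral_const, smul_eq_mul, sub_zero] at h3
    rw [le_div_iff₀ hc]
    linarith
  -- Fatou in time: the liminf is integrable over the period, hence finite at some instant. Fatou in
  -- space then makes `V` integrable at that instant.
  obtain ⟨t₀, ht₀, hfin⟩ : ∃ t₀ ∈ Set.Ioc 0 Θ,
      Filter.liminf (fun k => ENNReal.ofReal (∫ z, h k z ∂(μ t₀))) Filter.atTop < ⊤ := by
    have hmeas : ∀ k, AEMeasurable (fun t => ENNReal.ofReal (∫ z, h k z ∂(μ t)))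
        (volume.restrict (Set.Ioc 0 Θ)) := fun k =>
      (((hμ.continuousOn_test (hhs k) (hhc k)).mono fun t ht => ht.1.le).aemeasurable
        measurableSet_Ioc).ennreal_ofReal
    have hlint : ∀ k, ∫⁻ t in Set.Ioc 0 Θ, ENNReal.ofReal (∫ z, h k z ∂(μ t)) ≤
        ENNReal.ofReal (C * Θ / c) := fun k => by
      have hsub : Set.uIcc 0 Θ ⊆ Set.Ici 0 := by
        rw [Set.uIcc_of_le hΘ.le]; exact fun t ht => ht.1
      have hi2 := ((hμ.continuousOn_test (hhs k) (hhc k)).mono hsub).intervalIntegrable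
        (μ := volume)
      rw [← ofReal_integral_eq_lintegral_ofReal
        ((intervalIntegrable_iff_integrableOn_Ioc_of_le hΘ.le).1 hi2)
        (Filter.Eventually.of_forall fun t => integral_nonneg (hh0 k)),
        ← intervalIntegral.integral_of_le hΘ.le]
      exact ENNReal.ofReal_le_ofReal (hperiod k)
    have hlt : ∫⁻ t in Set.Ioc 0 Θ, Filter.liminf
        (fun k => ENNReal.ofReal (∫ z, h k z ∂(μ t))) Filter.atTop < ⊤ := by
      refine lt_of_le_of_lt (lintegral_liminf_le' hmeas) (lt_of_le_of_lt
        (Filter.liminf_le_of_le (by isBoundedDefault)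
          (a := ENNReal.ofReal (C * Θ / c)) fun b hb => ?_)
        ENNReal.ofReal_lt_top)
      obtain ⟨k, hk⟩ := hb.exists
      exact hk.trans (hlint k)
    have hmeas' : AEMeasurable (fun t => Filter.liminf
        (fun k => ENNReal.ofReal (∫ z, h k z ∂(μ t))) Filter.atTop)
        (volume.restrict (Set.Ioc 0 Θ)) := by
      simp only [Filter.liminf_eq_iSup_iInf_of_nat]
      exact AEMeasurable.iSup fun i => AEMeasurable.biInf _ (Set.to_countable _) fun k _ => hmeas k
    have hae := ae_lt_top' hmeas' hlt.ne
    have hpos : volume (Set.Ioc 0 Θ) ≠ 0 := by simp [hΘ]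
    have hne : (ae (volume.restrict (Set.Ioc 0 Θ))).NeBot := by
      rw [ae_neBot]
      exact fun h0 => hpos (Measure.restrict_eq_zero.1 h0)
    obtain ⟨t, ht1, ht2⟩ := (hae.and (ae_restrict_mem measurableSet_Ioc)).exists
    exact ⟨t, ht2, ht1⟩
  have hlint₀ : ∫⁻ z, ENNReal.ofReal (V z) ∂(μ t₀) < ⊤ :=
    (lintegral_ofReal_le_liminf (fun k => (hhs k).continuous) hh0
      (fun k => hμ.integrable_test (hhs k) (hhc k) ht₀.1.le) fun z => by
        filter_upwards [eventually_le_natCast_add_one (V z)] with k hk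
        simp only [h, truncSlope_of_le hk, one_mul]).trans_lt hfin
  have hint₀ : Integrable V (μ t₀) := by
    refine ⟨hVs.continuous.aestronglyMeasurable, ?_⟩
    rwa [hasFiniteIntegral_iff_ofReal (Filter.Eventually.of_forall hV0)]
  set A := ∫ z, V z ∂(μ t₀) with hA
  have hA0 : 0 ≤ A := integral_nonneg hV0
  have hint_trunc : ∀ k t, 0 ≤ t → Integrable (fun z => trunc k (V z)) (μ t) := fun k t ht => by
    have := hμ.isProbabilityMeasure t ht
    have h1 := (hμ.integrable_test (hgs k) (hgc k) ht).add
      (integrable_const (trunc k (2 * (k + 1))))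
    refine h1.congr (Filter.Eventually.of_forall fun z => ?_)
    simp [g]
  -- From `t₀` onwards the truncated moments grow at rate at most `C`, uniformly in `k`.
  have hgrow : ∀ k t, t₀ ≤ t → ∫ z, trunc k (V z) ∂(μ t) ≤ A + C * (t - t₀) := fun k t ht => by
    have h0 := ht₀.1.le
    have ht0 := h0.trans ht
    have := hμ.isProbabilityMeasure t ht0
    have := hμ.isProbabilityMeasure t₀ h0
    have h1 := hμ.integral_generator hf (hgs k) (hgc k) h0 ht
    have hsub : Set.uIcc t₀ t ⊆ Set.Ici 0 := by
      rw [Set.uIcc_of_le ht]; exact fun s hs => h0.trans hs.1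
    have hi1 := ((hμ.continuousOn_generator hf (hgs k) (hgc k)).mono hsub).intervalIntegrable
      (μ := volume)
    have h3 := intervalIntegral.integral_mono_on ht hi1 (intervalIntegrable_const (c := C))
      fun s hs => (hEle k s (h0.trans hs.1)).trans
        (sub_le_self _ (mul_nonneg hc.le (integral_nonneg (hh0 k))))
    rw [h1] at h3
    simp only [g] at h3
    rw [integral_add (hint_trunc k t ht0) (integrable_const _),
      integral_add (hint_trunc k t₀ h0) (integrable_const _)] at h3
    simp only [intervalIntegral.integral_const, smul_eq_mul, integral_const, probReal_univ,
      one_mul] at h3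
    have h4 : ∫ z, trunc k (V z) ∂(μ t₀) ≤ A :=
      integral_mono (hint_trunc k t₀ h0) hint₀ fun z => trunc_le k (hV0 z)
    linarith
  have hbound : ∀ t, t₀ ≤ t → ∫⁻ z, ENNReal.ofReal (V z) ∂(μ t) ≤
      ENNReal.ofReal (A + C * (t - t₀)) := fun t ht => by
    refine (lintegral_ofReal_le_liminf
      (fun k => ((contDiff_trunc k).comp hVs).continuous) (fun k z => trunc_nonneg k (hV0 z))
      (fun k => hint_trunc k t (ht₀.1.le.trans ht)) fun z => ?_).trans
      (Filter.liminf_le_of_le (by isBoundedDefault) fun b hb => ?_)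
    · filter_upwards [eventually_le_natCast_add_one (V z)] with k hk
      exact trunc_of_le hk (hV0 z)
    · obtain ⟨k, hk⟩ := hb.exists
      exact hk.trans (ENNReal.ofReal_le_ofReal (hgrow k t ht))
  refine ⟨A + C * (Θ + 1), by positivity, fun t ht => ?_⟩
  -- Since `t₀ ≤ Θ ≤ t + Θ`, a shift by one period also covers the times before `t₀`.
  have hlt := hbound (t + Θ) (by linarith [ht₀.2])
  rw [hμ.periodic t ht] at hlt
  have hVi : Integrable V (μ t) := by
    refine ⟨hVs.continuous.aestronglyMeasurable, ?_⟩
    rw [hasFiniteIntegral_iff_ofReal (Filter.Eventually.of_forall hV0)]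
    exact hlt.trans_lt ENNReal.ofReal_lt_top
  have hVle : ∫ z, V z ∂(μ t) ≤ A + C * (t + Θ - t₀) := by
    rw [← ofReal_integral_eq_lintegral_ofReal hVi (Filter.Eventually.of_forall hV0)] at hlt
    refine (ENNReal.ofReal_le_ofReal_iff ?_).1 hlt
    have : 0 ≤ C * (t + Θ - t₀) := mul_nonneg hC (by linarith [ht₀.2])
    linarith
  have hni : Integrable (fun z : Phase n => ‖z‖ ^ 2) (μ t) :=
    hVi.mono' (by fun_prop) (Filter.Eventually.of_forall fun z => by
      rw [Real.norm_of_nonneg (sq_nonneg _)]; exact hV z)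
  refine ⟨hni, (integral_mono hni hVi hV).trans (hVle.trans ?_)⟩
  have h1 := ht₀.1
  nlinarith [mul_nonneg hC ht, mul_nonneg hA0 ht, mul_nonneg (mul_nonneg hC hΘ.le) ht,
    mul_nonneg hC h1.le]

end State

/-! ### Spatial cutoffs of quadratic polynomials -/

/-- A smooth bump function on phase space. -/
def cutoffBump (n : ℕ) : ContDiffBump (0 : Phase n) := ⟨1, 2, one_pos, one_lt_two⟩

/-- The rescaled bump function, equal to `1` on the ball of radius `k + 1`. -/
def cutoff (k : ℕ) (z : Phase n) : ℝ := cutoffBump n (((k : ℝ) + 1)⁻¹ • z)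

lemma contDiff_cutoff (k : ℕ) : ContDiff ℝ ∞ (cutoff (n := n) k) :=
  (cutoffBump n).contDiff.comp (contDiff_const_smul _)

lemma cutoff_of_norm_lt {k : ℕ} {z : Phase n} (hz : ‖z‖ < k + 1) : cutoff k z = 1 := by
  have hk : (0 : ℝ) < k + 1 := by positivity
  refine (cutoffBump n).one_of_mem_closedBall ?_
  simp only [cutoffBump, Metric.mem_closedBall, dist_zero_right, norm_smul, norm_inv]
  rw [Real.norm_of_nonneg hk.le, inv_mul_le_iff₀ hk]
  linarith

lemma hasCompactSupport_cutoff (k : ℕ) : HasCompactSupport (cutoff (n := n) k) := by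
  have hk : (0 : ℝ) < k + 1 := by positivity
  refine HasCompactSupport.intro (isCompact_closedBall (0 : Phase n) (2 * (k + 1))) fun z hz => ?_
  refine (cutoffBump n).zero_of_le_dist ?_
  simp only [Metric.mem_closedBall, dist_zero_right, not_le] at hz
  simp only [cutoffBump, dist_zero_right, norm_smul, norm_inv]
  rw [Real.norm_of_nonneg hk.le, le_inv_mul_iff₀ hk]
  linarith

lemma abs_cutoff_le_one (k : ℕ) (z : Phase n) : |cutoff k z| ≤ 1 := by
  exact abs_le.2 ⟨(by norm_num : (-1 : ℝ) ≤ 0).trans (cutoffBump n).nonneg, (cutoffBump n).le_one⟩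

lemma fderiv_cutoff (k : ℕ) (z v : Phase n) : fderiv ℝ (cutoff k) z v =
    ((k : ℝ) + 1)⁻¹ * fderiv ℝ (cutoffBump n) (((k : ℝ) + 1)⁻¹ • z) v := by
  have h1 : HasFDerivAt (cutoffBump n : Phase n → ℝ) _ (((k : ℝ) + 1)⁻¹ • z) :=
    (((cutoffBump n).contDiff (n := 1)).differentiable (by simp) _).hasFDerivAt
  have h2 : HasFDerivAt (fun w : Phase n => ((k : ℝ) + 1)⁻¹ • w)
      (((k : ℝ) + 1)⁻¹ • ContinuousLinearMap.id ℝ (Phase n)) z :=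
    (((k : ℝ) + 1)⁻¹ • ContinuousLinearMap.id ℝ (Phase n)).hasFDerivAt
  have h3 : fderiv ℝ (cutoff k) z = _ := (h1.comp z h2).fderiv
  rw [h3]
  simp

lemma dp_dp_cutoff (k : ℕ) (x : Fin (n + 1)) (z : Phase n) : dp x (dp x (cutoff k)) z =
    ((k : ℝ) + 1)⁻¹ * (((k : ℝ) + 1)⁻¹ *
      dp x (dp x (cutoffBump n)) (((k : ℝ) + 1)⁻¹ • z)) := by
  have h0 : dp x (cutoff (n := n) k) = fun w =>
      ((k : ℝ) + 1)⁻¹ * dp x (cutoffBump n) (((k : ℝ) + 1)⁻¹ • w) :=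
    funext fun w => fderiv_cutoff k w _
  have h1 : HasFDerivAt (dp x (cutoffBump n) : Phase n → ℝ) _ (((k : ℝ) + 1)⁻¹ • z) :=
    ((contDiff_dp (cutoffBump n).contDiff x).differentiable (by simp) _).hasFDerivAt
  have h2 : HasFDerivAt (fun w : Phase n => ((k : ℝ) + 1)⁻¹ • w)
      (((k : ℝ) + 1)⁻¹ • ContinuousLinearMap.id ℝ (Phase n)) z :=
    (((k : ℝ) + 1)⁻¹ • ContinuousLinearMap.id ℝ (Phase n)).hasFDerivAt
  have h3 : HasFDerivAt (fun w => ((k : ℝ) + 1)⁻¹ *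
      dp x (cutoffBump n) (((k : ℝ) + 1)⁻¹ • w)) _ z := (h1.comp z h2).const_mul _
  rw [h0, dp, h3.fderiv]
  simp [dp]

/-- Derivatives of the cutoffs decay uniformly in the cutoff scale. -/
lemma exists_cutoff_bounds (n : ℕ) : ∃ C, 0 ≤ C ∧ ∀ (k : ℕ) (z : Phase n),
    (∀ v, |fderiv ℝ (cutoff k) z v| * (1 + ‖z‖) ≤ C * ‖v‖) ∧
      |dp 0 (dp 0 (cutoff k)) z| * (1 + ‖z‖) ^ 2 ≤ C := by
  have hs := (cutoffBump n).contDiff (n := ⊤)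
  have hc := (cutoffBump n).hasCompactSupport
  have hF1 : Continuous fun w : Phase n => (1 + ‖w‖) • fderiv ℝ (cutoffBump n) w :=
    (continuous_const.add continuous_norm).smul (hs.continuous_fderiv (by simp))
  have hF2 : Continuous fun w : Phase n => (1 + ‖w‖) ^ 2 • dp 0 (dp 0 (cutoffBump n)) w :=
    ((continuous_const.add continuous_norm).pow 2).smul
      (contDiff_dp (contDiff_dp hs 0) 0).continuous
  obtain ⟨C₁, hC₁⟩ := ((hc.fderiv ℝ).smul_left (f := fun w : Phase n =>
    1 + ‖w‖)).exists_bound_of_continuous hF1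
  have hc2 : HasCompactSupport (dp 0 (dp 0 (cutoffBump n))) :=
    (hc.fderiv_apply ℝ (0, Pi.single 0 1)).fderiv_apply ℝ (0, Pi.single 0 1)
  obtain ⟨C₂, hC₂⟩ := (hc2.smul_left (f := fun w : Phase n =>
    (1 + ‖w‖) ^ 2)).exists_bound_of_continuous hF2
  have hC₁0 : 0 ≤ C₁ := (norm_nonneg _).trans (hC₁ 0)
  have hC₂0 : 0 ≤ C₂ := (norm_nonneg _).trans (hC₂ 0)
  refine ⟨C₁ + C₂, by positivity, fun k z => ?_⟩
  have hk : (0 : ℝ) < k + 1 := by positivity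
  have hk1 : (1 : ℝ) ≤ k + 1 := by linarith [(Nat.cast_nonneg k : (0 : ℝ) ≤ k)]
  set a := ((k : ℝ) + 1)⁻¹ with ha
  have ha0 : 0 < a := by positivity
  have ha1 : a ≤ 1 := inv_le_one_of_one_le₀ hk1
  have hnorm : ‖a • z‖ = a * ‖z‖ := by rw [norm_smul, Real.norm_of_nonneg ha0.le]
  -- Each derivative of the rescaled bump yields a factor `a`, which turns one weight `1 + ‖z‖` into
  -- the weight at `a • z`, where the compact support of the bump bounds it.
  have hle : a * (1 + ‖z‖) ≤ 1 + ‖a • z‖ := by rw [hnorm]; linarith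
  have hz0 : 0 ≤ ‖z‖ := norm_nonneg z
  constructor
  · intro v
    have h1 := hC₁ (a • z)
    rw [Pi.smul_apply', norm_smul, Real.norm_of_nonneg (by positivity)] at h1
    have h2 := (fderiv ℝ (cutoffBump n) (a • z)).le_opNorm v
    rw [Real.norm_eq_abs] at h2
    rw [fderiv_cutoff, abs_mul, abs_of_pos ha0]
    calc a * |fderiv ℝ (cutoffBump n) (a • z) v| * (1 + ‖z‖)
        = (a * (1 + ‖z‖)) * |fderiv ℝ (cutoffBump n) (a • z) v| := by ring
      _ ≤ (1 + ‖a • z‖) * (‖fderiv ℝ (cutoffBump n) (a • z)‖ * ‖v‖) := by gcongr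
      _ = ((1 + ‖a • z‖) * ‖fderiv ℝ (cutoffBump n) (a • z)‖) * ‖v‖ := by ring
      _ ≤ (C₁ + C₂) * ‖v‖ := by gcongr; linarith
  · have h1 := hC₂ (a • z)
    rw [Pi.smul_apply', norm_smul, Real.norm_of_nonneg (by positivity), Real.norm_eq_abs] at h1
    rw [dp_dp_cutoff, abs_mul, abs_mul, abs_of_pos ha0]
    calc a * (a * |dp 0 (dp 0 (cutoffBump n)) (a • z)|) * (1 + ‖z‖) ^ 2
        = (a * (1 + ‖z‖)) ^ 2 * |dp 0 (dp 0 (cutoffBump n)) (a • z)| := by ring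
      _ ≤ (1 + ‖a • z‖) ^ 2 * |dp 0 (dp 0 (cutoffBump n)) (a • z)| := by gcongr
      _ ≤ C₁ + C₂ := by linarith

/-- The class of functions with quadratic growth, linearly growing gradient and bounded second
derivative in `p_0` is sent to quadratic growth: the drift is affine and flips preserve the norm. -/
lemma abs_generator_le (ω₀ γ T : ℝ) : ∃ C₀, 0 ≤ C₀ ∧ ∀ (C f : ℝ) (G : Phase n → ℝ), 0 ≤ C →
    (∀ z, |G z| ≤ C * (1 + ‖z‖) ^ 2) → (∀ z v, |fderiv ℝ G z v| ≤ C * (1 + ‖z‖) * ‖v‖) →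
    (∀ z, |dp 0 (dp 0 G) z| ≤ C) → ∀ z, |generator ω₀ γ T f G z| ≤
      C * (C₀ * (1 + |f|)) * (1 + ‖z‖) ^ 2 := by
  set e : Phase n := momentumDir (Fin.last n)
  set e₀ : Phase n := momentumDir 0
  set N : ℝ := ((Finset.univ.filter (fun x : Fin (n + 1) => x ≠ 0)).card : ℝ)
  refine ⟨‖drift (n := n) ω₀ 0‖ + ‖e‖ + |γ| * (N * 2) + 2 * |γ| * (|T| + ‖e₀‖), by positivity,
    fun C f G hC h0 h1 h2 z => ?_⟩
  have hz : 0 ≤ ‖z‖ := norm_nonneg z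
  have hz1 : 1 ≤ 1 + ‖z‖ := by linarith
  have hf0 := abs_nonneg f
  have hdrift : |fderiv ℝ G z (drift ω₀ 0 z + f • e)| ≤
      C * ((‖drift (n := n) ω₀ 0‖ + ‖e‖) * (1 + |f|)) * (1 + ‖z‖) ^ 2 := by
    have hn : ‖drift ω₀ 0 z + f • e‖ ≤ (‖drift (n := n) ω₀ 0‖ + ‖e‖) * (1 + |f|) * (1 + ‖z‖) := by
      have a1 := (drift (n := n) ω₀ 0).le_opNorm z
      have a2 : ‖f • e‖ = |f| * ‖e‖ := by rw [norm_smul, Real.norm_eq_abs]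
      have a3 := norm_add_le (drift ω₀ 0 z) (f • e)
      have a4 : 0 ≤ ‖drift (n := n) ω₀ 0‖ := norm_nonneg _
      have a5 : 0 ≤ ‖e‖ := norm_nonneg _
      have a6 : (‖drift (n := n) ω₀ 0‖ + ‖e‖) * (1 + |f|) * (1 + ‖z‖) =
          ‖drift (n := n) ω₀ 0‖ * ‖z‖ + |f| * ‖e‖ + (‖drift (n := n) ω₀ 0‖ +
          ‖drift (n := n) ω₀ 0‖ * |f| * (1 + ‖z‖) + ‖e‖ * (1 + ‖z‖) + ‖e‖ * |f| * ‖z‖) := by ring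
      have a7 : 0 ≤ ‖drift (n := n) ω₀ 0‖ +
          ‖drift (n := n) ω₀ 0‖ * |f| * (1 + ‖z‖) + ‖e‖ * (1 + ‖z‖) + ‖e‖ * |f| * ‖z‖ := by
        positivity
      rw [a6]
      linarith
    calc _ ≤ C * (1 + ‖z‖) * ‖drift ω₀ 0 z + f • e‖ := h1 z _
      _ ≤ C * (1 + ‖z‖) * ((‖drift (n := n) ω₀ 0‖ + ‖e‖) * (1 + |f|) * (1 + ‖z‖)) := by gcongr
      _ = _ := by ring
  have hflip : |flipPart G z| ≤ N * (2 * (C * (1 + ‖z‖) ^ 2)) := by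
    refine (Finset.abs_sum_le_sum_abs _ _).trans ((Finset.sum_le_card_nsmul _ _ _
      fun x _ => ?_).trans_eq (nsmul_eq_mul _ _))
    have b1 := h0 (flipMomentum x z)
    rw [norm_flipMomentum] at b1
    have b2 := h0 z
    have b3 := abs_sub (G (flipMomentum x z)) (G z)
    linarith
  have htherm : |thermostatPart T G z| ≤ (|T| + ‖e₀‖) * (C * (1 + ‖z‖) ^ 2) := by
    have c1 : |z.2 0| ≤ 1 + ‖z‖ := by
      have := (norm_le_pi_norm z.2 0).trans (norm_snd_le z)
      rw [Real.norm_eq_abs] at this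
      linarith
    have c2 : |dp 0 G z| ≤ C * (1 + ‖z‖) * ‖e₀‖ := h1 z _
    have c3 := h2 z
    calc |thermostatPart T G z| ≤ |T * dp 0 (dp 0 G) z| + |z.2 0 * dp 0 G z| := abs_sub _ _
      _ = |T| * |dp 0 (dp 0 G) z| + |z.2 0| * |dp 0 G z| := by rw [abs_mul, abs_mul]
      _ ≤ |T| * (C * (1 + ‖z‖) ^ 2) + (1 + ‖z‖) * (C * (1 + ‖z‖) * ‖e₀‖) := by
          gcongr
          exact c3.trans (le_mul_of_one_le_right hC (one_le_pow₀ hz1))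
      _ = _ := by ring
  rw [generator_eq]
  have hX : 0 ≤ C * (1 + ‖z‖) ^ 2 := by positivity
  have hN : 0 ≤ N := Nat.cast_nonneg _
  calc _ ≤ |fderiv ℝ G z (drift ω₀ 0 z + f • e)| + |γ| * |flipPart G z|
        + 2 * |γ| * |thermostatPart T G z| := by
        refine (abs_add_le _ _).trans ?_
        rw [abs_mul (2 * γ), abs_mul 2, abs_two]
        refine add_le_add_left ((abs_add_le _ _).trans ?_) _
        rw [abs_mul]
    _ ≤ C * ((‖drift (n := n) ω₀ 0‖ + ‖e‖) * (1 + |f|)) * (1 + ‖z‖) ^ 2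
        + |γ| * (N * (2 * (C * (1 + ‖z‖) ^ 2)))
        + 2 * |γ| * ((|T| + ‖e₀‖) * (C * (1 + ‖z‖) ^ 2)) := by gcongr
    _ ≤ C * ((‖drift (n := n) ω₀ 0‖ + ‖e‖) * (1 + |f|)) * (1 + ‖z‖) ^ 2
        + |γ| * (N * (2 * (C * (1 + ‖z‖) ^ 2))) * (1 + |f|)
        + 2 * |γ| * ((|T| + ‖e₀‖) * (C * (1 + ‖z‖) ^ 2)) * (1 + |f|) := by
        have d1 : 0 ≤ |γ| * (N * (2 * (C * (1 + ‖z‖) ^ 2))) := by positivity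
        have d2 : 0 ≤ 2 * |γ| * ((|T| + ‖e₀‖) * (C * (1 + ‖z‖) ^ 2)) := by positivity
        exact add_le_add (add_le_add le_rfl (le_mul_of_one_le_right d1 (by linarith)))
          (le_mul_of_one_le_right d2 (by linarith))
    _ = _ := by ring

/-- Uniform bounds for the generator on truncated quadratic polynomials. -/
lemma exists_generator_cutoff_bound (ω₀ γ T : ℝ) (B : Phase n →L[ℝ] Phase n →L[ℝ] ℝ)
    (ℓ : Phase n →L[ℝ] ℝ) : ∃ C, 0 ≤ C ∧ ∀ (k : ℕ) (f : ℝ) (z : Phase n),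
      |generator ω₀ γ T f (fun w => quadPoly B ℓ w * cutoff k w) z| ≤
        C * (1 + |f|) * (1 + ‖z‖) ^ 2 := by
  obtain ⟨C₀, hC₀, hgen⟩ := abs_generator_le (n := n) ω₀ γ T
  obtain ⟨C₁, hC₁, hcut⟩ := exists_cutoff_bounds n
  set D := 2 * (‖B‖ + ‖ℓ‖) + 2 * ‖B‖ * ‖momentumDir (n := n) 0‖ ^ 2 with hD
  have hD0 : 0 ≤ D := by positivity
  have hG : ∀ z, |quadPoly B ℓ z| ≤ D * (1 + ‖z‖) ^ 2 := fun z => by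
    have h1 : |B z z| ≤ ‖B‖ * ‖z‖ * ‖z‖ := B.le_opNorm₂ z z
    have h2 : |ℓ z| ≤ ‖ℓ‖ * ‖z‖ := ℓ.le_opNorm z
    have h3 : |quadPoly B ℓ z| ≤ |B z z| + |ℓ z| := abs_add_le _ _
    have : 0 ≤ ‖z‖ := norm_nonneg z
    have e : D * (1 + ‖z‖) ^ 2 = ‖B‖ * ‖z‖ * ‖z‖ + ‖ℓ‖ * ‖z‖ + (2 * ‖B‖ + 4 * ‖B‖ * ‖z‖ +
      ‖B‖ * ‖z‖ ^ 2 + 2 * ‖ℓ‖ + 3 * ‖ℓ‖ * ‖z‖ + 2 * ‖ℓ‖ * ‖z‖ ^ 2 +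
      2 * ‖B‖ * ‖momentumDir (n := n) 0‖ ^ 2 * (1 + ‖z‖) ^ 2) := by rw [hD]; ring
    have : 0 ≤ 2 * ‖B‖ + 4 * ‖B‖ * ‖z‖ +
      ‖B‖ * ‖z‖ ^ 2 + 2 * ‖ℓ‖ + 3 * ‖ℓ‖ * ‖z‖ + 2 * ‖ℓ‖ * ‖z‖ ^ 2 +
      2 * ‖B‖ * ‖momentumDir (n := n) 0‖ ^ 2 * (1 + ‖z‖) ^ 2 := by positivity
    linarith
  have hG1 : ∀ z v, |fderiv ℝ (quadPoly B ℓ) z v| ≤ D * (1 + ‖z‖) * ‖v‖ := fun z v => by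
    have h1 : |B z v| ≤ ‖B‖ * ‖z‖ * ‖v‖ := B.le_opNorm₂ z v
    have h1' : |B v z| ≤ ‖B‖ * ‖v‖ * ‖z‖ := B.le_opNorm₂ v z
    have h2 : |ℓ v| ≤ ‖ℓ‖ * ‖v‖ := ℓ.le_opNorm v
    have h3 := (abs_add_le (B z v + B v z) (ℓ v)).trans
      (add_le_add_left (abs_add_le (B z v) (B v z)) _)
    rw [fderiv_quadPoly]
    have e : D * (1 + ‖z‖) * ‖v‖ = ‖B‖ * ‖z‖ * ‖v‖ + ‖B‖ * ‖v‖ * ‖z‖ + ‖ℓ‖ * ‖v‖ +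
      (2 * ‖B‖ * ‖v‖ + ‖ℓ‖ * ‖v‖ + 2 * ‖ℓ‖ * ‖z‖ * ‖v‖ +
      2 * ‖B‖ * ‖momentumDir (n := n) 0‖ ^ 2 * (1 + ‖z‖) * ‖v‖) := by rw [hD]; ring
    have : 0 ≤ 2 * ‖B‖ * ‖v‖ + ‖ℓ‖ * ‖v‖ + 2 * ‖ℓ‖ * ‖z‖ * ‖v‖ +
      2 * ‖B‖ * ‖momentumDir (n := n) 0‖ ^ 2 * (1 + ‖z‖) * ‖v‖ := by positivity
    linarith
  have hG2 : ∀ z, |dp 0 (dp 0 (quadPoly B ℓ)) z| ≤ D := fun z => by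
    have h1 : |B (momentumDir 0) (momentumDir 0)| ≤
      ‖B‖ * ‖momentumDir (n := n) 0‖ * ‖momentumDir (n := n) 0‖ := B.le_opNorm₂ _ _
    rw [dp_dp_quadPoly, abs_mul, abs_two, hD]
    have : 0 ≤ 2 * (‖B‖ + ‖ℓ‖) := by positivity
    nlinarith
  set e₀ : Phase n := momentumDir 0 with he₀
  -- One constant dominating the product-rule bounds of orders zero, one and two; `2‖e₀‖²` comes
  -- from the cross term in the second derivative.
  set C := D * (1 + C₁) * (1 + 2 * ‖e₀‖ ^ 2) with hC
  have hCge : D * (C₁ + 1) ≤ C := by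
    rw [hC, add_comm C₁]
    exact le_mul_of_one_le_right (by positivity) (by linarith [sq_nonneg ‖e₀‖])
  have hGs := contDiff_quadPoly B ℓ
  have hχs := contDiff_cutoff (n := n)
  have hfd : ∀ k z v, fderiv ℝ (fun w => quadPoly B ℓ w * cutoff k w) z v =
      quadPoly B ℓ z * fderiv ℝ (cutoff k) z v + cutoff k z * fderiv ℝ (quadPoly B ℓ) z v :=
    fun k z v => by
    have h : HasFDerivAt (fun w => quadPoly B ℓ w * cutoff k w) _ z :=
      ((hGs.differentiable (by simp)) z).hasFDerivAt.mul
      ((hχs k).differentiable (by simp) z).hasFDerivAt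
    rw [h.fderiv]
    rfl
  have hdd : ∀ k z, dp 0 (dp 0 (fun w => quadPoly B ℓ w * cutoff k w)) z =
      quadPoly B ℓ z * dp 0 (dp 0 (cutoff k)) z + 2 * (dp 0 (cutoff k) z * dp 0 (quadPoly B ℓ) z)
        + cutoff k z * dp 0 (dp 0 (quadPoly B ℓ)) z := fun k z => by
    have h0 : dp 0 (fun w => quadPoly B ℓ w * cutoff k w) = fun w =>
        quadPoly B ℓ w * dp 0 (cutoff k) w + cutoff k w * dp 0 (quadPoly B ℓ) w :=
      funext fun w => hfd k w _
    have h : HasFDerivAt (fun w =>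
        quadPoly B ℓ w * dp 0 (cutoff k) w + cutoff k w * dp 0 (quadPoly B ℓ) w) _ z :=
      (((hGs.differentiable (by simp)) z).hasFDerivAt.mul
        ((contDiff_dp (hχs k) 0).differentiable (by simp) z).hasFDerivAt).add
      (((hχs k).differentiable (by simp) z).hasFDerivAt.mul
        ((contDiff_dp hGs 0).differentiable (by simp) z).hasFDerivAt)
    rw [h0, dp, h.fderiv]
    simp only [_root_.add_apply, _root_.smul_apply, smul_eq_mul, dp]
    ring
  refine ⟨C * C₀, by positivity, fun k f z => ?_⟩
  have := hgen C f (fun w => quadPoly B ℓ w * cutoff k w) (by positivity) ?_ ?_ ?_ z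
  · linarith
  · intro z
    rw [abs_mul]
    calc _ ≤ |quadPoly B ℓ z| * 1 := by gcongr; exact abs_cutoff_le_one k z
      _ ≤ D * (1 + ‖z‖) ^ 2 := by rw [mul_one]; exact hG z
      _ ≤ _ := by
        gcongr
        exact le_trans (le_mul_of_one_le_right hD0 (by linarith)) hCge
  · intro z v
    rw [hfd]
    have h1 := (hcut k z).1 v
    have hz : 0 ≤ ‖z‖ := norm_nonneg z
    calc _ ≤ |quadPoly B ℓ z| * |fderiv ℝ (cutoff k) z v|
          + |cutoff k z| * |fderiv ℝ (quadPoly B ℓ) z v| := by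
          rw [← abs_mul, ← abs_mul]; exact abs_add_le _ _
      _ ≤ D * (1 + ‖z‖) ^ 2 * |fderiv ℝ (cutoff k) z v| + 1 * (D * (1 + ‖z‖) * ‖v‖) := by
          gcongr
          · exact hG z
          · exact abs_cutoff_le_one k z
          · exact hG1 z v
      _ = D * (1 + ‖z‖) * (|fderiv ℝ (cutoff k) z v| * (1 + ‖z‖)) + D * (1 + ‖z‖) * ‖v‖ := by ring
      _ ≤ D * (1 + ‖z‖) * (C₁ * ‖v‖) + D * (1 + ‖z‖) * ‖v‖ := by gcongr
      _ = D * (C₁ + 1) * (1 + ‖z‖) * ‖v‖ := by ring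
      _ ≤ _ := by gcongr
  · intro z
    rw [hdd]
    have h1 : |dp 0 (cutoff k) z| * (1 + ‖z‖) ≤ C₁ * ‖e₀‖ := (hcut k z).1 _
    have h2 := (hcut k z).2
    have h3 : |dp 0 (quadPoly B ℓ) z| ≤ D * (1 + ‖z‖) * ‖e₀‖ := hG1 z _
    have hz : 0 ≤ ‖z‖ := norm_nonneg z
    calc _ ≤ |quadPoly B ℓ z| * |dp 0 (dp 0 (cutoff k)) z|
          + 2 * (|dp 0 (cutoff k) z| * |dp 0 (quadPoly B ℓ) z|)
          + |cutoff k z| * |dp 0 (dp 0 (quadPoly B ℓ)) z| := by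
          refine (abs_add_le _ _).trans ?_
          rw [← abs_mul, ← abs_mul, ← abs_mul, ← abs_two (α := ℝ), ← abs_mul, abs_two]
          exact add_le_add_left (abs_add_le _ _) _
      _ ≤ D * (1 + ‖z‖) ^ 2 * |dp 0 (dp 0 (cutoff k)) z|
          + 2 * (|dp 0 (cutoff k) z| * (D * (1 + ‖z‖) * ‖e₀‖)) + 1 * D := by
          gcongr
          · exact hG z
          · exact abs_cutoff_le_one k z
          · exact hG2 z
      _ = D * (|dp 0 (dp 0 (cutoff k)) z| * (1 + ‖z‖) ^ 2)
          + 2 * D * ‖e₀‖ * (|dp 0 (cutoff k) z| * (1 + ‖z‖)) + D := by ring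
      _ ≤ D * C₁ + 2 * D * ‖e₀‖ * (C₁ * ‖e₀‖) + D := by gcongr
      _ ≤ C := by
          rw [hC]
          have : 0 ≤ 2 * D * ‖e₀‖ ^ 2 := by positivity
          nlinarith

lemma generator_cutoff_eventuallyEq (ω₀ γ T f : ℝ) (G : Phase n → ℝ) (z : Phase n) :
    ∀ᶠ k : ℕ in Filter.atTop,
      generator ω₀ γ T f (fun w => G w * cutoff k w) z = generator ω₀ γ T f G z := by
  filter_upwards [eventually_le_natCast_add_one (‖z‖ + 1)] with k hk
  have hO : IsOpen {w : Phase n | ‖w‖ < (k : ℝ) + 1} := isOpen_lt continuous_norm continuous_const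
  refine generator_congr hO (fun x w hw => ?_) (fun w hw => ?_) ω₀ γ T f
    (show z ∈ {w : Phase n | ‖w‖ < (k : ℝ) + 1} from ?_)
  · simpa [norm_flipMomentum] using hw
  · simp only [cutoff_of_norm_lt hw, mul_one]
  · change ‖z‖ < (k : ℝ) + 1
    linarith

/-! ### The forward equation for quadratic polynomials -/

section Moments

variable {ω₀ γ T Θ S M : ℝ} {f : ℝ → ℝ} {μ : ℝ → Measure (Phase n)}

lemma integrable_one_add_norm_sq {ν : Measure (Phase n)} [IsProbabilityMeasure ν]
    (h : Integrable (fun z : Phase n => ‖z‖ ^ 2) ν) :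
    Integrable (fun z : Phase n => (1 + ‖z‖) ^ 2) ν := by
  refine (((integrable_const (2 : ℝ)).add (h.const_mul 2))).mono' (by fun_prop)
    (Filter.Eventually.of_forall fun z => ?_)
  rw [Real.norm_of_nonneg (sq_nonneg _)]
  change (1 + ‖z‖) ^ 2 ≤ 2 + 2 * ‖z‖ ^ 2
  nlinarith [sq_nonneg (1 - ‖z‖)]

lemma integral_one_add_norm_sq_le {ν : Measure (Phase n)} [IsProbabilityMeasure ν]
    (h : Integrable (fun z : Phase n => ‖z‖ ^ 2) ν) :
    ∫ z, (1 + ‖z‖) ^ 2 ∂ν ≤ 2 + 2 * ∫ z, ‖z‖ ^ 2 ∂ν := by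
  calc ∫ z, (1 + ‖z‖) ^ 2 ∂ν ≤ ∫ z, (2 + 2 * ‖z‖ ^ 2) ∂ν :=
        integral_mono (integrable_one_add_norm_sq h)
          ((integrable_const (2 : ℝ)).add (h.const_mul 2)) fun z => by
          change (1 + ‖z‖) ^ 2 ≤ 2 + 2 * ‖z‖ ^ 2
          nlinarith [sq_nonneg (1 - ‖z‖)]
    _ = _ := by
        rw [integral_add (integrable_const _) (h.const_mul 2), integral_const_mul]
        simp

lemma exists_quadPoly_bound (B : Phase n →L[ℝ] Phase n →L[ℝ] ℝ) (ℓ : Phase n →L[ℝ] ℝ) :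
    ∃ D, 0 ≤ D ∧ ∀ z, |quadPoly B ℓ z| ≤ D * (1 + ‖z‖) ^ 2 := by
  refine ⟨‖B‖ + ‖ℓ‖, by positivity, fun z => ?_⟩
  have h1 : |B z z| ≤ ‖B‖ * ‖z‖ * ‖z‖ := B.le_opNorm₂ z z
  have h2 : |ℓ z| ≤ ‖ℓ‖ * ‖z‖ := ℓ.le_opNorm z
  have h3 : |quadPoly B ℓ z| ≤ |B z z| + |ℓ z| := abs_add_le _ _
  have : 0 ≤ ‖z‖ := norm_nonneg z
  have : 0 ≤ ‖B‖ + 2 * ‖B‖ * ‖z‖ + ‖ℓ‖ + ‖ℓ‖ * ‖z‖ + ‖ℓ‖ * ‖z‖ ^ 2 := by positivity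
  nlinarith

lemma integrable_quadPoly {ν : Measure (Phase n)} [IsProbabilityMeasure ν]
    (h : Integrable (fun z : Phase n => ‖z‖ ^ 2) ν)
    (B : Phase n →L[ℝ] Phase n →L[ℝ] ℝ) (ℓ : Phase n →L[ℝ] ℝ) :
    Integrable (quadPoly B ℓ) ν := by
  obtain ⟨D, _, hD⟩ := exists_quadPoly_bound B ℓ
  exact ((integrable_one_add_norm_sq h).const_mul D).mono'
    (contDiff_quadPoly B ℓ).continuous.aestronglyMeasurable (Filter.Eventually.of_forall hD)

lemma tendsto_integral_cutoff {ν : Measure (Phase n)} {G : Phase n → ℝ} {F : ℕ → Phase n → ℝ}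
    {D : ℝ} [IsProbabilityMeasure ν] (h : Integrable (fun z : Phase n => ‖z‖ ^ 2) ν)
    (hF : ∀ k, Continuous (F k)) (hb : ∀ k z, |F k z| ≤ D * (1 + ‖z‖) ^ 2)
    (hlim : ∀ z, ∀ᶠ k in Filter.atTop, F k z = G z) :
    Filter.Tendsto (fun k => ∫ z, F k z ∂ν) Filter.atTop (nhds (∫ z, G z ∂ν)) :=
  tendsto_integral_of_dominated_convergence (fun z => D * (1 + ‖z‖) ^ 2)
    (fun k => (hF k).aestronglyMeasurable) ((integrable_one_add_norm_sq h).const_mul D)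
    (fun k => Filter.Eventually.of_forall fun z => hb k z)
    (Filter.Eventually.of_forall fun z =>
      tendsto_const_nhds.congr' ((hlim z).mono fun _ hk => hk.symm))

/-- The forward equation extends from test functions to quadratic polynomials. -/
theorem IsPeriodicState.integral_generator_quadPoly (hμ : IsPeriodicState ω₀ γ T Θ f μ)
    (hf : Continuous f) (hS : ∀ t, |f t| ≤ S)
    (hM : ∀ t, 0 ≤ t → Integrable (fun z => ‖z‖ ^ 2) (μ t) ∧ ∫ z, ‖z‖ ^ 2 ∂(μ t) ≤ M * (1 + t))
    (hM0 : 0 ≤ M) (B : Phase n →L[ℝ] Phase n →L[ℝ] ℝ) (ℓ : Phase n →L[ℝ] ℝ) {t : ℝ}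
    (ht : 0 ≤ t) :
    IntegrableOn (fun s => ∫ z, generator ω₀ γ T (f s) (quadPoly B ℓ) z ∂(μ s)) (Set.Icc 0 t) ∧
      ∫ s in (0 : ℝ)..t, ∫ z, generator ω₀ γ T (f s) (quadPoly B ℓ) z ∂(μ s) =
        ∫ z, quadPoly B ℓ z ∂(μ t) - ∫ z, quadPoly B ℓ z ∂(μ 0) := by
  obtain ⟨C, hC, hbd⟩ := exists_generator_cutoff_bound ω₀ γ T B ℓ
  obtain ⟨D, hD0, hD⟩ := exists_quadPoly_bound B ℓ
  have hS0 : 0 ≤ S := (abs_nonneg _).trans (hS 0)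
  let g : ℕ → Phase n → ℝ := fun k z => quadPoly B ℓ z * cutoff k z
  have hgs : ∀ k, ContDiff ℝ ∞ (g k) := fun k => (contDiff_quadPoly B ℓ).mul (contDiff_cutoff k)
  have hgc : ∀ k, HasCompactSupport (g k) := fun k => (hasCompactSupport_cutoff k).mul_left
  have hgb : ∀ k z, |g k z| ≤ D * (1 + ‖z‖) ^ 2 := fun k z => by
    simp only [g, abs_mul]
    exact (mul_le_of_le_one_right (abs_nonneg _) (abs_cutoff_le_one k z)).trans (hD z)
  have hglim : ∀ z, ∀ᶠ k in Filter.atTop, g k z = quadPoly B ℓ z := fun z => by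
    filter_upwards [eventually_le_natCast_add_one (‖z‖ + 1)] with k hk
    simp only [g, cutoff_of_norm_lt (show ‖z‖ < (k : ℝ) + 1 by linarith), mul_one]
  have hbd' : ∀ k s z, |generator ω₀ γ T (f s) (g k) z| ≤ C * (1 + S) * (1 + ‖z‖) ^ 2 :=
    fun k s z => (hbd k (f s) z).trans (by gcongr; exact hS s)
  have hlim : ∀ s, 0 ≤ s → Filter.Tendsto (fun k => ∫ z, generator ω₀ γ T (f s) (g k) z ∂(μ s))
      Filter.atTop (nhds (∫ z, generator ω₀ γ T (f s) (quadPoly B ℓ) z ∂(μ s))) := fun s hs => by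
    have := hμ.isProbabilityMeasure s hs
    exact tendsto_integral_cutoff (hM s hs).1
      (fun k => (contDiff_generator (hgs k) _ _ _ _).continuous) (fun k z => hbd' k s z)
      fun z => generator_cutoff_eventuallyEq _ _ _ _ _ z
  -- Dominates the generator integrals for all cutoffs and all times in `[0, t]`, so dominated
  -- convergence applies in space and then in time.
  set A := C * (1 + S) * (2 + 2 * (M * (1 + t))) with hA
  have hbound : ∀ k s, 0 ≤ s → s ≤ t → ‖∫ z, generator ω₀ γ T (f s) (g k) z ∂(μ s)‖ ≤ A :=
    fun k s hs hst => by
    have := hμ.isProbabilityMeasure s hs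
    have h1 := integral_one_add_norm_sq_le (hM s hs).1
    have h2 := (hM s hs).2
    calc ‖∫ z, generator ω₀ γ T (f s) (g k) z ∂(μ s)‖
        ≤ ∫ z, C * (1 + S) * (1 + ‖z‖) ^ 2 ∂(μ s) :=
          norm_integral_le_of_norm_le ((integrable_one_add_norm_sq (hM s hs).1).const_mul _)
            (Filter.Eventually.of_forall fun z => hbd' k s z)
      _ = C * (1 + S) * ∫ z, (1 + ‖z‖) ^ 2 ∂(μ s) := integral_const_mul _ _
      _ ≤ A := by
          have h3 : M * (1 + s) ≤ M * (1 + t) := by gcongr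
          rw [hA]
          gcongr
          linarith
  have hmeas : ∀ k, AEStronglyMeasurable
      (fun s => ∫ z, generator ω₀ γ T (f s) (g k) z ∂(μ s)) (volume.restrict (Set.Icc 0 t)) :=
    fun k => ((hμ.continuousOn_generator hf (hgs k) (hgc k)).mono
      fun s hs => hs.1).aestronglyMeasurable measurableSet_Icc
  constructor
  · have hmeas' := aestronglyMeasurable_of_tendsto_ae Filter.atTop hmeas
      ((ae_restrict_mem measurableSet_Icc).mono fun s hs => hlim s hs.1)
    refine Integrable.of_bound hmeas' A ?_
    filter_upwards [ae_restrict_mem measurableSet_Icc] with s hs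
    exact le_of_tendsto (hlim s hs.1).norm (Filter.Eventually.of_forall fun k =>
      hbound k s hs.1 hs.2)
  · have hioc : Set.uIoc 0 t ⊆ Set.Icc 0 t := by
      rw [Set.uIoc_of_le ht]; exact Set.Ioc_subset_Icc_self
    have h1 := intervalIntegral.tendsto_integral_filter_of_dominated_convergence
      (a := 0) (b := t) (μ := volume) (l := Filter.atTop)
      (F := fun k s => ∫ z, generator ω₀ γ T (f s) (g k) z ∂(μ s))
      (f := fun s => ∫ z, generator ω₀ γ T (f s) (quadPoly B ℓ) z ∂(μ s)) (fun _ => A)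
      (Filter.Eventually.of_forall fun k => (hmeas k).mono_set hioc)
      (Filter.Eventually.of_forall fun k => Filter.Eventually.of_forall fun s hs =>
        hbound k s (hioc hs).1 (hioc hs).2)
      intervalIntegrable_const
      (Filter.Eventually.of_forall fun s hs => hlim s (hioc hs).1)
    have h2 : ∀ s, 0 ≤ s → Filter.Tendsto (fun k => ∫ z, g k z ∂(μ s)) Filter.atTop
        (nhds (∫ z, quadPoly B ℓ z ∂(μ s))) := fun s hs => by
      have := hμ.isProbabilityMeasure s hs
      exact tendsto_integral_cutoff (hM s hs).1 (fun k => (hgs k).continuous) hgb hglim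
    have h3 := (h2 t ht).sub (h2 0 le_rfl)
    refine tendsto_nhds_unique h1 (h3.congr fun k => ?_)
    exact (hμ.integral_generator hf (hgs k) (hgc k) le_rfl ht).symm

/-- The integrated equation exhibits the moment as a primitive of an integrable function. Continuity
of moments then makes the right sides of the moment equations continuous, which upgrades them to
differential equations. -/
lemma IsPeriodicState.continuousOn_quadPoly (hμ : IsPeriodicState ω₀ γ T Θ f μ)
    (hf : Continuous f) (hS : ∀ t, |f t| ≤ S)
    (hM : ∀ t, 0 ≤ t → Integrable (fun z => ‖z‖ ^ 2) (μ t) ∧ ∫ z, ‖z‖ ^ 2 ∂(μ t) ≤ M * (1 + t))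
    (hM0 : 0 ≤ M) (B : Phase n →L[ℝ] Phase n →L[ℝ] ℝ) (ℓ : Phase n →L[ℝ] ℝ) :
    ContinuousOn (fun t => ∫ z, quadPoly B ℓ z ∂(μ t)) (Set.Ici 0) := by
  intro t ht
  have ht : (0 : ℝ) ≤ t := ht
  have ht1 : 0 ≤ t + 1 := by linarith
  have h1 := (hμ.integral_generator_quadPoly hf hS hM hM0 B ℓ ht1).1
  rw [← Set.uIcc_of_le ht1] at h1
  have h2 := intervalIntegral.continuousOn_primitive_interval h1
  rw [Set.uIcc_of_le ht1] at h2
  have h3 : ContinuousOn (fun t => ∫ z, quadPoly B ℓ z ∂(μ t)) (Set.Icc 0 (t + 1)) :=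
    (h2.add (continuousOn_const (c := ∫ z, quadPoly B ℓ z ∂(μ 0)))).congr fun s hs => by
      have := (hμ.integral_generator_quadPoly hf hS hM hM0 B ℓ hs.1).2
      simp only [Pi.add_apply]
      rw [this]
      ring
  refine (h3 t ⟨ht, by linarith⟩).mono_of_mem_nhdsWithin ?_
  have : Set.Icc 0 (t + 1) = Set.Ici 0 ∩ Set.Iic (t + 1) := rfl
  rw [this]
  exact Filter.inter_mem self_mem_nhdsWithin
    (mem_nhdsWithin_of_mem_nhds (Iic_mem_nhds (by linarith)))

lemma hasDerivWithinAt_of_integral_eq {u D : ℝ → ℝ} (hD : ContinuousOn D (Set.Ici 0))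
    (h : ∀ t, 0 ≤ t → ∫ s in (0 : ℝ)..t, D s = u t - u 0) {t : ℝ} (ht : 0 ≤ t) :
    HasDerivWithinAt u (D t) (Set.Ici 0) t := by
  -- Freezing `D` at its value at `0` for negative times gives a continuous function on the whole
  -- line, to which the fundamental theorem applies.
  have hc : Continuous fun s => D (max s 0) :=
    hD.comp_continuous (by fun_prop) fun s => le_max_right s 0
  have h1 := (intervalIntegral.integral_hasDerivAt_right (hc.intervalIntegrable 0 t)
    (hc.stronglyMeasurableAtFilter _ _) hc.continuousAt).hasDerivWithinAt (s := Set.Ici 0)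
  rw [max_eq_left ht] at h1
  have he : ∀ s, 0 ≤ s → u s = (∫ r in (0 : ℝ)..s, D (max r 0)) + u 0 := fun s hs => by
    have : ∫ r in (0 : ℝ)..s, D (max r 0) = ∫ r in (0 : ℝ)..s, D r :=
      intervalIntegral.integral_congr fun r hr => by
        rw [Set.uIcc_of_le hs] at hr
        simp only [max_eq_left hr.1]
    rw [this, h s hs]
    ring
  exact (h1.add_const (u 0)).congr he (he t ht)

lemma IsPeriodicState.hasDerivWithinAt_quadPoly (hμ : IsPeriodicState ω₀ γ T Θ f μ)
    (hf : Continuous f) (hS : ∀ t, |f t| ≤ S)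
    (hM : ∀ t, 0 ≤ t → Integrable (fun z => ‖z‖ ^ 2) (μ t) ∧ ∫ z, ‖z‖ ^ 2 ∂(μ t) ≤ M * (1 + t))
    (hM0 : 0 ≤ M) (B : Phase n →L[ℝ] Phase n →L[ℝ] ℝ) (ℓ : Phase n →L[ℝ] ℝ) {D : ℝ → ℝ}
    (hD : ContinuousOn D (Set.Ici 0))
    (hgen : ∀ t, 0 ≤ t → ∫ z, generator ω₀ γ T (f t) (quadPoly B ℓ) z ∂(μ t) = D t)
    {t : ℝ} (ht : 0 ≤ t) :
    HasDerivWithinAt (fun t => ∫ z, quadPoly B ℓ z ∂(μ t)) (D t) (Set.Ici 0) t := by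
  refine hasDerivWithinAt_of_integral_eq hD (fun t ht => ?_) ht
  rw [← (hμ.integral_generator_quadPoly hf hS hM hM0 B ℓ ht).2]
  refine intervalIntegral.integral_congr fun s hs => ?_
  rw [Set.uIcc_of_le ht] at hs
  exact (hgen s hs.1).symm

end Moments

/-! ### Differential equations for first and second moments -/

/-- The coordinate `q_x`. -/
def posL (x : Fin (n + 1)) : Phase n →L[ℝ] ℝ :=
  (ContinuousLinearMap.proj x).comp (ContinuousLinearMap.fst ℝ _ _)

/-- The coordinate `p_x`. -/
def momL (x : Fin (n + 1)) : Phase n →L[ℝ] ℝ :=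
  (ContinuousLinearMap.proj x).comp (ContinuousLinearMap.snd ℝ _ _)

lemma posL_apply (x : Fin (n + 1)) (z : Phase n) : posL x z = z.1 x := rfl

lemma momL_apply (x : Fin (n + 1)) (z : Phase n) : momL x z = z.2 x := rfl

lemma quadPoly_linear (ℓ : Phase n →L[ℝ] ℝ) : quadPoly 0 ℓ = fun z => ℓ z := by
  funext z; simp [quadPoly]

lemma quadPoly_mul (ℓ₁ ℓ₂ : Phase n →L[ℝ] ℝ) :
    quadPoly (ℓ₁.smulRight ℓ₂) 0 = fun z => ℓ₁ z * ℓ₂ z := by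
  funext z; simp [quadPoly]

lemma generator_linear (ω₀ γ T f : ℝ) (ℓ : Phase n →L[ℝ] ℝ) (z : Phase n) :
    generator ω₀ γ T f (quadPoly 0 ℓ) z =
      ℓ (drift ω₀ (2 * γ) z) + f * ℓ (momentumDir (Fin.last n)) := by
  rw [generator_quadPoly]
  simp

lemma generator_mul (ω₀ γ T f : ℝ) (ℓ₁ ℓ₂ : Phase n →L[ℝ] ℝ) (z : Phase n) :
    generator ω₀ γ T f (quadPoly (ℓ₁.smulRight ℓ₂) 0) z =
      ℓ₁ z * (ℓ₂ (drift ω₀ (2 * γ) z) + f * ℓ₂ (momentumDir (Fin.last n)))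
        + (ℓ₁ (drift ω₀ (2 * γ) z) + f * ℓ₁ (momentumDir (Fin.last n))) * ℓ₂ z
        + 4 * γ * ∑ x, (if x = 0 then T else z.2 x ^ 2) *
          (ℓ₁ (momentumDir x) * ℓ₂ (momentumDir x)) := by
  rw [generator_quadPoly]
  simp

lemma posL_momentumDir (x y : Fin (n + 1)) : posL x (momentumDir y) = 0 := rfl

lemma momL_momentumDir (x y : Fin (n + 1)) :
    momL x (momentumDir y) = if x = y then 1 else 0 := by
  simp [momL, momentumDir, Pi.single_apply]

lemma posL_drift (ω₀ c : ℝ) (x : Fin (n + 1)) (z : Phase n) : posL x (drift ω₀ c z) = z.2 x := rfl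

lemma momL_drift (ω₀ c : ℝ) (x : Fin (n + 1)) (z : Phase n) :
    momL x (drift ω₀ c z) = -(∑ k, stiffness ω₀ x k * z.1 k) - c * z.2 x := rfl

/-- The mean position at site `x`. -/
def meanPos (μ : ℝ → Measure (Phase n)) (t : ℝ) (x : Fin (n + 1)) : ℝ := ∫ z, z.1 x ∂(μ t)

/-- The mean momentum at site `x`. -/
def meanMom (μ : ℝ → Measure (Phase n)) (t : ℝ) (x : Fin (n + 1)) : ℝ := ∫ z, z.2 x ∂(μ t)

/-- The second moments of the positions. -/
def momQQ (μ : ℝ → Measure (Phase n)) (t : ℝ) (x y : Fin (n + 1)) : ℝ :=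
  ∫ z, z.1 x * z.1 y ∂(μ t)

/-- The mixed second moments. -/
def momQP (μ : ℝ → Measure (Phase n)) (t : ℝ) (x y : Fin (n + 1)) : ℝ :=
  ∫ z, z.1 x * z.2 y ∂(μ t)

/-- The second moments of the momenta. -/
def momPP (μ : ℝ → Measure (Phase n)) (t : ℝ) (x y : Fin (n + 1)) : ℝ :=
  ∫ z, z.2 x * z.2 y ∂(μ t)

/-- The indicator of the last site. -/
def lastInd (x : Fin (n + 1)) : ℝ := if x = Fin.last n then 1 else 0

/-- A periodic state with locally bounded second moments, driven by a bounded continuous force. -/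
structure IsBoundedState (ω₀ γ T Θ S M : ℝ) (f : ℝ → ℝ) (μ : ℝ → Measure (Phase n)) : Prop where
  state : IsPeriodicState ω₀ γ T Θ f μ
  continuous_force : Continuous f
  force_le : ∀ t, |f t| ≤ S
  moment : ∀ t, 0 ≤ t → Integrable (fun z => ‖z‖ ^ 2) (μ t) ∧ ∫ z, ‖z‖ ^ 2 ∂(μ t) ≤ M * (1 + t)
  nonneg : 0 ≤ M

/-- `g` is integrable with mean `a`. -/
def HasMean (ν : Measure (Phase n)) (g : Phase n → ℝ) (a : ℝ) : Prop :=
  Integrable g ν ∧ ∫ z, g z ∂ν = a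

namespace HasMean

variable {ν : Measure (Phase n)} {g h : Phase n → ℝ} {a b : ℝ}

lemma add (hg : HasMean ν g a) (hh : HasMean ν h b) :
    HasMean ν (fun z => g z + h z) (a + b) :=
  ⟨hg.1.add hh.1, by rw [integral_add hg.1 hh.1, hg.2, hh.2]⟩

lemma sub (hg : HasMean ν g a) (hh : HasMean ν h b) :
    HasMean ν (fun z => g z - h z) (a - b) :=
  ⟨hg.1.sub hh.1, by rw [integral_sub hg.1 hh.1, hg.2, hh.2]⟩

lemma neg (hg : HasMean ν g a) : HasMean ν (fun z => -g z) (-a) :=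
  ⟨hg.1.neg, by rw [integral_neg, hg.2]⟩

lemma const_mul (hg : HasMean ν g a) (c : ℝ) : HasMean ν (fun z => c * g z) (c * a) :=
  ⟨hg.1.const_mul c, by rw [integral_const_mul, hg.2]⟩

lemma sum {ι : Type*} [Fintype ι] {g : ι → Phase n → ℝ} {a : ι → ℝ}
    (hg : ∀ i, HasMean ν (g i) (a i)) : HasMean ν (fun z => ∑ i, g i z) (∑ i, a i) :=
  ⟨integrable_finsetSum _ fun i _ => (hg i).1, by
    rw [integral_finsetSum _ fun i _ => (hg i).1]
    exact Finset.sum_congr rfl fun i _ => (hg i).2⟩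

lemma const [IsProbabilityMeasure ν] (c : ℝ) : HasMean ν (fun _ => c) c :=
  ⟨integrable_const c, by simp⟩

lemma integral_eq (hg : HasMean ν g a) (hgh : ∀ z, h z = g z) : ∫ z, h z ∂ν = a := by
  rw [← hg.2]
  exact integral_congr_ae (Filter.Eventually.of_forall hgh)

end HasMean

namespace IsBoundedState

variable {ω₀ γ T Θ S M : ℝ} {f : ℝ → ℝ} {μ : ℝ → Measure (Phase n)}

lemma integrable_linear (h : IsBoundedState ω₀ γ T Θ S M f μ) {t : ℝ} (ht : 0 ≤ t)
    (ℓ : Phase n →L[ℝ] ℝ) : Integrable (fun z => ℓ z) (μ t) := by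
  have := h.state.isProbabilityMeasure t ht
  simpa only [quadPoly_linear] using integrable_quadPoly (h.moment t ht).1 0 ℓ

lemma integrable_mul (h : IsBoundedState ω₀ γ T Θ S M f μ) {t : ℝ} (ht : 0 ≤ t)
    (ℓ₁ ℓ₂ : Phase n →L[ℝ] ℝ) : Integrable (fun z => ℓ₁ z * ℓ₂ z) (μ t) := by
  have := h.state.isProbabilityMeasure t ht
  simpa only [quadPoly_mul] using integrable_quadPoly (h.moment t ht).1 (ℓ₁.smulRight ℓ₂) 0

lemma continuousOn_linear (h : IsBoundedState ω₀ γ T Θ S M f μ) (ℓ : Phase n →L[ℝ] ℝ) :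
    ContinuousOn (fun t => ∫ z, ℓ z ∂(μ t)) (Set.Ici 0) := by
  simpa only [quadPoly_linear] using h.state.continuousOn_quadPoly h.continuous_force h.force_le
    h.moment h.nonneg 0 ℓ

lemma continuousOn_mul (h : IsBoundedState ω₀ γ T Θ S M f μ) (ℓ₁ ℓ₂ : Phase n →L[ℝ] ℝ) :
    ContinuousOn (fun t => ∫ z, ℓ₁ z * ℓ₂ z ∂(μ t)) (Set.Ici 0) := by
  simpa only [quadPoly_mul] using h.state.continuousOn_quadPoly h.continuous_force h.force_le
    h.moment h.nonneg (ℓ₁.smulRight ℓ₂) 0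

lemma hasMean_pos (h : IsBoundedState ω₀ γ T Θ S M f μ) {t : ℝ} (ht : 0 ≤ t) (x : Fin (n + 1)) :
    HasMean (μ t) (fun z => z.1 x) (meanPos μ t x) := ⟨h.integrable_linear ht (posL x), rfl⟩

lemma hasMean_mom (h : IsBoundedState ω₀ γ T Θ S M f μ) {t : ℝ} (ht : 0 ≤ t) (x : Fin (n + 1)) :
    HasMean (μ t) (fun z => z.2 x) (meanMom μ t x) := ⟨h.integrable_linear ht (momL x), rfl⟩

lemma hasMean_qq (h : IsBoundedState ω₀ γ T Θ S M f μ) {t : ℝ} (ht : 0 ≤ t) (x y : Fin (n + 1)) :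
    HasMean (μ t) (fun z => z.1 x * z.1 y) (momQQ μ t x y) :=
  ⟨h.integrable_mul ht (posL x) (posL y), rfl⟩

lemma hasMean_qp (h : IsBoundedState ω₀ γ T Θ S M f μ) {t : ℝ} (ht : 0 ≤ t) (x y : Fin (n + 1)) :
    HasMean (μ t) (fun z => z.1 x * z.2 y) (momQP μ t x y) :=
  ⟨h.integrable_mul ht (posL x) (momL y), rfl⟩

lemma hasMean_pp (h : IsBoundedState ω₀ γ T Θ S M f μ) {t : ℝ} (ht : 0 ≤ t) (x y : Fin (n + 1)) :
    HasMean (μ t) (fun z => z.2 x * z.2 y) (momPP μ t x y) :=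
  ⟨h.integrable_mul ht (momL x) (momL y), rfl⟩

lemma continuousOn_meanPos (h : IsBoundedState ω₀ γ T Θ S M f μ) (x : Fin (n + 1)) :
    ContinuousOn (fun t => meanPos μ t x) (Set.Ici 0) := h.continuousOn_linear (posL x)

lemma continuousOn_meanMom (h : IsBoundedState ω₀ γ T Θ S M f μ) (x : Fin (n + 1)) :
    ContinuousOn (fun t => meanMom μ t x) (Set.Ici 0) := h.continuousOn_linear (momL x)

lemma continuousOn_momQQ (h : IsBoundedState ω₀ γ T Θ S M f μ) (x y : Fin (n + 1)) :
    ContinuousOn (fun t => momQQ μ t x y) (Set.Ici 0) := h.continuousOn_mul (posL x) (posL y)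

lemma continuousOn_momQP (h : IsBoundedState ω₀ γ T Θ S M f μ) (x y : Fin (n + 1)) :
    ContinuousOn (fun t => momQP μ t x y) (Set.Ici 0) := h.continuousOn_mul (posL x) (momL y)

lemma continuousOn_momPP (h : IsBoundedState ω₀ γ T Θ S M f μ) (x y : Fin (n + 1)) :
    ContinuousOn (fun t => momPP μ t x y) (Set.Ici 0) := h.continuousOn_mul (momL x) (momL y)

lemma hasDerivWithinAt_linear (h : IsBoundedState ω₀ γ T Θ S M f μ) (ℓ : Phase n →L[ℝ] ℝ)
    {D : ℝ → ℝ} (hD : ContinuousOn D (Set.Ici 0))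
    (hgen : ∀ t, 0 ≤ t → ∫ z, (ℓ (drift ω₀ (2 * γ) z) + f t * ℓ (momentumDir (Fin.last n))) ∂(μ t)
      = D t) {t : ℝ} (ht : 0 ≤ t) :
    HasDerivWithinAt (fun t => ∫ z, ℓ z ∂(μ t)) (D t) (Set.Ici 0) t := by
  have := h.state.hasDerivWithinAt_quadPoly h.continuous_force h.force_le h.moment h.nonneg 0 ℓ hD
    (fun t ht => by simpa only [generator_linear] using hgen t ht) ht
  simpa only [quadPoly_linear] using this

lemma hasDerivWithinAt_mul (h : IsBoundedState ω₀ γ T Θ S M f μ) (ℓ₁ ℓ₂ : Phase n →L[ℝ] ℝ)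
    {D : ℝ → ℝ} (hD : ContinuousOn D (Set.Ici 0))
    (hgen : ∀ t, 0 ≤ t → ∫ z,
      (ℓ₁ z * (ℓ₂ (drift ω₀ (2 * γ) z) + f t * ℓ₂ (momentumDir (Fin.last n)))
        + (ℓ₁ (drift ω₀ (2 * γ) z) + f t * ℓ₁ (momentumDir (Fin.last n))) * ℓ₂ z
        + 4 * γ * ∑ x, (if x = 0 then T else z.2 x ^ 2) *
          (ℓ₁ (momentumDir x) * ℓ₂ (momentumDir x))) ∂(μ t) = D t) {t : ℝ} (ht : 0 ≤ t) :
    HasDerivWithinAt (fun t => ∫ z, ℓ₁ z * ℓ₂ z ∂(μ t)) (D t) (Set.Ici 0) t := by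
  have := h.state.hasDerivWithinAt_quadPoly h.continuous_force h.force_le h.moment h.nonneg
    (ℓ₁.smulRight ℓ₂) 0 hD (fun t ht => by simpa only [generator_mul] using hgen t ht) ht
  simpa only [quadPoly_mul] using this

lemma hasDerivWithinAt_meanPos (h : IsBoundedState ω₀ γ T Θ S M f μ) (x : Fin (n + 1)) {t : ℝ}
    (ht : 0 ≤ t) :
    HasDerivWithinAt (fun t => meanPos μ t x) (meanMom μ t x) (Set.Ici 0) t := by
  refine h.hasDerivWithinAt_linear (posL x) (h.continuousOn_meanMom x) (fun t _ => ?_) ht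
  simp only [posL_drift, posL_momentumDir, mul_zero, add_zero]
  rfl

lemma hasDerivWithinAt_meanMom (h : IsBoundedState ω₀ γ T Θ S M f μ) (x : Fin (n + 1)) {t : ℝ}
    (ht : 0 ≤ t) :
    HasDerivWithinAt (fun t => meanMom μ t x)
      (-(∑ k, stiffness ω₀ x k * meanPos μ t k) - 2 * γ * meanMom μ t x + f t * lastInd x)
      (Set.Ici 0) t := by
  refine h.hasDerivWithinAt_linear (momL x) (D := fun t => -(∑ k, stiffness ω₀ x k * meanPos μ t k)
    - 2 * γ * meanMom μ t x + f t * lastInd x) ?_ (fun t ht => ?_) ht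
  · exact ((continuousOn_finsetSum _ fun k _ => continuousOn_const.mul
      (h.continuousOn_meanPos k)).neg.sub (continuousOn_const.mul (h.continuousOn_meanMom x))).add
      (h.continuous_force.continuousOn.mul continuousOn_const)
  · have := h.state.isProbabilityMeasure t ht
    exact (((HasMean.sum fun k => (h.hasMean_pos ht k).const_mul (stiffness ω₀ x k)).neg.sub
      ((h.hasMean_mom ht x).const_mul (2 * γ))).add (HasMean.const (f t * lastInd x))).integral_eq
      fun z => by simp only [momL_drift, momL_momentumDir, lastInd]

lemma hasDerivWithinAt_momQQ (h : IsBoundedState ω₀ γ T Θ S M f μ) (x y : Fin (n + 1)) {t : ℝ}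
    (ht : 0 ≤ t) :
    HasDerivWithinAt (fun t => momQQ μ t x y) (momQP μ t x y + momQP μ t y x) (Set.Ici 0) t := by
  refine h.hasDerivWithinAt_mul (posL x) (posL y) (D := fun t => momQP μ t x y + momQP μ t y x)
    ((h.continuousOn_momQP x y).add (h.continuousOn_momQP y x)) (fun t ht => ?_) ht
  refine ((h.hasMean_qp ht x y).add (h.hasMean_qp ht y x)).integral_eq fun z => ?_
  simp only [posL_drift, posL_momentumDir]
  simp [posL_apply, mul_comm]

lemma hasDerivWithinAt_momQP (h : IsBoundedState ω₀ γ T Θ S M f μ) (x y : Fin (n + 1)) {t : ℝ}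
    (ht : 0 ≤ t) :
    HasDerivWithinAt (fun t => momQP μ t x y)
      (momPP μ t x y - ∑ k, stiffness ω₀ y k * momQQ μ t x k - 2 * γ * momQP μ t x y
        + f t * lastInd y * meanPos μ t x) (Set.Ici 0) t := by
  refine h.hasDerivWithinAt_mul (posL x) (momL y)
    (D := fun t => momPP μ t x y - ∑ k, stiffness ω₀ y k * momQQ μ t x k - 2 * γ * momQP μ t x y
        + f t * lastInd y * meanPos μ t x) ?_ (fun t ht => ?_) ht
  · exact (((h.continuousOn_momPP x y).sub (continuousOn_finsetSum _ fun k _ =>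
      continuousOn_const.mul (h.continuousOn_momQQ x k))).sub
      (continuousOn_const.mul (h.continuousOn_momQP x y))).add
      ((h.continuous_force.continuousOn.mul continuousOn_const).mul (h.continuousOn_meanPos x))
  · refine ((((h.hasMean_pp ht x y).sub (HasMean.sum fun k =>
      (h.hasMean_qq ht x k).const_mul (stiffness ω₀ y k))).sub
      ((h.hasMean_qp ht x y).const_mul (2 * γ))).add
      ((h.hasMean_pos ht x).const_mul (f t * lastInd y))).integral_eq fun z => ?_
    simp only [posL_drift, posL_momentumDir, momL_drift, momL_momentumDir]
    simp only [posL_apply, momL_apply, mul_zero, add_zero, zero_mul, Finset.sum_const_zero,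
      lastInd, mul_left_comm _ (z.1 x), ← Finset.mul_sum]
    ring

/-- The damping rate is `4γ` for every pair of sites. On the diagonal the flip noise restores the
full second moment at `x ≠ 0`, while the thermostat restores `T` at site `0`. -/
lemma hasDerivWithinAt_momPP (h : IsBoundedState ω₀ γ T Θ S M f μ) (x y : Fin (n + 1)) {t : ℝ}
    (ht : 0 ≤ t) :
    HasDerivWithinAt (fun t => momPP μ t x y)
      (-(∑ k, stiffness ω₀ x k * momQP μ t k y) - ∑ k, stiffness ω₀ y k * momQP μ t k x
        - 4 * γ * momPP μ t x y + f t * lastInd x * meanMom μ t y + f t * lastInd y * meanMom μ t x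
        + 4 * γ * (if x = y then (if x = 0 then T else momPP μ t x x) else 0)) (Set.Ici 0) t := by
  refine h.hasDerivWithinAt_mul (momL x) (momL y)
    (D := fun t => -(∑ k, stiffness ω₀ x k * momQP μ t k y) - ∑ k, stiffness ω₀ y k * momQP μ t k x
        - 4 * γ * momPP μ t x y + f t * lastInd x * meanMom μ t y + f t * lastInd y * meanMom μ t x
        + 4 * γ * (if x = y then (if x = 0 then T else momPP μ t x x) else 0)) ?_
        (fun t ht => ?_) ht
  · have hlast : ContinuousOn (fun t => 4 * γ * (if x = y then (if x = 0 then T else momPP μ t x x)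
        else 0)) (Set.Ici 0) := by
      refine continuousOn_const.mul ?_
      split_ifs
      · exact continuousOn_const
      · exact h.continuousOn_momPP x x
      · exact continuousOn_const
    exact (((((continuousOn_finsetSum _ fun k _ => continuousOn_const.mul
      (h.continuousOn_momQP k y)).neg.sub (continuousOn_finsetSum _ fun k _ =>
      continuousOn_const.mul (h.continuousOn_momQP k x))).sub
      (continuousOn_const.mul (h.continuousOn_momPP x y))).add
      ((h.continuous_force.continuousOn.mul continuousOn_const).mul (h.continuousOn_meanMom y))).add
      ((h.continuous_force.continuousOn.mul continuousOn_const).mul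
        (h.continuousOn_meanMom x))).add hlast
  · have := h.state.isProbabilityMeasure t ht
    have h6 : HasMean (μ t) (fun z => if x = y then (if x = 0 then T else z.2 x * z.2 x) else 0)
        (if x = y then (if x = 0 then T else momPP μ t x x) else 0) := by
      split_ifs
      · exact HasMean.const _
      · exact h.hasMean_pp ht x x
      · exact HasMean.const _
    refine ((((((HasMean.sum fun k => (h.hasMean_qp ht k y).const_mul (stiffness ω₀ x k)).neg.sub
      (HasMean.sum fun k => (h.hasMean_qp ht k x).const_mul (stiffness ω₀ y k))).sub
      ((h.hasMean_pp ht x y).const_mul (4 * γ))).add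
      ((h.hasMean_mom ht y).const_mul (f t * lastInd x))).add
      ((h.hasMean_mom ht x).const_mul (f t * lastInd y))).add
      (h6.const_mul (4 * γ))).integral_eq fun z => ?_
    have hsum : ∑ k, (if k = 0 then T else z.2 k ^ 2) * ((if x = k then (1 : ℝ) else 0) *
        (if y = k then 1 else 0)) =
        if x = y then (if x = 0 then T else z.2 x * z.2 x) else 0 := by
      rw [Finset.sum_eq_single x]
      · by_cases hxy : x = y
        · simp [hxy, sq]
        · simp [hxy, Ne.symm hxy]
      · intro b _ hb; simp [Ne.symm hb]
      · simp
    simp only [momL_drift, momL_momentumDir, hsum]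
    simp only [momL_apply, lastInd, ← mul_assoc, ← Finset.sum_mul]
    ring

end IsBoundedState

/-! ### Mean-square response of the damped chain -/

lemma continuousOn_Ici_intervalIntegrable {u : ℝ → ℝ} (hu : ContinuousOn u (Set.Ici 0)) {b : ℝ}
    (hb : 0 ≤ b) : IntervalIntegrable u volume 0 b :=
  (hu.mono (by rw [Set.uIcc_of_le hb]; exact fun t ht => ht.1)).intervalIntegrable

/-- Mean-square response of the damped chain to a force applied at the last site. -/
lemma periodic_response_bound {ω₀ γ Θ L : ℝ} (hω₀ : 0 < ω₀) (hγ : 0 < γ) (hΘ : 0 < Θ)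
    {g : ℝ → ℝ} (hg : Continuous g) (hL : ∀ t, |g t| ≤ L) {u v : ℝ → Fin (n + 1) → ℝ}
    (hu : ∀ x t, 0 ≤ t → HasDerivWithinAt (fun t => u t x) (v t x) (Set.Ici 0) t)
    (hv : ∀ x t, 0 ≤ t → HasDerivWithinAt (fun t => v t x)
      (-(∑ k, stiffness ω₀ x k * u t k) - 2 * γ * v t x + g t * lastInd x) (Set.Ici 0) t)
    (hu0 : u Θ = u 0) (hv0 : v Θ = v 0) :
    ∑ x, ((1 / Θ) * ∫ t in (0 : ℝ)..Θ, u t x ^ 2) ≤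
      2 / ω₀ ^ 2 * (1 / (4 * γ ^ 2) + 1 / (2 * ω₀ ^ 2)) * L ^ 2 := by
  have huc : ∀ x, ContinuousOn (fun t => u t x) (Set.Ici 0) := fun x t ht =>
    (hu x t ht).continuousWithinAt
  have hvc : ∀ x, ContinuousOn (fun t => v t x) (Set.Ici 0) := fun x t ht =>
    (hv x t ht).continuousWithinAt
  let w : ℝ → Fin (n + 1) → ℝ := fun t x =>
    -(∑ k, stiffness ω₀ x k * u t k) - 2 * γ * v t x + g t * lastInd x
  have hwc : ∀ x, ContinuousOn (fun t => w t x) (Set.Ici 0) := fun x =>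
    ((continuousOn_finsetSum _ fun k _ => continuousOn_const.mul (huc k)).neg.sub
      (continuousOn_const.mul (hvc x))).add (hg.continuousOn.mul continuousOn_const)
  -- Energy over `γ`, plus `u · v` to produce dissipation in `u`, plus `γ|u|²` to cancel the cross
  -- term `-2γ u · v`. The derivative is `-|v|² - u · Ku + g (v_n / γ + u_n)`, and its integral over
  -- a period vanishes.
  let Ξ : ℝ → ℝ := fun t => ∑ x, (1 / γ * (v t x * v t x / 2 +
    u t x * (∑ k, stiffness ω₀ x k * u t k) / 2) + u t x * v t x + γ * (u t x * u t x))
  let Ξ' : ℝ → ℝ := fun t => ∑ x, (1 / γ * ((w t x * v t x + v t x * w t x) / 2 +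
    (v t x * (∑ k, stiffness ω₀ x k * u t k) + u t x * (∑ k, stiffness ω₀ x k * v t k)) / 2)
    + (v t x * v t x + u t x * w t x) + γ * (v t x * u t x + u t x * v t x))
  have hd : ∀ t, 0 ≤ t → HasDerivWithinAt Ξ (Ξ' t) (Set.Ici 0) t := fun t ht => by
    refine HasDerivWithinAt.fun_sum fun x _ => ?_
    have a1 := hu x t ht
    have a2 := hv x t ht
    have a3 : HasDerivWithinAt (fun t => ∑ k, stiffness ω₀ x k * u t k)
        (∑ k, stiffness ω₀ x k * v t k) (Set.Ici 0) t :=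
      HasDerivWithinAt.fun_sum fun k _ => (hu k t ht).const_mul _
    exact (((((a2.mul a2).div_const 2).add ((a1.mul a3).div_const 2)).const_mul (1 / γ)).add
      (a1.mul a2)).add ((a1.mul a1).const_mul γ)
  have hΞ'c : ContinuousOn Ξ' (Set.Ici 0) := by
    refine continuousOn_finsetSum _ fun x _ => ?_
    have b1 := huc x
    have b2 := hvc x
    have b3 := hwc x
    have b4 : ContinuousOn (fun t => ∑ k, stiffness ω₀ x k * u t k) (Set.Ici 0) :=
      continuousOn_finsetSum _ fun k _ => continuousOn_const.mul (huc k)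
    have b5 : ContinuousOn (fun t => ∑ k, stiffness ω₀ x k * v t k) (Set.Ici 0) :=
      continuousOn_finsetSum _ fun k _ => continuousOn_const.mul (hvc k)
    exact (((continuousOn_const.mul ((((b3.mul b2).add (b2.mul b3)).div_const 2).add
      (((b2.mul b4).add (b1.mul b5)).div_const 2))).add ((b2.mul b2).add (b1.mul b3))).add
      (continuousOn_const.mul ((b2.mul b1).add (b1.mul b2))))
  have hint := integral_eq_sub_of_hasDerivWithinAt_Ici hd hΞ'c le_rfl hΘ.le
  have hΞ0 : Ξ Θ = Ξ 0 := by simp only [Ξ, hu0, hv0]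
  rw [hΞ0, sub_self] at hint
  -- The costs of two Young inequalities: `g v_n / γ` is absorbed by all of `|v|²`, and `g u_n` by
  -- half of `ω₀²|u|²`.
  set c := 1 / (4 * γ ^ 2) + 1 / (2 * ω₀ ^ 2) with hc
  have hpt : ∀ t, Ξ' t ≤ c * L ^ 2 - ω₀ ^ 2 / 2 * ∑ x, u t x ^ 2 := fun t => by
    have e1 : Ξ' t = -(v t ⬝ᵥ v t) - u t ⬝ᵥ stiffness ω₀ *ᵥ u t
        + g t * (1 / γ * v t (Fin.last n) + u t (Fin.last n)) := by
      have s1 : u t ⬝ᵥ stiffness ω₀ *ᵥ v t = v t ⬝ᵥ stiffness ω₀ *ᵥ u t := by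
        rw [← dotProduct_transpose_mulVec, stiffness_transpose]
      have s2 : Ξ' t = ∑ x, (-(v t x * v t x) - u t x * (stiffness ω₀ *ᵥ u t) x
          + g t * ((1 / γ * v t x + u t x) * lastInd x)
          + 1 / γ / 2 * (u t x * (stiffness ω₀ *ᵥ v t) x - v t x * (stiffness ω₀ *ᵥ u t) x)) := by
        refine Finset.sum_congr rfl fun x _ => ?_
        have k1 : ∑ k, stiffness ω₀ x k * u t k = (stiffness ω₀ *ᵥ u t) x := rfl
        have k2 : ∑ k, stiffness ω₀ x k * v t k = (stiffness ω₀ *ᵥ v t) x := rfl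
        simp only [w, k1, k2]
        field_simp
        ring
      rw [s2, Finset.sum_add_distrib, Finset.sum_add_distrib, Finset.sum_sub_distrib,
        Finset.sum_neg_distrib, ← Finset.mul_sum, ← Finset.mul_sum, Finset.sum_sub_distrib]
      have s3 : ∑ x, (1 / γ * v t x + u t x) * lastInd x =
          1 / γ * v t (Fin.last n) + u t (Fin.last n) := by
        simp [lastInd]
      rw [s3]
      change -(v t ⬝ᵥ v t) - u t ⬝ᵥ stiffness ω₀ *ᵥ u t + _ +
        1 / γ / 2 * (u t ⬝ᵥ stiffness ω₀ *ᵥ v t - v t ⬝ᵥ stiffness ω₀ *ᵥ u t) = _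
      rw [s1, sub_self, mul_zero, add_zero]
    have e2 := le_dotProduct_stiffness ω₀ (u t)
    have e3 : ∀ y : Fin (n + 1) → ℝ, y (Fin.last n) ^ 2 ≤ y ⬝ᵥ y := fun y => by
      rw [sq]
      exact Finset.single_le_sum (f := fun x => y x * y x) (fun _ _ => mul_self_nonneg _)
        (Finset.mem_univ _)
    have e4 : ∑ x, u t x ^ 2 = u t ⬝ᵥ u t := by simp [dotProduct, sq]
    have e5 : g t ^ 2 ≤ L ^ 2 := by
      rw [← sq_abs]
      exact pow_le_pow_left₀ (abs_nonneg _) (hL t) 2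
    have e6 : g t * (1 / γ * v t (Fin.last n)) ≤ v t (Fin.last n) ^ 2 +
        1 / (4 * γ ^ 2) * g t ^ 2 := by
      have := sq_nonneg (v t (Fin.last n) - 1 / (2 * γ) * g t)
      have r : (v t (Fin.last n) - 1 / (2 * γ) * g t) ^ 2 = v t (Fin.last n) ^ 2 -
        g t * (1 / γ * v t (Fin.last n)) + 1 / (4 * γ ^ 2) * g t ^ 2 := by field_simp; ring
      linarith
    have e7 : g t * u t (Fin.last n) ≤ ω₀ ^ 2 / 2 * u t (Fin.last n) ^ 2 +
        1 / (2 * ω₀ ^ 2) * g t ^ 2 := by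
      have := sq_nonneg (ω₀ * u t (Fin.last n) - 1 / ω₀ * g t)
      have r : (ω₀ * u t (Fin.last n) - 1 / ω₀ * g t) ^ 2 = 2 * (ω₀ ^ 2 / 2 * u t (Fin.last n) ^ 2 -
        g t * u t (Fin.last n) + 1 / (2 * ω₀ ^ 2) * g t ^ 2) := by field_simp; ring
      linarith
    have e8 : c * g t ^ 2 ≤ c * L ^ 2 := by gcongr
    have e9 : c * g t ^ 2 = 1 / (4 * γ ^ 2) * g t ^ 2 + 1 / (2 * ω₀ ^ 2) * g t ^ 2 := by
      rw [hc]; ring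
    have e10 : ω₀ ^ 2 / 2 * u t (Fin.last n) ^ 2 ≤ ω₀ ^ 2 / 2 * (u t ⬝ᵥ u t) := by
      gcongr; exact e3 _
    have e11 := e3 (v t)
    rw [e1, e4, mul_add]
    linarith
  have hui : ∀ x, IntervalIntegrable (fun t => u t x ^ 2) volume 0 Θ := fun x =>
    continuousOn_Ici_intervalIntegrable ((huc x).pow 2) hΘ.le
  have husum : IntervalIntegrable (fun t => ∑ x, u t x ^ 2) volume 0 Θ :=
    continuousOn_Ici_intervalIntegrable (continuousOn_finsetSum _ fun x _ => (huc x).pow 2) hΘ.le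
  have hmono := intervalIntegral.integral_mono_on hΘ.le
    (continuousOn_Ici_intervalIntegrable hΞ'c hΘ.le)
    (intervalIntegrable_const.sub (husum.const_mul (ω₀ ^ 2 / 2))) fun t _ => hpt t
  rw [hint, intervalIntegral.integral_sub intervalIntegrable_const (husum.const_mul _),
    intervalIntegral.integral_const, sub_zero, smul_eq_mul, intervalIntegral.integral_const_mul,
    intervalIntegral.integral_finsetSum fun x _ => hui x] at hmono
  rw [← Finset.mul_sum]
  set I := ∑ x, ∫ t in (0 : ℝ)..Θ, u t x ^ 2
  have hI : ω₀ ^ 2 / 2 * I ≤ Θ * (c * L ^ 2) := by linarith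
  have hω2 : 0 < ω₀ ^ 2 := by positivity
  calc 1 / Θ * I = 2 / ω₀ ^ 2 * (1 / Θ) * (ω₀ ^ 2 / 2 * I) := by field_simp
    _ ≤ 2 / ω₀ ^ 2 * (1 / Θ) * (Θ * (c * L ^ 2)) := by gcongr
    _ = _ := by field_simp

/-! ### Time-averaged covariances -/

/-- The average of a function of time over `[0, Θ]`. -/
def avg (Θ : ℝ) (u : ℝ → ℝ) : ℝ := (1 / Θ) * ∫ t in (0 : ℝ)..Θ, u t

/-- `u` is continuous on `[0, ∞)` with average `a` over `[0, Θ]`. -/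
def HasAvg (Θ : ℝ) (u : ℝ → ℝ) (a : ℝ) : Prop := ContinuousOn u (Set.Ici 0) ∧ avg Θ u = a

namespace HasAvg

variable {Θ : ℝ} {u v : ℝ → ℝ} {a b : ℝ}

lemma add (hΘ : 0 ≤ Θ) (hu : HasAvg Θ u a) (hv : HasAvg Θ v b) :
    HasAvg Θ (fun t => u t + v t) (a + b) :=
  ⟨hu.1.add hv.1, by
    rw [avg, intervalIntegral.integral_add (continuousOn_Ici_intervalIntegrable hu.1 hΘ)
      (continuousOn_Ici_intervalIntegrable hv.1 hΘ), mul_add, ← hu.2, ← hv.2]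
    rfl⟩

lemma neg (hu : HasAvg Θ u a) : HasAvg Θ (fun t => -u t) (-a) :=
  ⟨hu.1.neg, by rw [avg, intervalIntegral.integral_neg, mul_neg, ← hu.2]; rfl⟩

lemma sub (hΘ : 0 ≤ Θ) (hu : HasAvg Θ u a) (hv : HasAvg Θ v b) :
    HasAvg Θ (fun t => u t - v t) (a - b) := by
  simpa only [sub_eq_add_neg] using hu.add hΘ hv.neg

lemma const_mul (hu : HasAvg Θ u a) (c : ℝ) : HasAvg Θ (fun t => c * u t) (c * a) :=
  ⟨continuousOn_const.mul hu.1, by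
    rw [avg, intervalIntegral.integral_const_mul, mul_left_comm, ← hu.2]; rfl⟩

lemma sum {ι : Type*} [Fintype ι] (hΘ : 0 ≤ Θ) {u : ι → ℝ → ℝ} {a : ι → ℝ}
    (hu : ∀ i, HasAvg Θ (u i) (a i)) : HasAvg Θ (fun t => ∑ i, u i t) (∑ i, a i) :=
  ⟨continuousOn_finsetSum _ fun i _ => (hu i).1, by
    rw [avg, intervalIntegral.integral_finsetSum fun i _ =>
      continuousOn_Ici_intervalIntegrable (hu i).1 hΘ, Finset.mul_sum]
    exact Finset.sum_congr rfl fun i _ => (hu i).2⟩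

lemma const (hΘ : 0 < Θ) (c : ℝ) : HasAvg Θ (fun _ => c) c :=
  ⟨continuousOn_const, by simp [avg, hΘ.ne']⟩

lemma eq_zero_of_periodic (hΘ : 0 ≤ Θ) (hv : HasAvg Θ v a)
    (hd : ∀ t, 0 ≤ t → HasDerivWithinAt u (v t) (Set.Ici 0) t) (hu : u Θ = u 0) : a = 0 := by
  rw [← hv.2, avg, integral_eq_sub_of_hasDerivWithinAt_Ici hd hv.1 le_rfl hΘ, hu, sub_self,
    mul_zero]

end HasAvg

namespace IsBoundedState

variable {ω₀ γ T Θ S M : ℝ} {f : ℝ → ℝ} {μ : ℝ → Measure (Phase n)}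

/-- The time average of the covariances of the positions. -/
def covQQ (Θ : ℝ) (μ : ℝ → Measure (Phase n)) : Matrix (Fin (n + 1)) (Fin (n + 1)) ℝ :=
  Matrix.of fun x y => avg Θ fun t => momQQ μ t x y - meanPos μ t x * meanPos μ t y

/-- The time average of the mixed covariances. -/
def covQP (Θ : ℝ) (μ : ℝ → Measure (Phase n)) : Matrix (Fin (n + 1)) (Fin (n + 1)) ℝ :=
  Matrix.of fun x y => avg Θ fun t => momQP μ t x y - meanPos μ t x * meanMom μ t y

/-- The time average of the covariances of the momenta. -/
def covPP (Θ : ℝ) (μ : ℝ → Measure (Phase n)) : Matrix (Fin (n + 1)) (Fin (n + 1)) ℝ :=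
  Matrix.of fun x y => avg Θ fun t => momPP μ t x y - meanMom μ t x * meanMom μ t y

lemma measure_period (h : IsBoundedState ω₀ γ T Θ S M f μ) : μ Θ = μ 0 := by
  simpa using h.state.periodic 0 le_rfl

lemma hasAvg_covQQ (h : IsBoundedState ω₀ γ T Θ S M f μ) (x y : Fin (n + 1)) :
    HasAvg Θ (fun t => momQQ μ t x y - meanPos μ t x * meanPos μ t y) (covQQ Θ μ x y) :=
  ⟨(h.continuousOn_momQQ x y).sub ((h.continuousOn_meanPos x).mul (h.continuousOn_meanPos y)), rfl⟩

lemma hasAvg_covQP (h : IsBoundedState ω₀ γ T Θ S M f μ) (x y : Fin (n + 1)) :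
    HasAvg Θ (fun t => momQP μ t x y - meanPos μ t x * meanMom μ t y) (covQP Θ μ x y) :=
  ⟨(h.continuousOn_momQP x y).sub ((h.continuousOn_meanPos x).mul (h.continuousOn_meanMom y)), rfl⟩

lemma hasAvg_covPP (h : IsBoundedState ω₀ γ T Θ S M f μ) (x y : Fin (n + 1)) :
    HasAvg Θ (fun t => momPP μ t x y - meanMom μ t x * meanMom μ t y) (covPP Θ μ x y) :=
  ⟨(h.continuousOn_momPP x y).sub ((h.continuousOn_meanMom x).mul (h.continuousOn_meanMom y)), rfl⟩

lemma covQQ_transpose : (covQQ Θ μ)ᵀ = covQQ Θ μ := by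
  ext x y
  simp only [covQQ, transpose_apply, of_apply, momQQ, mul_comm]

lemma covPP_transpose : (covPP Θ μ)ᵀ = covPP Θ μ := by
  ext x y
  simp only [covPP, transpose_apply, of_apply, momPP, mul_comm]

/-- The symmetrized mixed covariance is the time derivative of the periodic position covariance, so
it averages to zero. -/
lemma covQP_transpose (h : IsBoundedState ω₀ γ T Θ S M f μ) (hΘ : 0 ≤ Θ) :
    (covQP Θ μ)ᵀ = -covQP Θ μ := by
  refine eq_neg_of_add_eq_zero_left ?_
  ext x y
  exact ((h.hasAvg_covQP y x).add hΘ (h.hasAvg_covQP x y)).eq_zero_of_periodic hΘ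
    (u := fun t => momQQ μ t x y - meanPos μ t x * meanPos μ t y)
    (fun t ht => ((h.hasDerivWithinAt_momQQ x y ht).sub
      ((h.hasDerivWithinAt_meanPos x ht).mul (h.hasDerivWithinAt_meanPos y ht))).congr_deriv
      (by ring)) (by simp only [momQQ, meanPos, h.measure_period])

/-- Average of the derivative of the mixed covariance; the force terms of the moment cancel against
those of the product of means. -/
lemma covPP_eq (h : IsBoundedState ω₀ γ T Θ S M f μ) (hΘ : 0 ≤ Θ) :
    covPP Θ μ = covQQ Θ μ * stiffness ω₀ + (2 * γ) • covQP Θ μ := by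
  ext x y
  have hK : ∀ k, stiffness ω₀ k y = stiffness ω₀ y k := fun k =>
    congrFun (congrFun (stiffness_transpose (n := n) ω₀) y) k
  have h0 := (((h.hasAvg_covPP x y).sub hΘ (HasAvg.sum hΘ fun k =>
    (h.hasAvg_covQQ x k).const_mul (stiffness ω₀ y k))).sub hΘ
    ((h.hasAvg_covQP x y).const_mul (2 * γ))).eq_zero_of_periodic hΘ
    (u := fun t => momQP μ t x y - meanPos μ t x * meanMom μ t y)
    (fun t ht => ((h.hasDerivWithinAt_momQP x y ht).sub
      ((h.hasDerivWithinAt_meanPos x ht).mul (h.hasDerivWithinAt_meanMom y ht))).congr_deriv (by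
        simp only [mul_sub, Finset.sum_sub_distrib, mul_left_comm _ (meanPos μ t x),
          ← Finset.mul_sum]
        ring))
    (by simp only [momQP, meanPos, meanMom, h.measure_period])
  rw [Matrix.add_apply, Matrix.smul_apply, Matrix.mul_apply, smul_eq_mul]
  simp only [hK]
  simp only [mul_comm _ (stiffness ω₀ y _)]
  linarith

/-- The time-averaged kinetic temperature profile, with the thermostat temperature at site `0`. -/
def tempProfile (T Θ : ℝ) (μ : ℝ → Measure (Phase n)) (x : Fin (n + 1)) : ℝ :=
  if x = 0 then T else avg Θ fun t => momPP μ t x x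

/-- Average of the derivative of the momentum covariance. The force cancels, but the noise keeps
second moments rather than variances on its diagonal: this is where squared mean momenta enter as
heat sources. -/
lemma diagonal_tempProfile_sub (h : IsBoundedState ω₀ γ T Θ S M f μ) (hΘ : 0 < Θ) :
    (4 * γ) • (diagonal (tempProfile T Θ μ) - covPP Θ μ) =
      stiffness ω₀ * covQP Θ μ - covQP Θ μ * stiffness ω₀ := by
  have hA := h.covQP_transpose hΘ.le
  have hAK : covQP Θ μ * stiffness ω₀ = -(stiffness ω₀ * covQP Θ μ)ᵀ := by
    rw [transpose_mul, hA, stiffness_transpose, Matrix.neg_mul, neg_neg]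
  rw [hAK, sub_neg_eq_add]
  ext x y
  have hdiag : HasAvg Θ (fun t => if x = y then (if x = 0 then T else momPP μ t x x) else 0)
      (diagonal (tempProfile T Θ μ) x y) := by
    rw [diagonal_apply, tempProfile]
    split_ifs
    · exact HasAvg.const hΘ _
    · exact ⟨h.continuousOn_momPP x x, rfl⟩
    · exact HasAvg.const hΘ _
  have h0 := (((((HasAvg.sum hΘ.le fun k => (h.hasAvg_covQP k y).const_mul
    (stiffness ω₀ x k)).neg.sub hΘ.le (HasAvg.sum hΘ.le fun k =>
    (h.hasAvg_covQP k x).const_mul (stiffness ω₀ y k))).sub hΘ.le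
    ((h.hasAvg_covPP x y).const_mul (4 * γ))).add hΘ.le
    (hdiag.const_mul (4 * γ)))).eq_zero_of_periodic hΘ.le
    (u := fun t => momPP μ t x y - meanMom μ t x * meanMom μ t y)
    (fun t ht => ((h.hasDerivWithinAt_momPP x y ht).sub
      ((h.hasDerivWithinAt_meanMom x ht).mul (h.hasDerivWithinAt_meanMom y ht))).congr_deriv (by
        simp only [mul_sub, Finset.sum_sub_distrib, ← mul_assoc, ← Finset.sum_mul]
        ring))
    (by simp only [momPP, meanMom, h.measure_period])
  rw [Matrix.smul_apply, Matrix.sub_apply, Matrix.add_apply, transpose_apply, Matrix.mul_apply,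
    Matrix.mul_apply, smul_eq_mul]
  linarith

end IsBoundedState

lemma HasAvg.mono {Θ : ℝ} {u v : ℝ → ℝ} {a b : ℝ} (hΘ : 0 < Θ) (hu : HasAvg Θ u a)
    (hv : HasAvg Θ v b) (h : ∀ t, 0 ≤ t → u t ≤ v t) : a ≤ b := by
  rw [← hu.2, ← hv.2, avg, avg]
  exact mul_le_mul_of_nonneg_left (intervalIntegral.integral_mono_on hΘ.le
    (continuousOn_Ici_intervalIntegrable hu.1 hΘ.le)
    (continuousOn_Ici_intervalIntegrable hv.1 hΘ.le) fun t ht => h t ht.1) (by positivity)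

/-! ### Total energy of a periodic state -/

/-- The constant in the mean-square response of the damped chain. -/
def responseConst (ω₀ γ : ℝ) : ℝ := 2 / ω₀ ^ 2 * (1 / (4 * γ ^ 2) + 1 / (2 * ω₀ ^ 2))

/-- The constant comparing temperature gradients with the entropy production. -/
def gradientConst (ω₀ γ : ℝ) : ℝ :=
  2 * (16 * γ ^ 2) * (3 * ω₀ ^ 4 + 24) / ω₀ ^ 2 + 8 * (3 * ω₀ ^ 4 + 24)

lemma responseConst_nonneg (ω₀ γ : ℝ) : 0 ≤ responseConst ω₀ γ := by
  unfold responseConst; positivity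

lemma gradientConst_nonneg (ω₀ γ : ℝ) : 0 ≤ gradientConst ω₀ γ := by
  unfold gradientConst; positivity

lemma sum_energy (ω₀ : ℝ) (z : Phase n) : ∑ x, energy ω₀ x z =
    1 / 2 * ∑ x, z.2 x * z.2 x + 1 / 2 * ∑ x, ∑ y, stiffness ω₀ x y * (z.1 x * z.1 y) := by
  have h1 : ∑ x, ∑ y, stiffness ω₀ x y * (z.1 x * z.1 y) = z.1 ⬝ᵥ stiffness ω₀ *ᵥ z.1 := by
    simp only [dotProduct, mulVec, Finset.mul_sum]
    exact Finset.sum_congr rfl fun x _ => Finset.sum_congr rfl fun y _ => by ring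
  rw [h1, dotProduct_stiffness]
  simp only [dotProduct, Finset.mul_sum, ← Finset.sum_add_distrib]
  exact Finset.sum_congr rfl fun x _ => by simp only [energy]; ring

namespace IsBoundedState

variable {ω₀ γ T Θ S M L : ℝ} {f f' : ℝ → ℝ} {μ : ℝ → Measure (Phase n)}

/-- The mean energy at site `x`, expressed by second moments. -/
def energyMean (ω₀ : ℝ) (μ : ℝ → Measure (Phase n)) (t : ℝ) (x : Fin (n + 1)) : ℝ :=
  1 / 2 * momPP μ t x x + 1 / 2 * (momQQ μ t x x - 2 * momQQ μ t x (prevSite x)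
    + momQQ μ t (prevSite x) (prevSite x)) + ω₀ ^ 2 / 2 * momQQ μ t x x

lemma hasMean_energy (h : IsBoundedState ω₀ γ T Θ S M f μ) {t : ℝ} (ht : 0 ≤ t)
    (x : Fin (n + 1)) : HasMean (μ t) (energy ω₀ x) (energyMean ω₀ μ t x) := by
  have h1 := (((h.hasMean_pp ht x x).const_mul (1 / 2)).add ((((h.hasMean_qq ht x x).sub
    ((h.hasMean_qq ht x (prevSite x)).const_mul 2)).add
    (h.hasMean_qq ht (prevSite x) (prevSite x))).const_mul (1 / 2))).add
    ((h.hasMean_qq ht x x).const_mul (ω₀ ^ 2 / 2))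
  have h2 : energy ω₀ x = _ := funext fun z => show energy ω₀ x z =
    1 / 2 * (z.2 x * z.2 x) + 1 / 2 * (z.1 x * z.1 x - 2 * (z.1 x * z.1 (prevSite x)) +
      z.1 (prevSite x) * z.1 (prevSite x)) + ω₀ ^ 2 / 2 * (z.1 x * z.1 x) by
    simp only [energy]; ring
  rw [h2]
  exact h1

lemma continuousOn_energyMean (h : IsBoundedState ω₀ γ T Θ S M f μ) (x : Fin (n + 1)) :
    ContinuousOn (fun t => energyMean ω₀ μ t x) (Set.Ici 0) :=
  ((continuousOn_const.mul (h.continuousOn_momPP x x)).add (continuousOn_const.mul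
    (((h.continuousOn_momQQ x x).sub (continuousOn_const.mul
    (h.continuousOn_momQQ x (prevSite x)))).add
    (h.continuousOn_momQQ (prevSite x) (prevSite x))))).add
    (continuousOn_const.mul (h.continuousOn_momQQ x x))

lemma continuousOn_integral_energy (h : IsBoundedState ω₀ γ T Θ S M f μ) (x : Fin (n + 1)) :
    ContinuousOn (fun t => ∫ z, energy ω₀ x z ∂(μ t)) (Set.Ici 0) :=
  (h.continuousOn_energyMean x).congr fun _ ht => (h.hasMean_energy ht x).2

lemma sum_energyMean (h : IsBoundedState ω₀ γ T Θ S M f μ) {t : ℝ} (ht : 0 ≤ t) :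
    ∑ x, energyMean ω₀ μ t x = 1 / 2 * ∑ x, momPP μ t x x
      + 1 / 2 * ∑ x, ∑ y, stiffness ω₀ x y * momQQ μ t x y := by
  rw [← (HasMean.sum fun x => h.hasMean_energy ht x).2]
  exact (((HasMean.sum fun x => h.hasMean_pp ht x x).const_mul (1 / 2)).add
    ((HasMean.sum fun x => HasMean.sum fun y =>
      (h.hasMean_qq ht x y).const_mul (stiffness ω₀ x y)).const_mul (1 / 2))).integral_eq
    fun z => sum_energy ω₀ z

lemma sum_avg_meanPos_sq_le (h : IsBoundedState ω₀ γ T Θ S M f μ) (hω₀ : 0 < ω₀) (hγ : 0 < γ)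
    (hΘ : 0 < Θ) : ∑ x, avg Θ (fun t => meanPos μ t x ^ 2) ≤ responseConst ω₀ γ * S ^ 2 :=
  periodic_response_bound hω₀ hγ hΘ h.continuous_force h.force_le
    (fun x _ ht => h.hasDerivWithinAt_meanPos x ht)
    (fun x _ ht => h.hasDerivWithinAt_meanMom x ht)
    (by funext x; simp only [meanPos, h.measure_period])
    (by funext x; simp only [meanMom, h.measure_period])

/-- Differentiating the equation of the means in time shows that the mean momenta play the role of
positions in the same damped chain, driven by `f'`. This replaces the size of the force by the size
of its derivative. -/
lemma sum_avg_meanMom_sq_le (h : IsBoundedState ω₀ γ T Θ S M f μ) (hω₀ : 0 < ω₀) (hγ : 0 < γ)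
    (hΘ : 0 < Θ) (hf' : ∀ t, HasDerivAt f (f' t) t) (hfc : Continuous f') (hL : ∀ t, |f' t| ≤ L)
    (hper : f Θ = f 0) :
    ∑ x, avg Θ (fun t => meanMom μ t x ^ 2) ≤ responseConst ω₀ γ * L ^ 2 := by
  refine periodic_response_bound hω₀ hγ hΘ hfc hL (u := meanMom μ)
    (v := fun t x => -(∑ k, stiffness ω₀ x k * meanPos μ t k) - 2 * γ * meanMom μ t x
      + f t * lastInd x)
    (fun x _ ht => h.hasDerivWithinAt_meanMom x ht) (fun x t ht => ?_)
    (by funext x; simp only [meanMom, h.measure_period])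
    (by funext x; simp only [meanMom, meanPos, h.measure_period, hper])
  exact ((HasDerivWithinAt.fun_sum fun k _ =>
    (h.hasDerivWithinAt_meanPos k ht).const_mul (stiffness ω₀ x k)).neg.sub
    ((h.hasDerivWithinAt_meanMom x ht).const_mul (2 * γ))).add
    ((hf' t).hasDerivWithinAt.mul_const (lastInd x))

/-- Total time-averaged energy of a periodic state. -/
theorem sum_avg_energy_le (h : IsBoundedState ω₀ γ T Θ S M f μ) (hω₀ : 0 < ω₀) (hγ : 0 < γ)
    (hΘ : 0 < Θ) (hf' : ∀ t, HasDerivAt f (f' t) t) (hfc : Continuous f') (hL : ∀ t, |f' t| ≤ L)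
    (hper : f Θ = f 0) :
    ∑ x, avg Θ (fun t => energyMean ω₀ μ t x) ≤
      (n + 1) * (T + gradientConst ω₀ γ * (n * (responseConst ω₀ γ * L ^ 2)))
      + 1 / 2 * (responseConst ω₀ γ * L ^ 2)
      + 1 / 2 * ((ω₀ ^ 2 + 4) * (responseConst ω₀ γ * S ^ 2)) := by
  set s : Fin (n + 1) → ℝ := fun x => avg Θ fun t => meanMom μ t x ^ 2 with hs
  have hsavg : ∀ x, HasAvg Θ (fun t => meanMom μ t x ^ 2) (s x) := fun x =>
    ⟨(h.continuousOn_meanMom x).pow 2, rfl⟩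
  have hs0 : ∀ x, 0 ≤ s x := fun x =>
    (HasAvg.const hΘ 0).mono hΘ (hsavg x) fun t _ => sq_nonneg _
  have hsum := h.sum_avg_meanMom_sq_le hω₀ hγ hΘ hf' hfc hL hper
  have hpp : ∀ x, HasAvg Θ (fun t => momPP μ t x x) (covPP Θ μ x x + s x) := fun x => by
    have := (h.hasAvg_covPP x x).add hΘ.le (hsavg x)
    simpa only [sq, sub_add_cancel] using this
  have htr := trace_covariance_le hω₀ hγ (covQQ_transpose (Θ := Θ) (μ := μ)) covPP_transpose
    (h.covQP_transpose hΘ.le) (h.covPP_eq hΘ.le) (h.diagonal_tempProfile_sub hΘ) hs0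
    fun x hx => by rw [tempProfile, if_neg hx]; exact (hpp x).2
  rw [← gradientConst] at htr
  have hT0 : tempProfile T Θ μ 0 = T := if_pos rfl
  rw [hT0] at htr
  obtain ⟨a, ha⟩ : ∃ a, HasAvg Θ (fun t => meanPos μ t ⬝ᵥ stiffness ω₀ *ᵥ meanPos μ t) a := by
    have hc : ∀ x, ContinuousOn (fun t => ∑ k, stiffness ω₀ x k * meanPos μ t k) (Set.Ici 0) :=
      fun x => continuousOn_finsetSum _ fun k _ =>
        continuousOn_const.mul (h.continuousOn_meanPos k)
    have hc' : ContinuousOn (fun t => ∑ x, meanPos μ t x * ∑ k, stiffness ω₀ x k * meanPos μ t k)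
        (Set.Ici 0) :=
      continuousOn_finsetSum _ fun x _ => (h.continuousOn_meanPos x).mul (hc x)
    exact ⟨_, hc', rfl⟩
  have hale : a ≤ (ω₀ ^ 2 + 4) * (responseConst ω₀ γ * S ^ 2) := by
    have hq : HasAvg Θ (fun t => (ω₀ ^ 2 + 4) * ∑ x, meanPos μ t x ^ 2) _ :=
      (HasAvg.sum hΘ.le fun x => (⟨(h.continuousOn_meanPos x).pow 2, rfl⟩ :
        HasAvg Θ (fun t => meanPos μ t x ^ 2) (avg Θ fun t => meanPos μ t x ^ 2))).const_mul
        (ω₀ ^ 2 + 4)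
    refine (ha.mono hΘ hq fun t _ => ?_).trans (mul_le_mul_of_nonneg_left
      (h.sum_avg_meanPos_sq_le hω₀ hγ hΘ) (by positivity))
    refine (dotProduct_stiffness_le ω₀ _).trans (le_of_eq ?_)
    simp [dotProduct, sq]
  -- Virial identity: the mixed covariance is antisymmetric, so its trace drops out of `covPP_eq`.
  have htrQ : ∑ x, ∑ y, stiffness ω₀ x y * covQQ Θ μ x y = (covPP Θ μ).trace := by
    have h1 : (covQP Θ μ).trace = 0 := by
      have := congrArg trace (h.covQP_transpose hΘ.le)
      rw [trace_transpose, trace_neg] at this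
      linarith
    rw [h.covPP_eq hΘ.le, trace_add, trace_smul, h1, smul_zero, add_zero, trace_mul_comm, trace]
    refine Finset.sum_congr rfl fun x _ => ?_
    rw [diag_apply, Matrix.mul_apply]
    refine Finset.sum_congr rfl fun y _ => ?_
    rw [← transpose_apply (covQQ Θ μ), covQQ_transpose]
  have hqq : HasAvg Θ (fun t => ∑ x, ∑ y, stiffness ω₀ x y * momQQ μ t x y)
      ((covPP Θ μ).trace + a) := by
    have h1 := (HasAvg.sum hΘ.le fun x => HasAvg.sum hΘ.le fun y =>
      (h.hasAvg_covQQ x y).const_mul (stiffness ω₀ x y)).add hΘ.le ha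
    rw [htrQ] at h1
    refine ⟨?_, ?_⟩
    · exact continuousOn_finsetSum _ fun x _ => continuousOn_finsetSum _ fun y _ =>
        continuousOn_const.mul (h.continuousOn_momQQ x y)
    · rw [← h1.2]
      congr 1
      funext t
      simp only [dotProduct, mulVec, Finset.mul_sum, ← Finset.sum_add_distrib]
      exact Finset.sum_congr rfl fun x _ => Finset.sum_congr rfl fun y _ => by ring
  have htot := (((HasAvg.sum hΘ.le hpp).const_mul (1 / 2)).add hΘ.le (hqq.const_mul (1 / 2)))
  have hE := HasAvg.sum hΘ.le fun x => (⟨h.continuousOn_energyMean x, rfl⟩ :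
    HasAvg Θ (fun t => energyMean ω₀ μ t x) (avg Θ fun t => energyMean ω₀ μ t x))
  have heq := hE.mono hΘ htot fun t ht => (h.sum_energyMean ht).le
  refine heq.trans ?_
  have hP : ∑ x, (covPP Θ μ x x + s x) = (covPP Θ μ).trace + ∑ x, s x := by
    rw [Finset.sum_add_distrib]; rfl
  rw [hP]
  have hmono : (n + 1) * (T + gradientConst ω₀ γ * (n * ∑ x, s x)) ≤
      (n + 1) * (T + gradientConst ω₀ γ * (n * (responseConst ω₀ γ * L ^ 2))) := by
    have := gradientConst_nonneg ω₀ γ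
    gcongr
  linarith

end IsBoundedState

end Chain

/-! ### The scaling of the force and the conclusion -/

lemma exists_abs_le_of_periodic {g : ℝ → ℝ} (hg : Continuous g) (hp : Function.Periodic g 1) :
    ∃ S, 0 ≤ S ∧ ∀ t, |g t| ≤ S := by
  obtain ⟨S, hS⟩ := isCompact_Icc.exists_bound_of_continuousOn (s := Set.Icc (0 : ℝ) 1)
    hg.continuousOn
  refine ⟨S, (norm_nonneg _).trans (hS 0 (by simp)), fun t => ?_⟩
  have h1 := hS (Int.fract t) ⟨Int.fract_nonneg t, (Int.fract_lt_one t).le⟩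
  have h2 : g (Int.fract t) = g t := by
    have := hp.sub_int_mul_eq (x := t) ⌊t⌋
    rwa [mul_one] at this
  rwa [h2] at h1

end

theorem theorem6p4 (ω₀ γ T θ a b : ℝ) (hω₀ : 0 < ω₀) (hγ : 0 < γ) (hT : 0 < T) (hθ : 0 < θ)
    (𝓕 : ℝ → ℝ) (h𝓕_smooth : ContDiff ℝ ∞ 𝓕) (h𝓕_periodic : Function.Periodic 𝓕 1)
    (h𝓕_mean : ∫ t in (0 : ℝ)..1, 𝓕 t = 0) (h𝓕_sq : 0 < ∫ t in (0 : ℝ)..1, 𝓕 t ^ 2)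
    (h𝓕_fourier : Summable fun ℓ : ℤ => (ℓ : ℝ) ^ 2 * ‖Chain.fourierCoefficient 𝓕 ℓ‖ ^ 2)
    (hab : b - a = 1 / 2) (ha : a ≤ 0) (hb : 0 ≤ b) :
    ∃ C : ℝ, 0 < C ∧ ∀ n : ℕ, 1 ≤ n → ∀ μ : ℝ → Measure (Chain.Phase n),
      Chain.IsPeriodicState ω₀ γ T (Chain.period b θ n) (Chain.force a b θ 𝓕 n) μ →
        (∀ x : Fin (n + 1),
          (∀ t, 0 ≤ t → Integrable (Chain.energy ω₀ x) (μ t)) ∧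
          IntervalIntegrable (fun t => ∫ z, Chain.energy ω₀ x z ∂(μ t)) volume
            0 (Chain.period b θ n)) ∧
        1 / ((n : ℝ) + 1) *
          ∑ x : Fin (n + 1), Chain.timeAverage (Chain.period b θ n) μ (Chain.energy ω₀ x) ≤ C := by
  obtain ⟨S, hS0, hS⟩ := exists_abs_le_of_periodic h𝓕_smooth.continuous h𝓕_periodic
  have hdc : Continuous (deriv 𝓕) := h𝓕_smooth.continuous_deriv (by simp)
  have hdp : Function.Periodic (deriv 𝓕) 1 := fun t => by
    have : (fun s => 𝓕 (s + 1)) = 𝓕 := funext h𝓕_periodic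
    rw [← deriv_comp_add_const, this]
  obtain ⟨R, hR0, hR⟩ := exists_abs_le_of_periodic hdc hdp
  have hr := Chain.responseConst_nonneg ω₀ γ
  have hg := Chain.gradientConst_nonneg ω₀ γ
  refine ⟨T + Chain.gradientConst ω₀ γ * (Chain.responseConst ω₀ γ * (R / θ) ^ 2)
    + 1 / 2 * (Chain.responseConst ω₀ γ * (R / θ) ^ 2)
    + 1 / 2 * ((ω₀ ^ 2 + 4) * (Chain.responseConst ω₀ γ * S ^ 2)), by positivity,
    fun n hn μ hμ => ?_⟩
  have hn1 : (1 : ℝ) ≤ n := by exact_mod_cast hn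
  have hn0 : (0 : ℝ) < n := by linarith
  set Θ := Chain.period b θ n with hΘdef
  set f := Chain.force a b θ 𝓕 n with hfdef
  have hΘ : 0 < Θ := mul_pos (Real.rpow_pos_of_pos hn0 _) hθ
  have hna : 0 ≤ (n : ℝ) ^ a := (Real.rpow_pos_of_pos hn0 _).le
  -- The sign of `a` keeps the force itself bounded uniformly in `n`; this controls the potential
  -- energy of the mean positions.
  have hna1 : (n : ℝ) ^ a ≤ 1 := Real.rpow_le_one_of_one_le_of_nonpos hn1 ha
  have hfc : Continuous f :=
    continuous_const.mul (h𝓕_smooth.continuous.comp (continuous_id.div_const _))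
  have hfS : ∀ t, |f t| ≤ S := fun t => by
    rw [hfdef, Chain.force, abs_mul, abs_of_nonneg hna]
    exact (mul_le_of_le_one_left (abs_nonneg _) hna1).trans (hS _)
  set L := (n : ℝ) ^ a / Θ * R with hLdef
  have hf' : ∀ t, HasDerivAt f ((n : ℝ) ^ a * (deriv 𝓕 (t / Θ) * (1 / Θ))) t := fun t =>
    ((h𝓕_smooth.differentiable (by simp) (t / Θ)).hasDerivAt.comp t
      ((hasDerivAt_id t).div_const Θ)).const_mul _
  have hf'c : Continuous fun t => (n : ℝ) ^ a * (deriv 𝓕 (t / Θ) * (1 / Θ)) :=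
    continuous_const.mul ((hdc.comp (continuous_id.div_const _)).mul continuous_const)
  have hf'L : ∀ t, |(n : ℝ) ^ a * (deriv 𝓕 (t / Θ) * (1 / Θ))| ≤ L := fun t => by
    have h1 : 0 ≤ (n : ℝ) ^ a / Θ := by positivity
    have h2 : (n : ℝ) ^ a * (deriv 𝓕 (t / Θ) * (1 / Θ)) = (n : ℝ) ^ a / Θ * deriv 𝓕 (t / Θ) := by
      ring
    rw [h2, abs_mul, abs_of_nonneg h1, hLdef]
    exact mul_le_mul_of_nonneg_left (hR _) h1
  have hper : f Θ = f 0 := by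
    rw [hfdef, Chain.force, Chain.force, ← hΘdef, div_self hΘ.ne', zero_div]
    congr 1
    simpa using h𝓕_periodic 0
  -- The scaling `b - a = 1/2` enters here: the bound `L` on the derivative of the force is exactly
  -- `n^(-1/2) R / θ`, which balances the factor `n` in the temperature estimate.
  have hnL : n * L ^ 2 = (R / θ) ^ 2 := by
    have h1 : (n : ℝ) ^ b = (n : ℝ) ^ a * (n : ℝ) ^ (1 / 2 : ℝ) := by
      rw [← Real.rpow_add hn0, ← hab]
      ring_nf
    have h2 : ((n : ℝ) ^ (1 / 2 : ℝ)) ^ 2 = n := by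
      rw [← Real.sqrt_eq_rpow, Real.sq_sqrt hn0.le]
    have h3 : (n : ℝ) ^ a ≠ 0 := (Real.rpow_pos_of_pos hn0 _).ne'
    have h4 : (n : ℝ) ^ (1 / 2 : ℝ) ≠ 0 := (Real.rpow_pos_of_pos hn0 _).ne'
    have h5 : L = R / θ / (n : ℝ) ^ (1 / 2 : ℝ) := by
      rw [hLdef, hΘdef, Chain.period, h1]
      field_simp
    rw [h5, div_pow, h2]
    field_simp
  obtain ⟨M, hM0, hM⟩ := hμ.exists_moment_bound hω₀ hγ hT.le hΘ hfc hfS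
  have h : Chain.IsBoundedState ω₀ γ T Θ S M f μ := ⟨hμ, hfc, hfS, hM, hM0⟩
  refine ⟨fun x => ⟨fun t ht => (h.hasMean_energy ht x).1,
    Chain.continuousOn_Ici_intervalIntegrable (h.continuousOn_integral_energy x) hΘ.le⟩, ?_⟩
  have hsum : ∑ x, Chain.timeAverage Θ μ (Chain.energy ω₀ x) =
      ∑ x, Chain.avg Θ fun t => Chain.IsBoundedState.energyMean ω₀ μ t x := by
    refine Finset.sum_congr rfl fun x _ => ?_
    rw [Chain.timeAverage, Chain.avg]
    congr 1
    refine intervalIntegral.integral_congr fun t ht => ?_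
    rw [Set.uIcc_of_le hΘ.le] at ht
    exact (h.hasMean_energy ht.1 x).2
  have hmain := h.sum_avg_energy_le hω₀ hγ hΘ hf' hf'c hf'L hper
  have hnL' : n * (Chain.responseConst ω₀ γ * L ^ 2) =
      Chain.responseConst ω₀ γ * (R / θ) ^ 2 := by rw [← hnL]; ring
  have hL2 : L ^ 2 ≤ (R / θ) ^ 2 := by
    rw [← hnL]; exact le_mul_of_one_le_left (sq_nonneg _) hn1
  rw [hnL'] at hmain
  rw [hsum, one_div_mul_eq_div, div_le_iff₀ (by positivity)]
  refine hmain.trans ?_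
  set X := Chain.responseConst ω₀ γ * (R / θ) ^ 2
  set Y := (ω₀ ^ 2 + 4) * (Chain.responseConst ω₀ γ * S ^ 2)
  have hX : Chain.responseConst ω₀ γ * L ^ 2 ≤ X := mul_le_mul_of_nonneg_left hL2 hr
  have hX0 : 0 ≤ X := by positivity
  have hY0 : 0 ≤ Y := by positivity
  have hnX : 0 ≤ n * X := by positivity
  have hnY : 0 ≤ n * Y := by positivity
  linarith
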